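/- Let $Z$ be a $(2+1)$-dimensional TQFT: it assigns to every closed oriented surface $\Sigma$ a finite-dimensional complex vector space $Z(\Sigma)$, to every orientation-preserving diffeomorphism $f$ of such surfaces an isomorphism $Z(f)$, and to every oriented cobordism $W$ with parametrized boundary a linear map $Z_W$, subject to the usual axioms of a symmetric monoidal functor ($Z(\emptyset)\cong\mathbb C$, $Z(\Sigma\sqcup\Sigma')\cong Z(\Sigma)\otimes Z(\Sigma')$, naturality under diffeomorphisms, gluing, cylinders give identities, multiplicativity under disjoint union). For a closed oriented 3-manifold $M$ let $Z(M)\in\mathbb C$ be the value of $M$ as a cobordism from $\emptyset$ to $\emptyset$. Define diffeomorphisms of the torus $S^1\times S^1$ (with $S^1\subset\mathbb C$) by $S(z,w)=(\bar w,z)$, $T(z,w)=(zw,w)$, and $U:S^1\times S^1\to -S^1\times S^1$ by $U(z,w)=(z,\bar w)$. The fusion algebra is $Z(S^1\times S^1)$ with the product $Z_W$, where $W=Y\times S^1$ is regarded as a cobordism from $C_1\times S^1\sqcup C_2\times S^1$ to $C_3\times S^1$ and $Y$ is the disk with two holes, with inner boundary circles $C_1,C_2$ and outer boundary circle $C_3$;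 its identity element is $Z_{W_0}(1)$ for $W_0=(D^2\times S^1;\emptyset,S^1\times S^1)$. A basis $v_0,\dots,v_m$ of $Z(S^1\times S^1)$, with $Z(S)v_i=\sum_j S_{ji}v_j$, is a Verlinde basis if: (i) $v_0$ is the identity element of the fusion algebra; (ii) the matrix $(S_{ij})$ is unitary and symmetric, $Z(S)^2v_0=v_0$, $Z(S)^2v_i\in\{v_0,\dots,v_m\}$ for all $i$, $S_{i0}\neq0$ for all $i$, and $N_{ij}^k=\sum_l S_{il}S_{jl}\overline{S_{lk}}/S_{0l}$ are the structure constants of the fusion algebra in this basis; (iii) $Z(T)$ is diagonal in this basis; (iv) $Z(U)v_i=v_i^*$ for all $i$ under the identification $Z(-S^1\times S^1)\cong Z(S^1\times S^1)^*$ given by the cylinder. Let $v_0,\dots,v_m$ be a Verlinde basis and write $Z(T)v_i=t_iv_i$. Let $r\ge 0$, let $q,p_1,\dots,p_r$ be integers, and let $L(q,p_1,\dots,p_r)\subset S^3$ be the framed link that consists of an unknot with integral framing $q$ and $r$ parallel, mutually unlinked meridian circles of it with integral framings $p_1,\dots,p_r$. If the closed oriented 3-manifold $M$ is obtained from $S^3$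 by Dehn surgery along $L(q,p_1,\dots,p_r)$, then $$Z(M)=\sum_{i_1,\dots,i_r,j=0}^m t_{i_1}^{p_1}\cdots t_{i_r}^{p_r}\,t_j^{q}\;\frac{S_{i_10}\cdots S_{i_r0}\,S_{i_1j}\cdots S_{i_rj}}{S_{j0}^{\,r-2}}.$$ -/

import Mathlib

open scoped Manifold ContDiff Topology TensorProduct
open Module

namespace TQFT3

/-- A linear map between oriented vector spaces is an isomorphism that
carries the first orientation to the second. -/
def Carries {n : ℕ} {V W : Type} [NormedAddCommGroup V] [NormedSpace ℝ V]
    [NormedAddCommGroup W] [NormedSpace ℝ W] (L : V →L[ℝ] W)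
    (a : Orientation ℝ V (Fin n)) (b : Orientation ℝ W (Fin n)) : Prop :=
  ∃ e : V ≃ₗ[ℝ] W, (∀ v, e v = L v) ∧ Orientation.map (Fin n) e a = b

section LinearAlgebra

variable {m n : ℕ} {V W V' W' : Type} [NormedAddCommGroup V] [NormedSpace ℝ V]
  [NormedAddCommGroup W] [NormedSpace ℝ W] [NormedAddCommGroup V'] [NormedSpace ℝ V']
  [NormedAddCommGroup W'] [NormedSpace ℝ W']

theorem carries_id (a : Orientation ℝ V (Fin n)) : Carries (ContinuousLinearMap.id ℝ V) a a :=
  ⟨LinearEquiv.refl ℝ V, fun _ => rfl, by simp⟩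

theorem Carries.comp {U : Type} [NormedAddCommGroup U] [NormedSpace ℝ U]
    {L : V →L[ℝ] W} {K : W →L[ℝ] U} {a : Orientation ℝ V (Fin n)}
    {b : Orientation ℝ W (Fin n)} {c : Orientation ℝ U (Fin n)}
    (hK : Carries K b c) (hL : Carries L a b) : Carries (K.comp L) a c := by
  obtain ⟨e, he, rfl⟩ := hL
  obtain ⟨f, hf, rfl⟩ := hK
  refine ⟨e.trans f, fun v => by simp [he, hf], ?_⟩
  induction a using Module.Ray.ind with | h g hg => rfl

theorem Carries.neg {L : V →L[ℝ] W} {a : Orientation ℝ V (Fin n)}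
    {b : Orientation ℝ W (Fin n)} (h : Carries L a b) : Carries L (-a) (-b) := by
  obtain ⟨e, he, rfl⟩ := h
  exact ⟨e, he, by simp⟩

theorem orientation_eq_ray (u : Basis (Fin n) ℝ V) (η : V [⋀^Fin n]→ₗ[ℝ] ℝ) (hη : η ≠ 0)
    (h : 0 < η u) : u.orientation = rayOfNeZero ℝ η hη := by
  rw [Basis.orientation, ray_eq_iff]
  conv => rhs; rw [η.eq_smul_basis_det u]
  exact SameRay.sameRay_pos_smul_right _ h

theorem prod_basis_orientation {b₁ c₁ : Basis (Fin m) ℝ V} {b₂ c₂ : Basis (Fin n) ℝ W}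
    (h₁ : b₁.orientation = c₁.orientation) (h₂ : b₂.orientation = c₂.orientation) :
    ((b₁.prod b₂).reindex finSumFinEquiv).orientation =
      ((c₁.prod c₂).reindex finSumFinEquiv).orientation := by
  have := b₁.finiteDimensional_of_finite
  have := b₂.finiteDimensional_of_finite
  set e₁ := b₁.equiv c₁ (Equiv.refl _)
  set e₂ := b₂.equiv c₂ (Equiv.refl _)
  have hc₁ : b₁.map e₁ = c₁ := by ext; simp [e₁]
  have hc₂ : b₂.map e₂ = c₂ := by ext; simp [e₂]
  have d₁ : 0 < LinearMap.det (e₁ : V →ₗ[ℝ] V) := by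
    rw [← b₁.orientation_comp_linearEquiv_eq_iff_det_pos, hc₁, h₁]
  have d₂ : 0 < LinearMap.det (e₂ : W →ₗ[ℝ] W) := by
    rw [← b₂.orientation_comp_linearEquiv_eq_iff_det_pos, hc₂, h₂]
  have hc : (c₁.prod c₂).reindex finSumFinEquiv =
      ((b₁.prod b₂).reindex finSumFinEquiv).map (e₁.prodCongr e₂) := by
    refine Basis.eq_of_apply_eq fun i => ?_
    obtain ⟨i, rfl⟩ := finSumFinEquiv.surjective i
    rcases i with i | i <;> simp [e₁, e₂]
  rw [hc, eq_comm, Basis.orientation_comp_linearEquiv_eq_iff_det_pos]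
  have : ((e₁.prodCongr e₂ : (V × W) ≃ₗ[ℝ] V × W) : (V × W) →ₗ[ℝ] V × W) =
      (e₁ : V →ₗ[ℝ] V).prodMap (e₂ : W →ₗ[ℝ] W) := rfl
  rw [this, LinearMap.det_prodMap]
  exact mul_pos d₁ d₂

/-- The product orientation: a positive basis of the first factor followed by a positive basis
of the second is positive. -/
noncomputable def prodOrientation [NeZero m] [NeZero n] [FiniteDimensional ℝ V]
    [FiniteDimensional ℝ W] (hV : finrank ℝ V = m) (hW : finrank ℝ W = n)
    (a : Orientation ℝ V (Fin m)) (b : Orientation ℝ W (Fin n)) :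
    Orientation ℝ (V × W) (Fin (m + n)) :=
  (((a.someBasis (by simp [hV])).prod (b.someBasis (by simp [hW]))).reindex
    finSumFinEquiv).orientation

theorem prodOrientation_eq [NeZero m] [NeZero n] [FiniteDimensional ℝ V]
    [FiniteDimensional ℝ W] (hV : finrank ℝ V = m) (hW : finrank ℝ W = n)
    (b₁ : Basis (Fin m) ℝ V) (b₂ : Basis (Fin n) ℝ W) :
    prodOrientation hV hW b₁.orientation b₂.orientation =
      ((b₁.prod b₂).reindex finSumFinEquiv).orientation :=
  prod_basis_orientation (Orientation.someBasis_orientation _ _)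
    (Orientation.someBasis_orientation _ _)

theorem exists_basis [NeZero n] [FiniteDimensional ℝ V] (hV : finrank ℝ V = n)
    (a : Orientation ℝ V (Fin n)) : ∃ b : Basis (Fin n) ℝ V, b.orientation = a :=
  ⟨a.someBasis (by simp [hV]), Orientation.someBasis_orientation _ _⟩

theorem Carries.prodMap [NeZero m] [NeZero n] [FiniteDimensional ℝ V]
    [FiniteDimensional ℝ W] [FiniteDimensional ℝ V'] [FiniteDimensional ℝ W']
    (hV : finrank ℝ V = m) (hW : finrank ℝ W = n)
    (hV' : finrank ℝ V' = m) (hW' : finrank ℝ W' = n)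
    {L : V →L[ℝ] V'} {K : W →L[ℝ] W'}
    {a : Orientation ℝ V (Fin m)} {b : Orientation ℝ W (Fin n)}
    {a' : Orientation ℝ V' (Fin m)} {b' : Orientation ℝ W' (Fin n)}
    (hL : Carries L a a') (hK : Carries K b b') :
    Carries (L.prodMap K) (prodOrientation hV hW a b) (prodOrientation hV' hW' a' b') := by
  obtain ⟨e, he, rfl⟩ := hL
  obtain ⟨f, hf, rfl⟩ := hK
  obtain ⟨b₁, rfl⟩ := exists_basis hV a
  obtain ⟨b₂, rfl⟩ := exists_basis hW b
  refine ⟨e.prodCongr f, fun v => Prod.ext (he _) (hf _), ?_⟩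
  rw [← Basis.orientation_map, ← Basis.orientation_map, prodOrientation_eq, prodOrientation_eq,
    ← Basis.orientation_map]
  refine congrArg _ ?_
  refine Basis.eq_of_apply_eq fun i => ?_
  obtain ⟨i, rfl⟩ := finSumFinEquiv.surjective i
  rcases i with i | i <;> simp

end LinearAlgebra

/-- The derivative of a map of manifolds, as a linear map of the model vector spaces (a tangent
space is by definition the model vector space). -/
noncomputable def derivAt {E H E' H' M M' : Type} [NormedAddCommGroup E] [NormedSpace ℝ E]
    [TopologicalSpace H] [NormedAddCommGroup E'] [NormedSpace ℝ E'] [TopologicalSpace H']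
    [TopologicalSpace M] [ChartedSpace H M] [TopologicalSpace M'] [ChartedSpace H' M']
    (I : ModelWithCorners ℝ E H) (I' : ModelWithCorners ℝ E' H') (f : M → M') (x : M) :
    E →L[ℝ] E' :=
  mfderiv I I' f x

section Derivative

variable {E H E' H' E'' H'' M M' M'' : Type} [NormedAddCommGroup E] [NormedSpace ℝ E]
    [TopologicalSpace H] [NormedAddCommGroup E'] [NormedSpace ℝ E'] [TopologicalSpace H']
    [NormedAddCommGroup E''] [NormedSpace ℝ E''] [TopologicalSpace H'']
    [TopologicalSpace M] [ChartedSpace H M] [TopologicalSpace M'] [ChartedSpace H' M']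
    [TopologicalSpace M''] [ChartedSpace H'' M'']
    {I : ModelWithCorners ℝ E H} {I' : ModelWithCorners ℝ E' H'} {I'' : ModelWithCorners ℝ E'' H''}

theorem derivAt_comp {g : M' → M''} {f : M → M'} {x : M} (hg : MDifferentiableAt I' I'' g (f x))
    (hf : MDifferentiableAt I I' f x) :
    derivAt I I'' (g ∘ f) x = (derivAt I' I'' g (f x)).comp (derivAt I I' f x) :=
  mfderiv_comp x hg hf

theorem derivAt_id (x : M) : derivAt I I id x = ContinuousLinearMap.id ℝ E :=
  mfderiv_id

end Derivative

/-- An oriented smooth `n`-manifold without boundary (not necessarily compact or connected).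
`orient x` is an orientation of the tangent space at `x`, and in the charts it is locally
constant. -/
structure OrientedManifold (n : ℕ) where
  carrier : Type
  E : Type
  H : Type
  [topology : TopologicalSpace carrier]
  [normedAddCommGroup : NormedAddCommGroup E]
  [normedSpace : NormedSpace ℝ E]
  [finiteDimensional : FiniteDimensional ℝ E]
  [topologyH : TopologicalSpace H]
  I : ModelWithCorners ℝ E H
  [boundaryless : I.Boundaryless]
  [chartedSpace : ChartedSpace H carrier]
  [isManifold : IsManifold I ∞ carrier]
  [t2 : T2Space carrier]
  [secondCountable : SecondCountableTopology carrier]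
  finrank_eq : finrank ℝ E = n
  orient : carrier → Orientation ℝ E (Fin n)
  orient_locally_const : ∀ x₀, ∃ a₀ : Orientation ℝ E (Fin n), ∀ᶠ x in 𝓝 x₀,
    Carries (derivAt I 𝓘(ℝ, E) (extChartAt I x₀) x) (orient x) a₀

namespace OrientedManifold

instance (n : ℕ) : CoeSort (OrientedManifold n) Type := ⟨carrier⟩

attribute [instance] topology normedAddCommGroup normedSpace finiteDimensional topologyH
  boundaryless chartedSpace isManifold t2 secondCountable

/-- `M` with the opposite orientation. -/
def neg {n : ℕ} (M : OrientedManifold n) : OrientedManifold n :=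
  { M with
    orient := fun x => -M.orient x
    orient_locally_const := fun x₀ => by
      obtain ⟨a₀, h⟩ := M.orient_locally_const x₀
      exact ⟨-a₀, h.mono fun x hx => hx.neg⟩ }

/-- The product of two oriented manifolds of positive dimension, with the product orientation. -/
noncomputable def prod {m n : ℕ} [NeZero m] [NeZero n] (M : OrientedManifold m) (N : OrientedManifold n) :
    OrientedManifold (m + n) where
  carrier := M × N
  E := M.E × N.E
  H := ModelProd M.H N.H
  I := M.I.prod N.I
  finrank_eq := by simp [M.finrank_eq, N.finrank_eq]
  orient := fun x => prodOrientation M.finrank_eq N.finrank_eq (M.orient x.1) (N.orient x.2)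
  orient_locally_const := fun x₀ => by
    obtain ⟨a₁, h₁⟩ := M.orient_locally_const x₀.1
    obtain ⟨a₂, h₂⟩ := N.orient_locally_const x₀.2
    refine ⟨prodOrientation M.finrank_eq N.finrank_eq a₁ a₂, ?_⟩
    have hs₁ := extChartAt_source_mem_nhds (I := M.I) x₀.1
    have hs₂ := extChartAt_source_mem_nhds (I := N.I) x₀.2
    have := ((h₁.and hs₁).prod_nhds (h₂.and hs₂))
    filter_upwards [this] with x hx
    have m₁ : x.1 ∈ (extChartAt M.I x₀.1).source := hx.1.2
    have m₂ : x.2 ∈ (extChartAt N.I x₀.2).source := hx.2.2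
    have key : derivAt (M.I.prod N.I) 𝓘(ℝ, M.E × N.E) (extChartAt (M.I.prod N.I) x₀) x =
        (derivAt M.I 𝓘(ℝ, M.E) (extChartAt M.I x₀.1) x.1).prodMap
          (derivAt N.I 𝓘(ℝ, N.E) (extChartAt N.I x₀.2) x.2) := by
      have e1 : (extChartAt (M.I.prod N.I) x₀ : M × N → M.E × N.E) =
          Prod.map (extChartAt M.I x₀.1) (extChartAt N.I x₀.2) := by
        rw [extChartAt_prod]; rfl
      rw [e1, modelWithCornersSelf_prod, ← chartedSpaceSelf_prod]
      have d1 : MDifferentiableAt M.I 𝓘(ℝ, M.E) (extChartAt M.I x₀.1) x.1 :=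
        (contMDiffAt_extChartAt' (n := ∞) (by simpa using m₁)).mdifferentiableAt (by simp)
      have d2 : MDifferentiableAt N.I 𝓘(ℝ, N.E) (extChartAt N.I x₀.2) x.2 :=
        (contMDiffAt_extChartAt' (n := ∞) (by simpa using m₂)).mdifferentiableAt (by simp)
      exact (d1.hasMFDerivAt.prodMap d2.hasMFDerivAt).mfderiv
    rw [key]
    exact hx.1.1.prodMap _ _ _ _ hx.2.1

end OrientedManifold

section Hypersurface

variable {n : ℕ} {V : Type} [NormedAddCommGroup V] [NormedSpace ℝ V]
  {E H M : Type} [NormedAddCommGroup E] [NormedSpace ℝ E]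
  [TopologicalSpace H] [TopologicalSpace M] [ChartedSpace H M]

/-- For a map `f` from a manifold to a vector space with basis `B`, the alternating form
`(v₁, …, vₙ) ↦ det_B (f x, df v₁, …, df vₙ)` on the tangent space at `x`. -/
noncomputable def positionForm (I : ModelWithCorners ℝ E H) (B : Basis (Fin (n + 1)) ℝ V)
    (f : M → V) (x : M) : E [⋀^Fin n]→ₗ[ℝ] ℝ :=
  (B.det.curryLeft (f x)).compLinearMap
    (derivAt I 𝓘(ℝ, V) f x : E →ₗ[ℝ] V)

theorem positionForm_apply (I : ModelWithCorners ℝ E H) (B : Basis (Fin (n + 1)) ℝ V)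
    (f : M → V) (x : M) (v : Fin n → E) :
    positionForm I B f x v = B.det (Matrix.vecCons (f x) fun i => derivAt I 𝓘(ℝ, V) f x (v i)) :=
  rfl

theorem positionForm_locally_const [FiniteDimensional ℝ E] (I : ModelWithCorners ℝ E H) [I.Boundaryless]
    [IsManifold I ∞ M] (hE : finrank ℝ E = n)
    (B : Basis (Fin (n + 1)) ℝ V) (f : M → V) (hf : ContMDiff I 𝓘(ℝ, V) ∞ f)
    (h0 : ∀ x, positionForm I B f x ≠ 0) (x₀ : M) :
    ∃ a₀ : Orientation ℝ E (Fin n), ∀ᶠ x in 𝓝 x₀,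
      Carries (derivAt I 𝓘(ℝ, E) (extChartAt I x₀) x)
        (rayOfNeZero ℝ (positionForm I B f x) (h0 x)) a₀ := by
  set φ := extChartAt I x₀ with hφ
  set F : E → V := f ∘ φ.symm with hF
  have hopen : IsOpen φ.target := isOpen_extChartAt_target x₀
  have hFs : ContDiffOn ℝ ∞ F φ.target := by
    rw [← contMDiffOn_iff_contDiffOn]
    exact hf.comp_contMDiffOn (contMDiffOn_extChartAt_symm x₀)
  let ζ : E → E [⋀^Fin n]→ₗ[ℝ] ℝ := fun y =>
    (B.det.curryLeft (F y)).compLinearMap (fderiv ℝ F y : E →ₗ[ℝ] V)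
  have hD : ∀ x ∈ φ.source, ∃ e : E ≃ₗ[ℝ] E, (∀ v, e v = derivAt I 𝓘(ℝ, E) φ x v) ∧
      (positionForm I B f x).compLinearMap (e.symm : E →ₗ[ℝ] E) = ζ (φ x) := by
    intro x hx
    obtain ⟨e, he⟩ : (derivAt I 𝓘(ℝ, E) φ x).IsInvertible :=
      isInvertible_mfderiv_extChartAt (I := I) hx
    have he' : ∀ v : E, e v = derivAt I 𝓘(ℝ, E) φ x v := fun v =>
      congrArg (fun L : E →L[ℝ] E => L v) he
    refine ⟨e.toLinearEquiv, he', ?_⟩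
    have hy : φ x ∈ φ.target := φ.map_source hx
    have hFd : DifferentiableAt ℝ F (φ x) :=
      (hFs.contDiffAt (hopen.mem_nhds hy)).differentiableAt (by simp)
    have hφd : MDifferentiableAt I 𝓘(ℝ, E) φ x := mdifferentiableAt_extChartAt (by simpa [hφ] using hx)
    have hfx : derivAt I 𝓘(ℝ, V) f x = (fderiv ℝ F (φ x)).comp (derivAt I 𝓘(ℝ, E) φ x) := by
      have h1 : derivAt I 𝓘(ℝ, V) (F ∘ φ) x =
          (derivAt 𝓘(ℝ, E) 𝓘(ℝ, V) F (φ x)).comp (derivAt I 𝓘(ℝ, E) φ x) :=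
        derivAt_comp hFd.mdifferentiableAt hφd
      have h2 : derivAt 𝓘(ℝ, E) 𝓘(ℝ, V) F (φ x) = fderiv ℝ F (φ x) := mfderiv_eq_fderiv
      have h3 : derivAt I 𝓘(ℝ, V) (F ∘ φ) x = derivAt I 𝓘(ℝ, V) f x := by
        refine Filter.EventuallyEq.mfderiv_eq ?_
        filter_upwards [extChartAt_source_mem_nhds' (I := I) hx] with z hz
        simp [hF, φ.left_inv hz]
      rw [← h3, h1, h2]
    have hFx : F (φ x) = f x := by simp [hF, φ.left_inv hx]
    ext v
    simp only [AlternatingMap.compLinearMap_apply, positionForm, ζ, hFx, hfx]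
    congr 1
    ext i
    have := he' (e.symm (v i))
    simp only [ContinuousLinearEquiv.apply_symm_apply] at this
    change (fderiv ℝ F (φ x)) (derivAt I 𝓘(ℝ, E) φ x (e.symm (v i))) = _
    rw [← this]
    rfl
  let b : Basis (Fin n) ℝ E := finBasisOfFinrankEq ℝ E hE
  have hx₀ : x₀ ∈ φ.source := mem_extChartAt_source x₀
  have hζ0 : ∀ x ∈ φ.source, ζ (φ x) ≠ 0 := by
    intro x hx
    obtain ⟨e, -, he⟩ := hD x hx
    rw [← he]
    exact mt ((positionForm I B f x).compLinearEquiv_eq_zero_iff e.symm).mp (h0 x)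
  have hζb : ∀ x ∈ φ.source, ζ (φ x) b ≠ 0 := by
    intro x hx h
    apply hζ0 x hx
    rw [(ζ (φ x)).eq_smul_basis_det b, h, zero_smul]
  have hcont : ContinuousAt (fun y => ζ y b) (φ x₀) := by
    have hy : φ.target ∈ 𝓝 (φ x₀) := hopen.mem_nhds (φ.map_source hx₀)
    have hF1 := hFs.contDiffAt hy
    have c1 : ContinuousAt F (φ x₀) := hF1.continuousAt
    have c2 : ContinuousAt (fderiv ℝ F) (φ x₀) :=
      (hF1.fderiv_right (m := 0) (by simp)).continuousAt
    have : FiniteDimensional ℝ V := B.finiteDimensional_of_finite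
    have hdet : Continuous fun w : Fin (n + 1) → V => B.det w := by
      simp only [Basis.det_apply]
      refine Continuous.matrix_det (continuous_matrix fun i j => ?_)
      exact (LinearMap.continuous_of_finiteDimensional (B.coord i)).comp (continuous_apply j)
    have : ContinuousAt (fun y => (Matrix.vecCons (F y) fun i => fderiv ℝ F y (b i) :
        Fin (n + 1) → V)) (φ x₀) := by
      refine continuousAt_pi.2 fun i => ?_
      refine Fin.cases ?_ (fun i => ?_) i
      · simpa using c1
      · simpa using c2.clm_apply continuousAt_const
    exact hdet.continuousAt.comp this
  refine ⟨rayOfNeZero ℝ (ζ (φ x₀)) (hζ0 x₀ hx₀), ?_⟩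
  have hpos : ∀ᶠ x in 𝓝 x₀, 0 < ζ (φ x) b * ζ (φ x₀) b := by
    have h1 : ContinuousAt (fun x => ζ (φ x) b * ζ (φ x₀) b) x₀ :=
      (hcont.comp (continuousAt_extChartAt (I := I) x₀)).mul continuousAt_const
    exact h1.eventually (lt_mem_nhds (mul_self_pos.2 (hζb x₀ hx₀)))
  filter_upwards [hpos, extChartAt_source_mem_nhds (I := I) x₀] with x hx hxs
  obtain ⟨e, he, he'⟩ := hD x hxs
  refine ⟨e, he, ?_⟩
  rw [Orientation.map_apply, ray_eq_iff, he', (ζ (φ x)).eq_smul_basis_det b,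
    (ζ (φ x₀)).eq_smul_basis_det b]
  have h0' := hζb x₀ hx₀
  have : ζ (φ x) b • b.det = (ζ (φ x) b / ζ (φ x₀) b) • ζ (φ x₀) b • b.det := by
    rw [smul_smul, div_mul_cancel₀ _ h0']
  rw [this]
  refine SameRay.sameRay_pos_smul_left _ ?_
  have : ζ (φ x) b / ζ (φ x₀) b = ζ (φ x) b * ζ (φ x₀) b / (ζ (φ x₀) b * ζ (φ x₀) b) := by
    field_simp
  rw [this]
  exact div_pos hx (mul_self_pos.2 h0')

end Hypersurface

theorem positionForm_sphere_ne_zero {n : ℕ} {V : Type} [NormedAddCommGroup V]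
    [InnerProductSpace ℝ V] [Fact (finrank ℝ V = n + 1)] (B : Basis (Fin (n + 1)) ℝ V)
    (x : Metric.sphere (0 : V) 1) : positionForm (𝓡 n) B Subtype.val x ≠ 0 := by
  intro h
  let b := (EuclideanSpace.basisFun (Fin n) ℝ).toBasis
  set L : EuclideanSpace ℝ (Fin n) →L[ℝ] V := derivAt (𝓡 n) 𝓘(ℝ, V) Subtype.val x with hL
  have hinj : Function.Injective L := injective_mvfderiv_subtypeVal_sphere x
  have hrange : L.range = (Submodule.span ℝ {(x : V)})ᗮ := range_mvfderiv_subtypeVal x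
  have hb := congrArg (fun η : (EuclideanSpace ℝ (Fin n)) [⋀^Fin n]→ₗ[ℝ] ℝ => η b) h
  simp only [positionForm_apply, AlternatingMap.zero_apply] at hb
  have hli : LinearIndependent ℝ (Matrix.vecCons (x : V) fun i => L (b i)) := by
    refine linearIndependent_finCons.2 ⟨?_, fun hx => ?_⟩
    · exact b.linearIndependent.map' (L : EuclideanSpace ℝ (Fin n) →ₗ[ℝ] V)
        (LinearMap.ker_eq_bot.2 hinj)
    · have : (x : V) ∈ L.range := by
        refine Submodule.span_le.2 ?_ hx
        rintro _ ⟨i, rfl⟩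
        exact ⟨b i, rfl⟩
      rw [hrange, Submodule.mem_orthogonal_singleton_iff_inner_right, real_inner_self_eq_norm_sq] at this
      have hx1 : ‖(x : V)‖ = 1 := by simp
      rw [hx1] at this
      norm_num at this
  have : FiniteDimensional ℝ V := B.finiteDimensional_of_finite
  have hspan : Submodule.span ℝ (Set.range (Matrix.vecCons (x : V) fun i => L (b i))) = ⊤ :=
    hli.span_eq_top_of_card_eq_finrank' (by simp [(Fact.out : finrank ℝ V = n + 1)])
  exact ((B.is_basis_iff_det).1 ⟨hli, hspan⟩).ne_zero hb

namespace OrientedManifold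

/-- A vector space, oriented by a basis. -/
noncomputable def ofBasis {n : ℕ} {V : Type} [NormedAddCommGroup V] [NormedSpace ℝ V]
    [FiniteDimensional ℝ V] (b : Basis (Fin n) ℝ V) : OrientedManifold n where
  carrier := V
  E := V
  H := V
  I := 𝓘(ℝ, V)
  finrank_eq := by simp [finrank_eq_card_basis b]
  orient := fun _ => b.orientation
  orient_locally_const := fun x₀ => ⟨b.orientation, Filter.Eventually.of_forall fun x => by
    have : derivAt 𝓘(ℝ, V) 𝓘(ℝ, V) (extChartAt 𝓘(ℝ, V) x₀) x = ContinuousLinearMap.id ℝ V := by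
      rw [extChartAt_self_eq]
      exact derivAt_id x
    rw [this]
    exact carries_id _⟩

/-- The real line. -/
noncomputable def line : OrientedManifold 1 := ofBasis (Basis.singleton (Fin 1) ℝ)

/-- The complex plane, oriented by `1, i`. -/
noncomputable def plane : OrientedManifold 2 := ofBasis Complex.basisOneI

attribute [local instance] finrank_real_complex_fact'

/-- The circle `S¹ ⊆ ℂ`, oriented counterclockwise (outward normal first). -/
noncomputable def circle : OrientedManifold 1 where
  carrier := Circle
  E := EuclideanSpace ℝ (Fin 1)
  H := EuclideanSpace ℝ (Fin 1)
  I := 𝓡 1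
  isManifold := .of_le (n := ω) le_top
  finrank_eq := by simp
  orient := fun x => rayOfNeZero ℝ
    (positionForm (𝓡 1) Complex.basisOneI (fun z : Circle => (z : ℂ)) x)
    (positionForm_sphere_ne_zero (V := ℂ) Complex.basisOneI x)
  orient_locally_const := positionForm_locally_const (𝓡 1) (by simp) _ _
    (contMDiff_coe_sphere (E := ℂ)) _

/-- The standard basis of `ℝ⁴ = ℂ²`. -/
noncomputable def basisR4 : Basis (Fin 4) ℝ (EuclideanSpace ℝ (Fin 4)) :=
  (EuclideanSpace.basisFun (Fin 4) ℝ).toBasis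

theorem finrank_R4 : Fact (finrank ℝ (EuclideanSpace ℝ (Fin 4)) = 3 + 1) := ⟨by simp⟩

attribute [local instance] finrank_R4

/-- The 3-sphere `S³ ⊆ ℝ⁴ = ℂ²`, oriented as the boundary of the ball (outward normal first). -/
noncomputable def sphere3 : OrientedManifold 3 where
  carrier := Metric.sphere (0 : EuclideanSpace ℝ (Fin 4)) 1
  E := EuclideanSpace ℝ (Fin 3)
  H := EuclideanSpace ℝ (Fin 3)
  I := 𝓡 3
  isManifold := .of_le (n := ω) le_top
  finrank_eq := by simp
  orient := fun x => rayOfNeZero ℝ (positionForm (𝓡 3) basisR4 Subtype.val x)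
    (positionForm_sphere_ne_zero basisR4 x)
  orient_locally_const := positionForm_locally_const (𝓡 3) (by simp) _ _
    contMDiff_coe_sphere _

end OrientedManifold

open OrientedManifold

/-- `f` restricts to an orientation-preserving smooth embedding of the open set `U` (an injective
smooth map with invertible orientation-preserving derivatives between manifolds of the same
dimension is a diffeomorphism onto an open set). -/
structure IsOrientedEmbOn {n : ℕ} (M N : OrientedManifold n) (f : M → N) (U : Set M) : Prop where
  isOpen : IsOpen U
  injOn : Set.InjOn f U
  contMDiffOn : ContMDiffOn M.I N.I ∞ f U
  carries : ∀ x ∈ U, Carries (derivAt M.I N.I f x) (M.orient x) (N.orient (f x))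

/-- `f` restricts to an orientation-preserving smooth embedding of a neighbourhood of `X`. -/
def IsOrientedEmbNear {n : ℕ} (M N : OrientedManifold n) (f : M → N) (X : Set M) : Prop :=
  ∃ U, X ⊆ U ∧ IsOrientedEmbOn M N f U

/-- Orientation-preserving diffeomorphisms. -/
structure OrientedDiffeo {n : ℕ} (M N : OrientedManifold n) extends
    Diffeomorph M.I N.I M N ∞ where
  carries : ∀ x, Carries (derivAt M.I N.I toFun x) (M.orient x) (N.orient (toFun x))

namespace OrientedDiffeo

instance {n : ℕ} (M N : OrientedManifold n) : CoeFun (OrientedDiffeo M N) (fun _ => M → N) :=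
  ⟨fun f => f.toFun⟩

/-- The identity. -/
noncomputable def refl {n : ℕ} (M : OrientedManifold n) : OrientedDiffeo M M where
  toDiffeomorph := Diffeomorph.refl M.I M ∞
  carries := fun x => by
    change Carries (derivAt M.I M.I id x) _ _
    rw [derivAt_id]
    exact carries_id _

/-- Composition: first `f`, then `g`. -/
noncomputable def trans {n : ℕ} {M N P : OrientedManifold n} (f : OrientedDiffeo M N) (g : OrientedDiffeo N P) :
    OrientedDiffeo M P where
  toDiffeomorph := f.toDiffeomorph.trans g.toDiffeomorph
  carries := fun x => by
    change Carries (derivAt M.I P.I (g ∘ f) x) _ _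
    have h : derivAt M.I P.I (g ∘ f) x = (derivAt N.I P.I g (f x)).comp (derivAt M.I N.I f x) :=
      derivAt_comp (g.contMDiff_toFun.mdifferentiableAt (by simp))
        (f.contMDiff_toFun.mdifferentiableAt (by simp))
    rw [h]
    exact (g.carries (f x)).comp (f.carries x)

end OrientedDiffeo

/-- Closed oriented smooth `n`-manifolds, possibly empty or disconnected. -/
structure ClosedManifold (n : ℕ) extends OrientedManifold n where
  [compact : CompactSpace carrier]

attribute [instance] ClosedManifold.compact

instance (n : ℕ) : CoeSort (ClosedManifold n) Type := ⟨fun M => M.carrier⟩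

instance (n : ℕ) : Coe (ClosedManifold n) (OrientedManifold n) := ⟨fun M => M.toOrientedManifold⟩

/-- A closed oriented manifold with the opposite orientation. -/
def ClosedManifold.neg {n : ℕ} (M : ClosedManifold n) : ClosedManifold n where
  toOrientedManifold := M.toOrientedManifold.neg
  compact := M.compact

/-- Orientation-preserving diffeomorphisms of closed surfaces. -/
abbrev SurfaceDiffeo (S S' : ClosedManifold 2) : Type :=
  OrientedDiffeo S.toOrientedManifold S'.toOrientedManifold

/-- The empty surface. -/
noncomputable def emptySurface : ClosedManifold 2 where
  carrier := Empty
  E := EuclideanSpace ℝ (Fin 2)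
  H := EuclideanSpace ℝ (Fin 2)
  I := 𝓡 2
  chartedSpace := ChartedSpace.empty _ _
  isManifold := by
    let := ChartedSpace.empty (EuclideanSpace ℝ (Fin 2)) Empty
    exact IsManifold.empty (M := Empty) (I := 𝓡 2) ∞
  finrank_eq := by simp
  orient := fun x => x.elim
  orient_locally_const := fun x => x.elim

/-- The torus `S¹ × S¹`. -/
noncomputable def torus : ClosedManifold 2 where
  toOrientedManifold := circle.prod circle
  compact := inferInstanceAs (CompactSpace (Circle × Circle))

/-- `C` is the disjoint union of `A` and `B`, included by `i₁` and `i₂`. -/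
structure DisjUnion {n : ℕ} (A B C : ClosedManifold n) where
  i₁ : A → C
  i₂ : B → C
  emb₁ : IsOrientedEmbOn A.toOrientedManifold C i₁ Set.univ
  emb₂ : IsOrientedEmbOn B.toOrientedManifold C i₂ Set.univ
  isCompl : IsCompl (Set.range i₁) (Set.range i₂)

/-- `f : S → N` parametrizes outgoing boundary components of the domain `X ⊆ N`: there is a
collar `S × (-ε, ε) → N` of `f` in which `X` is `S × (-ε, 0]`; so `X` is a smooth domain there, and
`f` preserves the orientation, the boundary being oriented by the outward normal. -/
def IsOutgoing (S : OrientedManifold 2) (N : OrientedManifold 3) (X : Set N) (f : S → N) : Prop :=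
  ∃ ε > 0, ∃ c : S × ℝ → N, IsOrientedEmbOn (S.prod line) N c {p : S × ℝ | |p.2| < ε} ∧
    (∀ x, c (x, 0) = f x) ∧ ∀ x t, |t| < ε → (c (x, t) ∈ X ↔ t ≤ 0)

/-- `f : S → N` parametrizes incoming boundary components of `X`: as before, but in the collar `X`
is `S × [0, ε)`, and so `f` reverses the orientation. -/
def IsIncoming (S : OrientedManifold 2) (N : OrientedManifold 3) (X : Set N) (f : S → N) : Prop :=
  ∃ ε > 0, ∃ c : S × ℝ → N, IsOrientedEmbOn (S.prod line) N c {p : S × ℝ | |p.2| < ε} ∧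
    (∀ x, c (x, 0) = f x) ∧ ∀ x t, |t| < ε → (c (x, t) ∈ X ↔ 0 ≤ t)

/-- A `(2+1)`-dimensional cobordism with parametrized boundary `(X; inc : S₀ → ∂X, out : S₁ → ∂X)`.
The compact 3-manifold with boundary `X` is given as a smooth compact domain of an oriented
3-manifold `N` without boundary (such as `X` with an open collar attached); only `X` matters, since
cobordisms are always compared by maps defined near `X`. -/
structure Cobordism (S₀ S₁ : ClosedManifold 2) where
  N : OrientedManifold 3
  X : Set N
  inc : S₀ → N
  out : S₁ → N
  isCompact : IsCompact X
  incoming : IsIncoming S₀ N X inc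
  outgoing : IsOutgoing S₁ N X out
  disjoint : Disjoint (Set.range inc) (Set.range out)
  frontier_eq : frontier X = Set.range inc ∪ Set.range out

/-- A closed oriented 3-manifold as a cobordism from the empty surface to itself. -/
noncomputable def ClosedManifold.toCobordism (M : ClosedManifold 3) :
    Cobordism emptySurface emptySurface where
  N := M.toOrientedManifold
  X := Set.univ
  inc := fun x => Empty.elim x
  out := fun x => Empty.elim x
  isCompact := isCompact_univ
  incoming := ⟨1, one_pos, fun p => Empty.elim p.1,
    ⟨isOpen_lt (f := fun p : Empty × ℝ => |p.2|) (by fun_prop) continuous_const,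
      fun p => Empty.elim p.1, fun p => Empty.elim p.1, fun p => Empty.elim p.1⟩,
    fun x => Empty.elim x, fun x => Empty.elim x⟩
  outgoing := ⟨1, one_pos, fun p => Empty.elim p.1,
    ⟨isOpen_lt (f := fun p : Empty × ℝ => |p.2|) (by fun_prop) continuous_const,
      fun p => Empty.elim p.1, fun p => Empty.elim p.1, fun p => Empty.elim p.1⟩,
    fun x => Empty.elim x, fun x => Empty.elim x⟩
  disjoint := Set.disjoint_left.2 fun _ ⟨x, _⟩ => Empty.elim x
  frontier_eq := by
    rw [frontier_univ, eq_comm, Set.union_empty_iff]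
    exact ⟨Set.eq_empty_of_forall_notMem fun _ ⟨x, _⟩ => Empty.elim x,
      Set.eq_empty_of_forall_notMem fun _ ⟨x, _⟩ => Empty.elim x⟩

namespace Cobordism

/-- `W` and `W'` are diffeomorphic, compatibly with diffeomorphisms of the boundary surfaces. -/
def IsDiffeomorphic {S₀ S₁ S₀' S₁' : ClosedManifold 2} (W : Cobordism S₀ S₁)
    (W' : Cobordism S₀' S₁') (g₀ : S₀ → S₀') (g₁ : S₁ → S₁') : Prop :=
  ∃ Φ : W.N → W'.N, IsOrientedEmbNear W.N W'.N Φ W.X ∧ Φ '' W.X = W'.X ∧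
    (∀ x, Φ (W.inc x) = W'.inc (g₀ x)) ∧ ∀ x, Φ (W.out x) = W'.out (g₁ x)

/-- `W` is obtained by gluing `W₁` and `W₂` along `B`. -/
def IsGluing {A B C : ClosedManifold 2} (W₁ : Cobordism A B) (W₂ : Cobordism B C)
    (W : Cobordism A C) : Prop :=
  ∃ (Φ₁ : W₁.N → W.N) (Φ₂ : W₂.N → W.N),
    IsOrientedEmbNear W₁.N W.N Φ₁ W₁.X ∧ IsOrientedEmbNear W₂.N W.N Φ₂ W₂.X ∧
    Φ₁ '' W₁.X ∪ Φ₂ '' W₂.X = W.X ∧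
    Φ₁ '' W₁.X ∩ Φ₂ '' W₂.X = Set.range (fun b => Φ₁ (W₁.out b)) ∧
    (∀ b, Φ₁ (W₁.out b) = Φ₂ (W₂.inc b)) ∧
    (∀ a, W.inc a = Φ₁ (W₁.inc a)) ∧ ∀ c, W.out c = Φ₂ (W₂.out c)

/-- `W` is the disjoint union of `W₁` and `W₂`. -/
def IsUnion {A₁ A₂ A B₁ B₂ B : ClosedManifold 2} (W₁ : Cobordism A₁ B₁) (W₂ : Cobordism A₂ B₂)
    (W : Cobordism A B)
    (dA : DisjUnion A₁ A₂ A)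
    (dB : DisjUnion B₁ B₂ B) : Prop :=
  ∃ (Φ₁ : W₁.N → W.N) (Φ₂ : W₂.N → W.N),
    IsOrientedEmbNear W₁.N W.N Φ₁ W₁.X ∧ IsOrientedEmbNear W₂.N W.N Φ₂ W₂.X ∧
    Φ₁ '' W₁.X ∪ Φ₂ '' W₂.X = W.X ∧ Disjoint (Φ₁ '' W₁.X) (Φ₂ '' W₂.X) ∧
    (∀ a, W.inc (dA.i₁ a) = Φ₁ (W₁.inc a)) ∧ (∀ a, W.inc (dA.i₂ a) = Φ₂ (W₂.inc a)) ∧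
    (∀ b, W.out (dB.i₁ b) = Φ₁ (W₁.out b)) ∧ ∀ b, W.out (dB.i₂ b) = Φ₂ (W₂.out b)

/-- `W` is the cylinder `S × [0, 1]` from `S = S × 0` to `S = S × 1`. -/
def IsCylinder {S : ClosedManifold 2} (W : Cobordism S S) : Prop :=
  ∃ Φ : S × ℝ → W.N,
    IsOrientedEmbNear (S.toOrientedManifold.prod line) W.N Φ {p : S × ℝ | p.2 ∈ Set.Icc 0 1} ∧
    Φ '' {p : S × ℝ | p.2 ∈ Set.Icc 0 1} = W.X ∧
    (∀ x, W.inc x = Φ (x, 0)) ∧ ∀ x, W.out x = Φ (x, 1)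

/-- `W` is the cylinder `S × [0, 1]`, viewed as a cobordism from `S ⊔ -S = S × 0 ⊔ S × 1` to the
empty surface. -/
def IsEvaluation {S A : ClosedManifold 2}
    (d : DisjUnion S S.neg A)
    (W : Cobordism A emptySurface) : Prop :=
  ∃ Φ : S × ℝ → W.N,
    IsOrientedEmbNear (S.toOrientedManifold.prod line) W.N Φ {p : S × ℝ | p.2 ∈ Set.Icc 0 1} ∧
    Φ '' {p : S × ℝ | p.2 ∈ Set.Icc 0 1} = W.X ∧
    (∀ x : S, W.inc (d.i₁ x) = Φ (x, 0)) ∧ ∀ x : S, W.inc (d.i₂ x) = Φ (x, 1)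

end Cobordism

/-- A `(2+1)`-dimensional topological quantum field theory: a symmetric monoidal functor from
closed oriented surfaces, with orientation-preserving diffeomorphisms and oriented cobordisms, to
finite-dimensional complex vector spaces. -/
structure TQFT where
  V : ClosedManifold 2 → Type
  [addCommGroup : ∀ S, AddCommGroup (V S)]
  [module : ∀ S, Module ℂ (V S)]
  [finiteDimensional : ∀ S, FiniteDimensional ℂ (V S)]
  /-- The isomorphism `Z(f)` of a diffeomorphism `f`. -/
  map : ∀ {S S' : ClosedManifold 2}, SurfaceDiffeo S S' → V S ≃ₗ[ℂ] V S'
  /-- The linear map `Z_W` of a cobordism `W`. -/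
  cob : ∀ {S S' : ClosedManifold 2}, Cobordism S S' → V S →ₗ[ℂ] V S'
  /-- The isomorphism `ℂ ≅ Z(∅)`. -/
  unit : ∀ S : ClosedManifold 2, IsEmpty S → ℂ ≃ₗ[ℂ] V S
  /-- The isomorphism `Z(A) ⊗ Z(B) ≅ Z(A ⊔ B)`. -/
  tensor : ∀ {A B C : ClosedManifold 2}, DisjUnion A B C → V A ⊗[ℂ] V B ≃ₗ[ℂ] V C
  map_refl : ∀ S : ClosedManifold 2, map (OrientedDiffeo.refl S.toOrientedManifold) = LinearEquiv.refl ℂ (V S)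
  map_trans : ∀ {S S' S'' : ClosedManifold 2} (f : SurfaceDiffeo S S')
    (g : SurfaceDiffeo S' S''), map (OrientedDiffeo.trans f g) = (map f).trans (map g)
  unit_natural : ∀ {S S' : ClosedManifold 2} (h : IsEmpty S) (h' : IsEmpty S')
    (f : SurfaceDiffeo S S') (z : ℂ), map f (unit S h z) = unit S' h' z
  tensor_natural : ∀ {A B C A' B' C' : ClosedManifold 2} (d : DisjUnion A B C)
    (d' : DisjUnion A' B' C') (f : SurfaceDiffeo A A') (g : SurfaceDiffeo B B')
    (h : SurfaceDiffeo C C'), (∀ a, h (d.i₁ a) = d'.i₁ (f a)) →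
    (∀ b, h (d.i₂ b) = d'.i₂ (g b)) →
    ∀ x y, map h (tensor d (x ⊗ₜ y)) = tensor d' (map f x ⊗ₜ map g y)
  tensor_symm : ∀ {A B C : ClosedManifold 2} (d : DisjUnion A B C) (d' : DisjUnion B A C),
    d'.i₁ = d.i₂ → d'.i₂ = d.i₁ → ∀ x y, tensor d' (y ⊗ₜ x) = tensor d (x ⊗ₜ y)
  tensor_assoc : ∀ {A B C AB BC ABC : ClosedManifold 2} (dAB : DisjUnion A B AB)
    (d : DisjUnion AB C ABC) (dBC : DisjUnion B C BC) (d' : DisjUnion A BC ABC),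
    (∀ a, d.i₁ (dAB.i₁ a) = d'.i₁ a) → (∀ b, d.i₁ (dAB.i₂ b) = d'.i₂ (dBC.i₁ b)) →
    (∀ c, d.i₂ c = d'.i₂ (dBC.i₂ c)) →
    ∀ x y z, tensor d (tensor dAB (x ⊗ₜ y) ⊗ₜ z) = tensor d' (x ⊗ₜ tensor dBC (y ⊗ₜ z))
  tensor_unit : ∀ {A B C : ClosedManifold 2} (d : DisjUnion A B C) (hB : IsEmpty B)
    (f : SurfaceDiffeo A C), (∀ a, f a = d.i₁ a) →
    ∀ x z, tensor d (x ⊗ₜ unit B hB z) = z • map f x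
  cob_natural : ∀ {S₀ S₁ S₀' S₁' : ClosedManifold 2} (W : Cobordism S₀ S₁)
    (W' : Cobordism S₀' S₁') (g₀ : SurfaceDiffeo S₀ S₀')
    (g₁ : SurfaceDiffeo S₁ S₁'),
    W.IsDiffeomorphic W' g₀ g₁ → ∀ x, map g₁ (cob W x) = cob W' (map g₀ x)
  cob_cylinder : ∀ {S : ClosedManifold 2} (W : Cobordism S S), W.IsCylinder → ∀ x, cob W x = x
  cob_gluing : ∀ {A B C : ClosedManifold 2} (W₁ : Cobordism A B) (W₂ : Cobordism B C)
    (W : Cobordism A C), W₁.IsGluing W₂ W → ∀ x, cob W x = cob W₂ (cob W₁ x)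
  cob_union : ∀ {A₁ A₂ A B₁ B₂ B : ClosedManifold 2} (W₁ : Cobordism A₁ B₁) (W₂ : Cobordism A₂ B₂)
    (W : Cobordism A B) (dA : DisjUnion A₁ A₂ A) (dB : DisjUnion B₁ B₂ B),
    W₁.IsUnion W₂ W dA dB →
    ∀ x y, cob W (tensor dA (x ⊗ₜ y)) = tensor dB (cob W₁ x ⊗ₜ cob W₂ y)

attribute [instance] TQFT.addCommGroup TQFT.module TQFT.finiteDimensional

/-- The identification `ℂ ≅ Z(∅)`. -/
noncomputable def TQFT.ofEmpty (Z : TQFT) : ℂ ≃ₗ[ℂ] Z.V emptySurface :=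
  Z.unit emptySurface (inferInstanceAs (IsEmpty Empty))

/-- The invariant `Z(M) ∈ ℂ` of a closed oriented 3-manifold `M`. -/
noncomputable def TQFT.closed (Z : TQFT) (M : ClosedManifold 3) : ℂ :=
  Z.ofEmpty.symm (Z.cob M.toCobordism (Z.ofEmpty 1))

theorem Carries.of_comp {n : ℕ} {U V W : Type} [NormedAddCommGroup U] [NormedSpace ℝ U]
    [NormedAddCommGroup V] [NormedSpace ℝ V] [NormedAddCommGroup W] [NormedSpace ℝ W]
    {L : V →L[ℝ] W} {K : W →L[ℝ] U} {a : Orientation ℝ V (Fin n)}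
    {b : Orientation ℝ W (Fin n)} {c : Orientation ℝ U (Fin n)}
    (hKL : Carries (K.comp L) a c) (hL : Carries L a b) : Carries K b c := by
  obtain ⟨e, he, rfl⟩ := hL
  obtain ⟨f, hf, rfl⟩ := hKL
  refine ⟨e.symm.trans f, fun v => ?_, ?_⟩
  · rw [LinearEquiv.trans_apply, hf, ContinuousLinearMap.comp_apply, ← he,
      LinearEquiv.apply_symm_apply]
  · induction a using Module.Ray.ind with | h g hg =>
    simp only [Orientation.map_apply]
    congr 1
    ext v
    simp [AlternatingMap.compLinearMap_apply]

/-- A criterion for preserving orientations, by means of a volume form on the target. -/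
theorem carries_of_form_pos {n : ℕ} {V W : Type} [NormedAddCommGroup V] [NormedSpace ℝ V]
    [NormedAddCommGroup W] [NormedSpace ℝ W] [FiniteDimensional ℝ W] (hW : finrank ℝ W = n)
    (u : Basis (Fin n) ℝ V) (L : V →L[ℝ] W) (η : W [⋀^Fin n]→ₗ[ℝ] ℝ) (hη : η ≠ 0)
    (h : 0 < η (fun i => L (u i))) : Carries L u.orientation (rayOfNeZero ℝ η hη) := by
  have hli : LinearIndependent ℝ (fun i => L (u i)) := by
    by_contra hd
    exact h.ne' (η.map_linearDependent _ hd)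
  let c : Basis (Fin n) ℝ W := Basis.mk hli
    (hli.span_eq_top_of_card_eq_finrank' (by simp [hW])).ge
  have hc : ∀ i, c i = L (u i) := fun i => by simp [c]
  have hcu : (c : Fin n → W) = fun i => L (u i) := funext hc
  refine ⟨u.equiv c (Equiv.refl _), fun v => ?_, ?_⟩
  · have : ((u.equiv c (Equiv.refl _) : V ≃ₗ[ℝ] W) : V →ₗ[ℝ] W) = (L : V →ₗ[ℝ] W) :=
      u.ext fun i => by simp [hc]
    exact congrArg (fun K : V →ₗ[ℝ] W => K v) this
  · rw [← Basis.orientation_map, ← orientation_eq_ray c η hη (by rw [hcu]; exact h)]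
    congr 1
    exact Basis.eq_of_apply_eq fun i => by simp

theorem carries_of_det_pos {n : ℕ} {V : Type} [NormedAddCommGroup V] [NormedSpace ℝ V]
    [FiniteDimensional ℝ V] (hV : finrank ℝ V = n) (A : V →L[ℝ] V) (a : Orientation ℝ V (Fin n))
    (h : 0 < LinearMap.det (A : V →ₗ[ℝ] V)) : Carries A a a := by
  let e := LinearEquiv.ofIsUnitDet (f := (A : V →ₗ[ℝ] V)) (v := finBasis ℝ V)
    (v' := finBasis ℝ V) (by simpa using h.ne')
  refine ⟨e, fun v => rfl, ?_⟩
  rw [Orientation.map_eq_iff_det_pos _ _ (by simp [hV])]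
  exact h

theorem carries_neg_of_det_neg {n : ℕ} {V : Type} [NormedAddCommGroup V] [NormedSpace ℝ V]
    [FiniteDimensional ℝ V] (hV : finrank ℝ V = n) (A : V →L[ℝ] V) (a : Orientation ℝ V (Fin n))
    (h : LinearMap.det (A : V →ₗ[ℝ] V) < 0) : Carries A a (-a) := by
  let e := LinearEquiv.ofIsUnitDet (f := (A : V →ₗ[ℝ] V)) (v := finBasis ℝ V)
    (v' := finBasis ℝ V) (by simpa using h.ne)
  refine ⟨e, fun v => rfl, ?_⟩
  rw [Orientation.map_eq_neg_iff_det_neg _ _ (by simp [hV])]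
  exact h

theorem carries_circleExp (t : ℝ) : Carries (derivAt 𝓘(ℝ, ℝ) (𝓡 1) Circle.exp t)
    (Basis.singleton (Fin 1) ℝ).orientation (circle.orient (Circle.exp t)) := by
  have := finrank_real_complex_fact'
  refine carries_of_form_pos (by simp) _ _ _ _ ?_
  rw [positionForm_apply]
  have h : (derivAt (𝓡 1) 𝓘(ℝ, ℂ) (fun z : Circle => (z : ℂ)) (Circle.exp t)).comp
      (derivAt 𝓘(ℝ, ℝ) (𝓡 1) Circle.exp t) = derivAt 𝓘(ℝ, ℝ) 𝓘(ℝ, ℂ)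
        (fun t : ℝ => Complex.exp (t * Complex.I)) t := by
    rw [← derivAt_comp]
    · rfl
    · exact (contMDiff_coe_sphere (E := ℂ) (n := 1) (m := 1)).mdifferentiableAt (by simp)
    · exact (contMDiff_circleExp (m := 1)).mdifferentiableAt (by simp)
  have h2 : derivAt 𝓘(ℝ, ℝ) 𝓘(ℝ, ℂ) (fun t : ℝ => Complex.exp (t * Complex.I)) t 1 =
      Complex.exp (t * Complex.I) * Complex.I := by
    have h3 : HasDerivAt (fun t : ℝ => Complex.exp (t * Complex.I))
        (Complex.exp (t * Complex.I) * Complex.I) t := by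
      have := ((hasDerivAt_id (t : ℂ)).mul_const Complex.I).cexp.comp_ofReal
      simpa using this
    have h4 : derivAt 𝓘(ℝ, ℝ) 𝓘(ℝ, ℂ) (fun t : ℝ => Complex.exp (t * Complex.I)) t =
      fderiv ℝ (fun t : ℝ => Complex.exp (t * Complex.I)) t := mfderiv_eq_fderiv
    rw [h4]
    exact h3.deriv
  rw [← h] at h2
  simp only [ContinuousLinearMap.comp_apply] at h2
  have h5 : ∀ i : Fin 1, (Basis.singleton (Fin 1) ℝ) i = (1 : ℝ) := by simp
  simp only [h5, h2]
  rw [Basis.det_apply, Matrix.det_fin_two]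
  simp [Basis.toMatrix_apply, Complex.exp_re, Complex.exp_im]
  nlinarith [Real.sin_sq_add_cos_sq t]

theorem derivAt_prodMap {E H E' H' F G F' G' M M' P P' : Type} [NormedAddCommGroup E]
    [NormedSpace ℝ E] [TopologicalSpace H] [NormedAddCommGroup E'] [NormedSpace ℝ E']
    [TopologicalSpace H'] [NormedAddCommGroup F] [NormedSpace ℝ F] [TopologicalSpace G]
    [NormedAddCommGroup F'] [NormedSpace ℝ F'] [TopologicalSpace G']
    [TopologicalSpace M] [ChartedSpace H M] [TopologicalSpace M'] [ChartedSpace H' M']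
    [TopologicalSpace P] [ChartedSpace G P] [TopologicalSpace P'] [ChartedSpace G' P']
    {I : ModelWithCorners ℝ E H} {I' : ModelWithCorners ℝ E' H'} {J : ModelWithCorners ℝ F G}
    {J' : ModelWithCorners ℝ F' G'} {f : M → M'} {g : P → P'} {x : M × P}
    (hf : MDifferentiableAt I I' f x.1) (hg : MDifferentiableAt J J' g x.2) :
    derivAt (I.prod J) (I'.prod J') (Prod.map f g) x =
      (derivAt I I' f x.1).prodMap (derivAt J J' g x.2) :=
  (hf.hasMFDerivAt.prodMap hg.hasMFDerivAt).mfderiv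

theorem derivAt_eq_fderiv {V W U : Type} [NormedAddCommGroup V] [NormedSpace ℝ V]
    [NormedAddCommGroup W] [NormedSpace ℝ W] [NormedAddCommGroup U] [NormedSpace ℝ U]
    (f : V × W → U) (x : V × W) :
    derivAt (𝓘(ℝ, V).prod 𝓘(ℝ, W)) 𝓘(ℝ, U) f x = fderiv ℝ f x := by
  rw [← modelWithCornersSelf_prod, chartedSpaceSelf_prod]
  exact mfderiv_eq_fderiv

/-- The orientation of `ℝ × ℝ`. -/
noncomputable def orientR2 : Orientation ℝ (ℝ × ℝ) (Fin 2) :=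
  prodOrientation (m := 1) (n := 1) (by simp) (by simp)
    (Basis.singleton (Fin 1) ℝ).orientation (Basis.singleton (Fin 1) ℝ).orientation

theorem mdifferentiable_circleExp : MDifferentiable 𝓘(ℝ, ℝ) (𝓡 1) Circle.exp := fun _ =>
  (contMDiff_circleExp (m := 1)).mdifferentiableAt (by simp)

theorem carries_expMap (x : ℝ × ℝ) :
    Carries (derivAt (𝓘(ℝ, ℝ).prod 𝓘(ℝ, ℝ)) ((𝓡 1).prod (𝓡 1))
      (Prod.map Circle.exp Circle.exp) x) orientR2
      (torus.orient (Circle.exp x.1, Circle.exp x.2)) := by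
  rw [derivAt_prodMap (mdifferentiable_circleExp _) (mdifferentiable_circleExp _)]
  exact (carries_circleExp x.1).prodMap _ _ (by simp) (by simp) (carries_circleExp x.2)

/-- The derivative of a map of the torus that is covered by a linear map `A` of `ℝ²`. -/
theorem carries_torus {f : Circle × Circle → Circle × Circle}
    (hf : MDifferentiable ((𝓡 1).prod (𝓡 1)) ((𝓡 1).prod (𝓡 1)) f) (A : ℝ × ℝ →L[ℝ] ℝ × ℝ)
    (hA : ∀ x : ℝ × ℝ, f (Circle.exp x.1, Circle.exp x.2) =
      (Circle.exp (A x).1, Circle.exp (A x).2)) (p : Circle × Circle)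
    {b : Orientation ℝ (ℝ × ℝ) (Fin 2)} {c : Orientation ℝ torus.E (Fin 2)}
    (hAb : Carries A orientR2 b)
    (hc : ∀ x : ℝ × ℝ, (Circle.exp x.1, Circle.exp x.2) = f p →
      Carries (derivAt (𝓘(ℝ, ℝ).prod 𝓘(ℝ, ℝ)) ((𝓡 1).prod (𝓡 1))
        (Prod.map Circle.exp Circle.exp) x) b c) :
    Carries (derivAt ((𝓡 1).prod (𝓡 1)) ((𝓡 1).prod (𝓡 1)) f p) (torus.orient p) c := by
  obtain ⟨x₁, h₁⟩ : ∃ x, Circle.exp x = p.1 := ⟨_, Circle.exp_arg p.1⟩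
  obtain ⟨x₂, h₂⟩ : ∃ x, Circle.exp x = p.2 := ⟨_, Circle.exp_arg p.2⟩
  have hx : (Circle.exp x₁, Circle.exp x₂) = p := Prod.ext h₁ h₂
  rw [← hx]
  refine Carries.of_comp (a := orientR2) ?_ (carries_expMap (x₁, x₂))
  have hd : MDifferentiable (𝓘(ℝ, ℝ).prod 𝓘(ℝ, ℝ)) ((𝓡 1).prod (𝓡 1))
    (Prod.map Circle.exp Circle.exp) := mdifferentiable_circleExp.prodMap mdifferentiable_circleExp
  have hAd : MDifferentiable (𝓘(ℝ, ℝ).prod 𝓘(ℝ, ℝ)) (𝓘(ℝ, ℝ).prod 𝓘(ℝ, ℝ)) A := by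
    rw [← modelWithCornersSelf_prod, chartedSpaceSelf_prod]
    exact A.differentiable.mdifferentiable
  have hA' : derivAt (𝓘(ℝ, ℝ).prod 𝓘(ℝ, ℝ)) (𝓘(ℝ, ℝ).prod 𝓘(ℝ, ℝ)) A (x₁, x₂) = A := by
    rw [← modelWithCornersSelf_prod, chartedSpaceSelf_prod]
    exact (mfderiv_eq_fderiv).trans A.fderiv
  have e1 := derivAt_comp (x := (x₁, x₂)) (hf (Prod.map Circle.exp Circle.exp (x₁, x₂))) (hd (x₁, x₂))
  have e2 := derivAt_comp (x := (x₁, x₂)) (hd (A (x₁, x₂))) (hAd (x₁, x₂))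
  have e3 : f ∘ Prod.map Circle.exp Circle.exp = Prod.map Circle.exp Circle.exp ∘ A :=
    funext hA
  rw [← e3, e1, hA'] at e2
  exact e2 ▸ (hc _ (by rw [← hA, hx])).comp hAb

theorem contMDiff_torusS : ContMDiff ((𝓡 1).prod (𝓡 1)) ((𝓡 1).prod (𝓡 1)) ∞
    fun p : Circle × Circle => (p.2⁻¹, p.1) :=
  (contMDiff_snd.inv.prodMk contMDiff_fst).of_le (n := ω) le_top

theorem contMDiff_torusS_symm : ContMDiff ((𝓡 1).prod (𝓡 1)) ((𝓡 1).prod (𝓡 1)) ∞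
    fun p : Circle × Circle => (p.2, p.1⁻¹) :=
  (contMDiff_snd.prodMk contMDiff_fst.inv).of_le (n := ω) le_top

theorem contMDiff_torusT : ContMDiff ((𝓡 1).prod (𝓡 1)) ((𝓡 1).prod (𝓡 1)) ∞
    fun p : Circle × Circle => (p.1 * p.2, p.2) :=
  ((contMDiff_fst.mul contMDiff_snd).prodMk contMDiff_snd).of_le (n := ω) le_top

theorem contMDiff_torusT_symm : ContMDiff ((𝓡 1).prod (𝓡 1)) ((𝓡 1).prod (𝓡 1)) ∞
    fun p : Circle × Circle => (p.1 * p.2⁻¹, p.2) :=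
  ((contMDiff_fst.mul contMDiff_snd.inv).prodMk contMDiff_snd).of_le (n := ω) le_top

theorem contMDiff_torusU : ContMDiff ((𝓡 1).prod (𝓡 1)) ((𝓡 1).prod (𝓡 1)) ∞
    fun p : Circle × Circle => (p.1, p.2⁻¹) :=
  (contMDiff_fst.prodMk contMDiff_snd.inv).of_le (n := ω) le_top

theorem det_R2 (A : ℝ × ℝ →L[ℝ] ℝ × ℝ) : LinearMap.det (A : ℝ × ℝ →ₗ[ℝ] ℝ × ℝ) =
    (A (1, 0)).1 * (A (0, 1)).2 - (A (0, 1)).1 * (A (1, 0)).2 := by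
  rw [← LinearMap.det_toMatrix (Basis.finTwoProd ℝ), Matrix.det_fin_two]
  simp [LinearMap.toMatrix_apply]

/-- The diffeomorphism `S(z, w) = (w̄, z)` of the torus. -/
noncomputable def torusS : SurfaceDiffeo torus torus where
  toFun := fun p : Circle × Circle => ((p.2⁻¹, p.1) : Circle × Circle)
  invFun := fun p : Circle × Circle => ((p.2, p.1⁻¹) : Circle × Circle)
  left_inv := fun p : Circle × Circle => by simp; rfl
  right_inv := fun p : Circle × Circle => by simp; rfl
  contMDiff_toFun := contMDiff_torusS
  contMDiff_invFun := contMDiff_torusS_symm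
  carries := fun p => carries_torus (contMDiff_torusS.mdifferentiable (by simp))
    ((-ContinuousLinearMap.snd ℝ ℝ ℝ).prod (ContinuousLinearMap.fst ℝ ℝ ℝ))
    (fun x => by simp [Circle.exp_neg]) p
    (carries_of_det_pos (by simp) _ _ (by rw [det_R2]; simp))
    (fun x hx => hx ▸ carries_expMap x)

/-- The diffeomorphism `T(z, w) = (zw, w)` of the torus. -/
noncomputable def torusT : SurfaceDiffeo torus torus where
  toFun := fun p : Circle × Circle => ((p.1 * p.2, p.2) : Circle × Circle)
  invFun := fun p : Circle × Circle => ((p.1 * p.2⁻¹, p.2) : Circle × Circle)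
  left_inv := fun p : Circle × Circle => by simp; rfl
  right_inv := fun p : Circle × Circle => by simp; rfl
  contMDiff_toFun := contMDiff_torusT
  contMDiff_invFun := contMDiff_torusT_symm
  carries := fun p => carries_torus (contMDiff_torusT.mdifferentiable (by simp))
    ((ContinuousLinearMap.fst ℝ ℝ ℝ + ContinuousLinearMap.snd ℝ ℝ ℝ).prod
      (ContinuousLinearMap.snd ℝ ℝ ℝ))
    (fun x => by simp [Circle.exp_add]) p
    (carries_of_det_pos (by simp) _ _ (by rw [det_R2]; simp))
    (fun x hx => hx ▸ carries_expMap x)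

/-- The diffeomorphism `U(z, w) = (z, w̄)` from the torus to the torus with the opposite
orientation. -/
noncomputable def torusU : SurfaceDiffeo torus torus.neg where
  toFun := fun p : Circle × Circle => ((p.1, p.2⁻¹) : Circle × Circle)
  invFun := fun p : Circle × Circle => ((p.1, p.2⁻¹) : Circle × Circle)
  left_inv := fun p : Circle × Circle => by simp; rfl
  right_inv := fun p : Circle × Circle => by simp; rfl
  contMDiff_toFun := contMDiff_torusU
  contMDiff_invFun := contMDiff_torusU
  carries := fun p => carries_torus (contMDiff_torusU.mdifferentiable (by simp))
    ((ContinuousLinearMap.fst ℝ ℝ ℝ).prod (-ContinuousLinearMap.snd ℝ ℝ ℝ))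
    (fun x => by simp [Circle.exp_neg]) p
    (carries_neg_of_det_neg (by simp) _ _ (by rw [det_R2]; simp))
    (fun x hx => hx ▸ (carries_expMap x).neg)

/-- The solid torus `D² × S¹` in `ℂ × S¹`. -/
def solidTorus : Set (ℂ × Circle) := {p | ‖p.1‖ ≤ 1}

/-- The open solid torus. -/
def openSolidTorus : Set (ℂ × Circle) := {p | ‖p.1‖ < 1}

/-- A framed link in `S³` with components indexed by `ι`: the framings are orientation-preserving
embeddings `h k : D² × S¹ → S³` with disjoint images. The `k`-th component is the core
`h k (0 × S¹)`, and its framing is given by the longitude `h k (1 × S¹)`. -/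
structure FramedLink (ι : Type) where
  h : ι → ℂ × Circle → sphere3
  emb : ∀ k, IsOrientedEmbNear (plane.prod circle) sphere3 (h k) solidTorus
  disjoint : ∀ k l, k ≠ l → Disjoint (h k '' solidTorus) (h l '' solidTorus)

/-- The exterior of a framed link: the complement of the open tubular neighbourhoods. -/
def FramedLink.exterior {ι : Type} (L : FramedLink ι) : Set sphere3 :=
  (⋃ k, L.h k '' openSolidTorus)ᶜ

/-- Two framed links are equivalent if an orientation-preserving diffeomorphism of `S³` carries
one to the other. -/
def FramedLink.Equivalent {ι : Type} (L L' : FramedLink ι) : Prop :=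
  ∃ F : OrientedDiffeo sphere3 sphere3, ∀ k, ∀ x ∈ solidTorus, L'.h k x = F (L.h k x)

/-- `M` is obtained from `S³` by Dehn surgery along the framed link `L`: it is the union of the
exterior of `L` (embedded by `Φ`) and of solid tori (embedded by `g k`), glued along their boundary
by `(z, w) ↦ h k (S (z, w)) = h k (w̄, z)`, so that the meridians are glued to the longitudes. -/
def FramedLink.IsSurgery {ι : Type} (L : FramedLink ι) (M : ClosedManifold 3) : Prop :=
  ∃ (Φ : sphere3 → M) (g : ι → ℂ × Circle → M),
    IsOrientedEmbNear sphere3 M Φ L.exterior ∧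
    (∀ k, IsOrientedEmbNear (plane.prod circle) M (g k) solidTorus) ∧
    (∀ k (z w : Circle), g k ((z : ℂ), w) = Φ (L.h k (((w⁻¹ : Circle) : ℂ), z))) ∧
    Φ '' L.exterior ∪ ⋃ k, g k '' solidTorus = Set.univ ∧
    (∀ k, Disjoint (Φ '' L.exterior) (g k '' openSolidTorus)) ∧
    ∀ k l, k ≠ l → Disjoint (g k '' solidTorus) (g l '' solidTorus)

/-- The point `(a, b)` of `ℂ² = ℝ⁴`. -/
noncomputable def vec4 : ℂ × ℂ →L[ℝ] EuclideanSpace ℝ (Fin 4) :=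
  LinearMap.toContinuousLinearMap
    { toFun := fun x => !₂[x.1.re, x.1.im, x.2.re, x.2.im]
      map_add' := fun x y => by ext i; fin_cases i <;> simp
      map_smul' := fun c x => by ext i; fin_cases i <;> simp }

theorem vec4_apply (x : ℂ × ℂ) : vec4 x = !₂[x.1.re, x.1.im, x.2.re, x.2.im] := rfl

theorem norm_vec4 (x : ℂ × ℂ) : ‖vec4 x‖ = √(‖x.1‖ ^ 2 + ‖x.2‖ ^ 2) := by
  rw [vec4_apply, EuclideanSpace.norm_eq]
  congr 1
  simp [Fin.sum_univ_four, Complex.sq_norm, Complex.normSq_apply]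
  ring

theorem vec4_injective : Function.Injective vec4 := by
  intro x y h
  have h0 := congrArg (fun v : EuclideanSpace ℝ (Fin 4) => v 0) h
  have h1 := congrArg (fun v : EuclideanSpace ℝ (Fin 4) => v 1) h
  have h2 := congrArg (fun v : EuclideanSpace ℝ (Fin 4) => v 2) h
  have h3 := congrArg (fun v : EuclideanSpace ℝ (Fin 4) => v 3) h
  simp [vec4_apply] at h0 h1 h2 h3
  exact Prod.ext (Complex.ext h0 h1) (Complex.ext h2 h3)

/-- The normalizing factor `(1 + |a|²)^(-1/2)`. -/
noncomputable def scale (a : ℂ) : ℝ := (√(1 + ‖a‖ ^ 2))⁻¹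

theorem scale_pos (a : ℂ) : 0 < scale a := by
  unfold scale; positivity

theorem contDiff_scale : ContDiff ℝ ∞ scale := by
  have h : ContDiff ℝ ∞ fun a : ℂ => 1 + ‖a‖ ^ 2 := contDiff_const.add (contDiff_id.norm_sq ℝ)
  have hp : ∀ a : ℂ, 0 < 1 + ‖a‖ ^ 2 := fun a => by positivity
  exact (h.sqrt fun a => (hp a).ne').inv fun a => (Real.sqrt_pos.2 (hp a)).ne'

/-- The point `(a, w) / √(1 + |a|²)` of `S³`. For fixed `a` this is a circle around the axis
`b = 0` of `S³ ⊆ ℂ²`. -/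
noncomputable def meridianPoint (a : ℂ) (w : Circle) : sphere3 :=
  (⟨scale a • vec4 (a, w), by
    have h : 0 < 1 + ‖a‖ ^ 2 := by positivity
    rw [mem_sphere_zero_iff_norm, norm_smul, norm_vec4, Real.norm_eq_abs, abs_of_pos (scale_pos a)]
    simp only [Circle.norm_coe, one_pow, scale]
    rw [add_comm (‖a‖ ^ 2)]
    exact inv_mul_cancel₀ (Real.sqrt_pos.2 h).ne'⟩ :
    Metric.sphere (0 : EuclideanSpace ℝ (Fin 4)) 1)

/-- The point `(w, b) / √(1 + |b|²)` of `S³`. For `b = 0` this is the axis. -/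
noncomputable def axisPoint (b : ℂ) (w : Circle) : sphere3 :=
  (⟨scale b • vec4 (w, b), by
    have h : 0 < 1 + ‖b‖ ^ 2 := by positivity
    rw [mem_sphere_zero_iff_norm, norm_smul, norm_vec4, Real.norm_eq_abs, abs_of_pos (scale_pos b)]
    simp only [Circle.norm_coe, one_pow, scale]
    exact inv_mul_cancel₀ (Real.sqrt_pos.2 h).ne'⟩ :
    Metric.sphere (0 : EuclideanSpace ℝ (Fin 4)) 1)

/-- The tubular neighbourhood of the circle `meridianPoint c w`, `w ∈ S¹`, with integral framing
`p` and radius `ρ`. For `p = 0` the longitude `meridianPoint (c + ρ) w` is not linked with the core;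
in general it winds `p` times around the core, so that its linking number with the core is `p`. -/
noncomputable def meridianFraming (c ρ : ℝ) (p : ℤ) (x : ℂ × Circle) : sphere3 :=
  meridianPoint (c + ρ * x.1 * ((x.2 ^ p : Circle) : ℂ)) x.2

/-- The tubular neighbourhood of the axis with integral framing `q`: the linking number of its
longitude with the axis is `q`. -/
noncomputable def axisFraming (q : ℤ) (x : ℂ × Circle) : sphere3 :=
  axisPoint (x.1 * ((x.2 ^ q : Circle) : ℂ)) x.2

theorem meridian_eq {a a' : ℂ} {w w' : Circle} (h : meridianPoint a w = meridianPoint a' w') :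
    a = a' ∧ w = w' := by
  have h1 : scale a • vec4 (a, w) = scale a' • vec4 (a', w') := congrArg Subtype.val h
  rw [← map_smul, ← map_smul] at h1
  have h2 := vec4_injective h1
  simp only [Prod.smul_mk, Prod.mk.injEq] at h2
  have h3 := congrArg norm h2.2
  rw [norm_smul, norm_smul, Circle.norm_coe, Circle.norm_coe, Real.norm_eq_abs, Real.norm_eq_abs,
    abs_of_pos (scale_pos a), abs_of_pos (scale_pos a'), mul_one, mul_one] at h3
  rw [h3] at h2
  exact ⟨smul_right_injective _ (scale_pos a').ne' h2.1,
    Circle.ext (smul_right_injective _ (scale_pos a').ne' h2.2)⟩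

theorem axis_eq {a a' : ℂ} {w w' : Circle} (h : axisPoint a w = axisPoint a' w') :
    a = a' ∧ w = w' := by
  have h1 : scale a • vec4 (w, a) = scale a' • vec4 (w', a') := congrArg Subtype.val h
  rw [← map_smul, ← map_smul] at h1
  have h2 := vec4_injective h1
  simp only [Prod.smul_mk, Prod.mk.injEq] at h2
  have h3 := congrArg norm h2.1
  rw [norm_smul, norm_smul, Circle.norm_coe, Circle.norm_coe, Real.norm_eq_abs, Real.norm_eq_abs,
    abs_of_pos (scale_pos a), abs_of_pos (scale_pos a'), mul_one, mul_one] at h3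
  rw [h3] at h2
  exact ⟨smul_right_injective _ (scale_pos a').ne' h2.2,
    Circle.ext (smul_right_injective _ (scale_pos a').ne' h2.1)⟩

theorem meridian_axis {a b : ℂ} {w w' : Circle} (h : meridianPoint a w = axisPoint b w') :
    ‖a‖ * ‖b‖ = 1 := by
  have h1 : scale a • vec4 (a, w) = scale b • vec4 (w', b) := congrArg Subtype.val h
  rw [← map_smul, ← map_smul] at h1
  have h2 := vec4_injective h1
  simp only [Prod.smul_mk, Prod.mk.injEq] at h2
  have h3 := congrArg norm h2.1
  have h4 := congrArg norm h2.2
  rw [norm_smul, norm_smul, Circle.norm_coe, Real.norm_eq_abs, Real.norm_eq_abs,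
    abs_of_pos (scale_pos a), abs_of_pos (scale_pos b), mul_one] at h3 h4
  have := scale_pos a
  rw [← h3] at h4
  have h5 : scale a * (‖a‖ * ‖b‖) = scale a * 1 := by rw [mul_one, ← mul_assoc]; exact h4.symm
  exact mul_left_cancel₀ this.ne' h5

theorem contMDiff_circle_zpow (p : ℤ) : ContMDiff (𝓡 1) (𝓡 1) ω fun w : Circle => w ^ p := by
  rcases p with n | n
  · simpa using contMDiff_pow (I := 𝓡 1) (G := Circle) (n := ω) n
  · simpa using (contMDiff_pow (I := 𝓡 1) (G := Circle) (n := ω) (n + 1)).inv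

theorem det_basisR4 (v : Fin 4 → EuclideanSpace ℝ (Fin 4)) :
    basisR4.det v = Matrix.det (Matrix.of fun i j => v j i) := by
  rw [Basis.det_apply]
  congr 1

theorem det_normalize (s : ℝ) (g : EuclideanSpace ℝ (Fin 4)) (d : Fin 3 → EuclideanSpace ℝ (Fin 4))
    (c : Fin 3 → ℝ) : basisR4.det (Matrix.vecCons (s • g) fun i => s • d i + c i • g) =
      s ^ 4 * basisR4.det (Matrix.vecCons g d) := by
  rw [det_basisR4, det_basisR4]
  simp [Matrix.det_succ_row_zero, Fin.sum_univ_succ, Fin.succAbove]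
  ring

/-- The standard basis of `ℂ × ℝ`. -/
noncomputable def basisCR : Basis (Fin 3) ℝ (ℂ × ℝ) :=
  (Complex.basisOneI.prod (Basis.singleton (Fin 1) ℝ)).reindex finSumFinEquiv

theorem carries_planeExp (x : ℂ × ℝ) :
    Carries (derivAt (𝓘(ℝ, ℂ).prod 𝓘(ℝ, ℝ)) (𝓘(ℝ, ℂ).prod (𝓡 1)) (Prod.map id Circle.exp) x)
      basisCR.orientation ((plane.prod circle).orient (x.1, Circle.exp x.2)) := by
  rw [derivAt_prodMap mdifferentiableAt_id (mdifferentiable_circleExp _), derivAt_id, basisCR,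
    ← prodOrientation_eq (by simp) (by simp)]
  exact (carries_id _).prodMap _ _ (by simp) (by simp) (carries_circleExp x.2)

theorem emb_framing (c ρ : ℝ) (p : ℤ) (K : ℂ × ℂ →L[ℝ] EuclideanSpace ℝ (Fin 4))
    (f : ℂ × Circle → sphere3)
    (hf : ∀ x, (show Metric.sphere (0 : EuclideanSpace ℝ (Fin 4)) 1 from f x : EuclideanSpace ℝ (Fin 4)) =
      scale (c + ρ * x.1 * ((x.2 ^ p : Circle) : ℂ)) •
        K (c + ρ * x.1 * ((x.2 ^ p : Circle) : ℂ), x.2))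
    (hinj : Function.Injective f)
    (hdet : ∀ (a u b : ℂ) (w : Circle), u ≠ 0 → 0 < basisR4.det (Matrix.vecCons (K (a, w))
      ![K (u, 0), K (u * Complex.I, 0), K (b, w * Complex.I)])) (hρ : 0 < ρ) :
    IsOrientedEmbOn (plane.prod circle) sphere3 f Set.univ := by
  have := finrank_R4
  have := finrank_real_complex_fact'
  let Ψ : ℂ × ℂ × ℂ → EuclideanSpace ℝ (Fin 4) := fun y =>
    scale (c + ρ * y.1 * y.2.1) • K (c + ρ * y.1 * y.2.1, y.2.2)
  have hα : ContDiff ℝ ∞ fun y : ℂ × ℂ × ℂ => (c : ℂ) + ρ * y.1 * y.2.1 := by fun_prop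
  have hΨ : ContDiff ℝ ∞ Ψ :=
    (contDiff_scale.comp hα).smul (K.contDiff.comp (hα.prodMk (by fun_prop)))
  have hcoe : ContMDiff (𝓡 1) 𝓘(ℝ, ℂ) ∞ (fun w : Circle => (w : ℂ)) := contMDiff_coe_sphere (E := ℂ)
  have hζ : ContMDiff (𝓘(ℝ, ℂ).prod (𝓡 1)) 𝓘(ℝ, ℂ × ℂ × ℂ) ∞
      (fun x : ℂ × Circle => (x.1, ((x.2 ^ p : Circle) : ℂ), (x.2 : ℂ))) :=
    contMDiff_fst.prodMk_space (((hcoe.comp ((contMDiff_circle_zpow p).of_le le_top)).comp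
      contMDiff_snd).prodMk_space (hcoe.comp contMDiff_snd))
  let f' : ℂ × Circle → Metric.sphere (0 : EuclideanSpace ℝ (Fin 4)) 1 := f
  have hval : ContMDiff (𝓘(ℝ, ℂ).prod (𝓡 1)) 𝓘(ℝ, EuclideanSpace ℝ (Fin 4)) ∞
      (fun x : ℂ × Circle => (f' x : EuclideanSpace ℝ (Fin 4))) := by
    have : (fun x : ℂ × Circle => (f' x : EuclideanSpace ℝ (Fin 4))) =
      Ψ ∘ fun x : ℂ × Circle => (x.1, ((x.2 ^ p : Circle) : ℂ), (x.2 : ℂ)) := funext hf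
    rw [this]
    exact hΨ.contMDiff.comp hζ
  have hsm : ContMDiff (𝓘(ℝ, ℂ).prod (𝓡 1)) (𝓡 3) ∞ f' :=
    hval.codRestrict_sphere fun x => (f' x).2
  refine ⟨isOpen_univ, hinj.injOn, hsm.contMDiffOn, ?_⟩
  suffices hmain : ∀ (z : ℂ) (w : Circle), Carries
      (derivAt (𝓘(ℝ, ℂ).prod (𝓡 1)) (𝓡 3) f' (z, w)) ((plane.prod circle).orient (z, w))
      (sphere3.orient (f (z, w))) from fun x _ => hmain x.1 x.2
  intro z w
  obtain ⟨θ, rfl⟩ : ∃ θ, Circle.exp θ = w := ⟨_, Circle.exp_arg w⟩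
  refine Carries.of_comp ?_ (carries_planeExp (z, θ))
  refine carries_of_form_pos (by simp) _ _ _ (positionForm_sphere_ne_zero basisR4 (f' (z, Circle.exp θ))) ?_
  rw [positionForm_apply]
  have hv : MDifferentiableAt (𝓡 3) 𝓘(ℝ, EuclideanSpace ℝ (Fin 4))
    (Subtype.val : Metric.sphere (0 : EuclideanSpace ℝ (Fin 4)) 1 → _) (f' (z, Circle.exp θ)) :=
    (contMDiff_coe_sphere (n := 3) (m := 1)).mdifferentiableAt (by simp)
  have hf'd : MDifferentiableAt (𝓘(ℝ, ℂ).prod (𝓡 1)) (𝓡 3) f' (z, Circle.exp θ) :=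
    hsm.mdifferentiableAt (by simp)
  have hed : MDifferentiableAt (𝓘(ℝ, ℂ).prod 𝓘(ℝ, ℝ)) (𝓘(ℝ, ℂ).prod (𝓡 1))
    (Prod.map id Circle.exp) (z, θ) := mdifferentiableAt_id.prodMap (mdifferentiable_circleExp θ)
  let G : ℂ × ℝ → EuclideanSpace ℝ (Fin 4) := fun x => Subtype.val (f' (x.1, Circle.exp x.2))
  have e1 : (derivAt (𝓡 3) 𝓘(ℝ, EuclideanSpace ℝ (Fin 4)) Subtype.val (f' (z, Circle.exp θ))).comp
      ((derivAt (𝓘(ℝ, ℂ).prod (𝓡 1)) (𝓡 3) f' (z, Circle.exp θ)).comp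
        (derivAt (𝓘(ℝ, ℂ).prod 𝓘(ℝ, ℝ)) (𝓘(ℝ, ℂ).prod (𝓡 1)) (Prod.map id Circle.exp) (z, θ))) =
      fderiv ℝ G (z, θ) := by
    rw [← derivAt_eq_fderiv]
    have a1 := derivAt_comp (x := (z, θ)) hf'd hed
    have a2 := derivAt_comp (x := (z, θ)) hv (hf'd.comp (z, θ) hed)
    rw [a1] at a2
    exact a2.symm
  have e2 : ∀ i, derivAt (𝓡 3) 𝓘(ℝ, EuclideanSpace ℝ (Fin 4)) Subtype.val (f' (z, Circle.exp θ))
      (((derivAt (𝓘(ℝ, ℂ).prod (𝓡 1)) (𝓡 3) f' (z, Circle.exp θ)).comp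
        (derivAt (𝓘(ℝ, ℂ).prod 𝓘(ℝ, ℝ)) (𝓘(ℝ, ℂ).prod (𝓡 1)) (Prod.map id Circle.exp) (z, θ)))
          (basisCR i)) = fderiv ℝ G (z, θ) (basisCR i) := fun i =>
    congrArg (fun L : ℂ × ℝ →L[ℝ] EuclideanSpace ℝ (Fin 4) => L (basisCR i)) e1
  suffices h : 0 < basisR4.det (Matrix.vecCons (f' (z, Circle.exp θ) : EuclideanSpace ℝ (Fin 4))
      fun i => fderiv ℝ G (z, θ) (basisCR i)) by
    convert h using 4
    exact e2 _
  let A : ℂ × ℝ → ℂ := fun x => c + ρ * x.1 * Complex.exp (p * (x.2 * Complex.I))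
  let e : ℂ × ℝ → ℂ := fun x => Complex.exp (x.2 * Complex.I)
  have hpow : ∀ t : ℝ, ((Circle.exp t ^ p : Circle) : ℂ) = Complex.exp (p * (t * Complex.I)) :=
    fun t => by rw [Circle.coe_zpow, Circle.coe_exp, ← Complex.exp_int_mul]
  have hG : G = fun x => scale (A x) • K (A x, e x) := by
    funext x
    refine (hf (x.1, Circle.exp x.2)).trans ?_
    simp only [hpow, Circle.coe_exp, A, e]
  have he : HasFDerivAt e (((1 : ℝ →L[ℝ] ℝ).smulRight
      (Complex.exp (θ * Complex.I) * Complex.I)).comp (ContinuousLinearMap.snd ℝ ℂ ℝ)) (z, θ) := by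
    have h3 : HasDerivAt (fun t : ℝ => Complex.exp (t * Complex.I))
        (Complex.exp (θ * Complex.I) * Complex.I) θ := by
      have := ((hasDerivAt_id (θ : ℂ)).mul_const Complex.I).cexp.comp_ofReal
      simpa using this
    exact HasFDerivAt.comp (𝕜 := ℝ) (f := Prod.snd) (z, θ) h3.hasFDerivAt hasFDerivAt_snd
  obtain ⟨d, hd⟩ : ∃ d : ℂ, HasDerivAt (fun t : ℝ => Complex.exp (p * (t * Complex.I))) d θ := by
    have := (((hasDerivAt_id (θ : ℂ)).mul_const Complex.I).const_mul (p : ℂ)).cexp.comp_ofReal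
    exact ⟨_, by simpa using this⟩
  have hA : HasFDerivAt A (((ρ * z : ℂ) • ((1 : ℝ →L[ℝ] ℝ).smulRight d).comp
      (ContinuousLinearMap.snd ℝ ℂ ℝ)) + Complex.exp (p * (θ * Complex.I)) •
        ((ρ : ℂ) • ContinuousLinearMap.fst ℝ ℂ ℝ)) (z, θ) := by
    have h1 : HasFDerivAt (fun x : ℂ × ℝ => Complex.exp (p * (x.2 * Complex.I)))
      (((1 : ℝ →L[ℝ] ℝ).smulRight d).comp (ContinuousLinearMap.snd ℝ ℂ ℝ)) (z, θ) :=
      HasFDerivAt.comp (𝕜 := ℝ) (f := Prod.snd) (z, θ) hd.hasFDerivAt hasFDerivAt_snd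
    have h2 : HasFDerivAt (fun x : ℂ × ℝ => (ρ : ℂ) * x.1)
      ((ρ : ℂ) • ContinuousLinearMap.fst ℝ ℂ ℝ) (z, θ) :=
      (hasFDerivAt_fst (𝕜 := ℝ) (p := (z, θ))).const_mul (ρ : ℂ)
    exact (h2.mul h1).const_add (c : ℂ)
  have hs : HasFDerivAt (fun x => scale (A x)) (fderiv ℝ (fun x => scale (A x)) (z, θ)) (z, θ) :=
    (((contDiff_scale.differentiable (by simp)) _).comp (z, θ) hA.differentiableAt).hasFDerivAt
  have hK : HasFDerivAt (fun x => K (A x, e x)) (K.comp (ContinuousLinearMap.prod _ _)) (z, θ) :=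
    K.hasFDerivAt.comp (z, θ) (hA.prodMk he)
  have hG' : ∀ u, fderiv ℝ G (z, θ) u = scale (A (z, θ)) • K
      ((ρ * z : ℂ) * (u.2 • d) + Complex.exp (p * (θ * Complex.I)) * (ρ * u.1),
        u.2 • (Complex.exp (θ * Complex.I) * Complex.I)) +
      (fderiv ℝ (fun x => scale (A x)) (z, θ) u) • K (A (z, θ), e (z, θ)) := by
    intro u
    rw [hG, (hs.fun_smul hK).fderiv]
    simp
  have hG0 : (f' (z, Circle.exp θ) : EuclideanSpace ℝ (Fin 4)) =
      scale (A (z, θ)) • K (A (z, θ), e (z, θ)) := congrFun hG (z, θ)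
  simp only [hG', hG0]
  rw [det_normalize]
  refine mul_pos (pow_pos (scale_pos _) 4) ?_
  have := hdet (A (z, θ)) (Complex.exp (p * (θ * Complex.I)) * ρ) (ρ * z * d) (Circle.exp θ)
    (mul_ne_zero (Complex.exp_ne_zero _) (by exact_mod_cast hρ.ne'))
  refine this.trans_eq (congrArg (fun v => basisR4.det v)
    (congrArg₂ Matrix.vecCons rfl (funext fun i => ?_)))
  have b0 : basisCR 0 = (1, 0) := by
    have : (0 : Fin 3) = finSumFinEquiv (Sum.inl 0 : Fin 2 ⊕ Fin 1) := rfl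
    rw [this, basisCR, Basis.reindex_apply, Equiv.symm_apply_apply]
    simp
  have b1 : basisCR 1 = (Complex.I, 0) := by
    have : (1 : Fin 3) = finSumFinEquiv (Sum.inl 1 : Fin 2 ⊕ Fin 1) := rfl
    rw [this, basisCR, Basis.reindex_apply, Equiv.symm_apply_apply]
    simp
  have b2 : basisCR 2 = (0, 1) := by
    have : (2 : Fin 3) = finSumFinEquiv (Sum.inr 0 : Fin 2 ⊕ Fin 1) := rfl
    rw [this, basisCR, Basis.reindex_apply, Equiv.symm_apply_apply]
    simp
  fin_cases i
  · simp [b0]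
  · simp [b1, mul_assoc]
  · simp [b2]

theorem emb_meridianFraming (c ρ : ℝ) (hρ : 0 < ρ) (p : ℤ) :
    IsOrientedEmbOn (plane.prod circle) sphere3 (meridianFraming c ρ p) Set.univ := by
  refine emb_framing c ρ p vec4 _ (fun x => rfl) ?_ ?_ hρ
  · rintro ⟨z, w⟩ ⟨z', w'⟩ h
    obtain ⟨h1, h2⟩ := meridian_eq h
    simp only at h1 h2
    subst h2
    have h3 := mul_right_cancel₀ (Circle.coe_ne_zero _) (add_left_cancel h1)
    rw [mul_left_cancel₀ (by exact_mod_cast hρ.ne') h3]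
  · intro a u b w hu
    have h1 : 0 < u.re * u.re + u.im * u.im := by
      rw [← Complex.normSq_apply]; exact Complex.normSq_pos.2 hu
    have h2 : (w : ℂ).re * (w : ℂ).re + (w : ℂ).im * (w : ℂ).im = 1 := by
      rw [← Complex.normSq_apply]; exact Circle.normSq_coe w
    have : basisR4.det (Matrix.vecCons (vec4 (a, (w : ℂ)))
        ![vec4 (u, 0), vec4 (u * Complex.I, 0), vec4 (b, w * Complex.I)]) =
        (u.re * u.re + u.im * u.im) *
          ((w : ℂ).re * (w : ℂ).re + (w : ℂ).im * (w : ℂ).im) := by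
      rw [det_basisR4]
      simp [Matrix.det_succ_row_zero, Fin.sum_univ_succ, Fin.succAbove, vec4_apply]
      ring
    rw [this, h2, mul_one]
    exact h1

theorem emb_axisFraming (q : ℤ) :
    IsOrientedEmbOn (plane.prod circle) sphere3 (axisFraming q) Set.univ := by
  refine emb_framing 0 1 q (vec4.comp
    ((ContinuousLinearMap.snd ℝ ℂ ℂ).prod (ContinuousLinearMap.fst ℝ ℂ ℂ))) _ (fun x => ?_) ?_ ?_
      one_pos
  · simp only [Complex.ofReal_zero, Complex.ofReal_one, zero_add, one_mul]
    rfl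
  · rintro ⟨z, w⟩ ⟨z', w'⟩ h
    obtain ⟨h1, h2⟩ := axis_eq h
    simp only at h1 h2
    subst h2
    rw [mul_right_cancel₀ (Circle.coe_ne_zero _) h1]
  · intro a u b w hu
    have h1 : 0 < u.re * u.re + u.im * u.im := by
      rw [← Complex.normSq_apply]; exact Complex.normSq_pos.2 hu
    have h2 : (w : ℂ).re * (w : ℂ).re + (w : ℂ).im * (w : ℂ).im = 1 := by
      rw [← Complex.normSq_apply]; exact Circle.normSq_coe w
    simp only [ContinuousLinearMap.comp_apply, ContinuousLinearMap.prod_apply,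
      ContinuousLinearMap.coe_fst', ContinuousLinearMap.coe_snd']
    have : basisR4.det (Matrix.vecCons (vec4 ((w : ℂ), a))
        ![vec4 (0, u), vec4 (0, u * Complex.I), vec4 (w * Complex.I, b)]) =
        (u.re * u.re + u.im * u.im) *
          ((w : ℂ).re * (w : ℂ).re + (w : ℂ).im * (w : ℂ).im) := by
      rw [det_basisR4]
      simp [Matrix.det_succ_row_zero, Fin.sum_univ_succ, Fin.succAbove, vec4_apply]
      ring
    rw [this, h2, mul_one]
    exact h1

/-- The centres `-1/2, 3/8, …` of a sequence of disjoint disks in the unit disk. -/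
noncomputable def centre (k : ℕ) : ℝ := 2 / 3 - 7 / 6 * (1 / 4) ^ k

/-- The radii `1/4, 1/16, …` of these disks. -/
noncomputable def radius (k : ℕ) : ℝ := (1 / 4) ^ (k + 1)

theorem radius_pos (k : ℕ) : 0 < radius k := by unfold radius; positivity

theorem centre_lt {k l : ℕ} (h : k < l) : centre k + radius k < centre l - radius l := by
  have h1 : ((1 : ℝ) / 4) ^ l ≤ (1 / 4) ^ (k + 1) :=
    pow_le_pow_of_le_one (by norm_num) (by norm_num) h
  have h2 : (0 : ℝ) < (1 / 4) ^ k := by positivity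
  unfold centre radius
  rw [pow_succ] at h1 ⊢
  rw [pow_succ]
  linarith

theorem centre_bounds (k : ℕ) : |centre k| + radius k < 1 := by
  have h1 : ((1 : ℝ) / 4) ^ k ≤ 1 := pow_le_one₀ (by norm_num) (by norm_num)
  have h2 : (0 : ℝ) < (1 / 4) ^ k := by positivity
  unfold centre radius
  rw [pow_succ]
  rcases abs_cases (2 / 3 - 7 / 6 * ((1 : ℝ) / 4) ^ k) with h | h <;> linarith [h.1]

theorem disjoint_meridian {k l : ℕ} (hkl : k < l) (p p' : ℤ) :
    Disjoint (meridianFraming (centre k) (radius k) p '' solidTorus)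
      (meridianFraming (centre l) (radius l) p' '' solidTorus) := by
  rw [Set.disjoint_left]
  rintro _ ⟨⟨z, w⟩, hz, rfl⟩ ⟨⟨z', w'⟩, hz', h⟩
  have h1 := (meridian_eq h).1
  simp only [solidTorus, Set.mem_ofPred_eq] at hz hz'
  have h2 := congrArg Complex.re h1
  simp only [Complex.add_re, Complex.ofReal_re, mul_assoc, Complex.re_ofReal_mul] at h2
  have b1 : |(z * ((w ^ p : Circle) : ℂ)).re| ≤ 1 :=
    (Complex.abs_re_le_norm _).trans (by rw [norm_mul, Circle.norm_coe, mul_one]; exact hz)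
  have b2 : |(z' * ((w' ^ p' : Circle) : ℂ)).re| ≤ 1 :=
    (Complex.abs_re_le_norm _).trans (by rw [norm_mul, Circle.norm_coe, mul_one]; exact hz')
  rw [abs_le] at b1 b2
  have := centre_lt hkl
  nlinarith [radius_pos k, radius_pos l]

theorem disjoint_axis (k : ℕ) (p q : ℤ) :
    Disjoint (meridianFraming (centre k) (radius k) p '' solidTorus)
      (axisFraming q '' solidTorus) := by
  rw [Set.disjoint_left]
  rintro _ ⟨⟨z, w⟩, hz, rfl⟩ ⟨⟨z', w'⟩, hz', h⟩
  have h1 := meridian_axis h.symm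
  simp only [solidTorus, Set.mem_ofPred_eq] at hz hz'
  have b1 : ‖(centre k : ℂ) + radius k * z * ((w ^ p : Circle) : ℂ)‖ < 1 := by
    refine (norm_add_le _ _).trans_lt ?_
    rw [norm_mul, norm_mul, Circle.norm_coe, mul_one, Complex.norm_real, Complex.norm_real,
      Real.norm_eq_abs, Real.norm_eq_abs, abs_of_pos (radius_pos k)]
    have := centre_bounds k
    nlinarith [radius_pos k]
  have b2 : ‖z' * ((w' ^ q : Circle) : ℂ)‖ ≤ 1 := by
    rw [norm_mul, Circle.norm_coe, mul_one]; exact hz'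
  have := mul_lt_one_of_nonneg_of_lt_one_left (norm_nonneg _) b1 b2
  exact this.ne h1

/-- The framed link `L(q, p₁, …, pᵣ)`: an unknot (the axis, component `none`) with integral framing
`q`, and `r` unlinked parallel meridian circles of it (components `some k`) with integral
framings `pₖ`. -/
noncomputable def starLink {r : ℕ} (q : ℤ) (p : Fin r → ℤ) : FramedLink (Option (Fin r)) where
  h := fun k => k.elim (axisFraming q) fun k => meridianFraming (centre k) (radius k) (p k)
  emb := fun k => ⟨Set.univ, Set.subset_univ _, by
    cases k with
    | none => exact emb_axisFraming q
    | some k => exact emb_meridianFraming _ _ (radius_pos k) _⟩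
  disjoint := fun k l hkl => by
    cases k with
    | none =>
      cases l with
      | none => exact absurd rfl hkl
      | some l => exact (disjoint_axis l _ _).symm
    | some k =>
      cases l with
      | none => exact disjoint_axis k _ _
      | some l =>
        rcases lt_or_gt_of_ne (fun h => hkl (congrArg some (Fin.ext h)) : (k : ℕ) ≠ l) with h | h
        · exact disjoint_meridian h _ _
        · exact (disjoint_meridian h _ _).symm

/-- `W` is the solid torus `D² × S¹`, viewed as a cobordism from the empty surface to
`S¹ × S¹ = ∂D² × S¹`. -/
def Cobordism.IsSolidTorus (W : Cobordism emptySurface torus) : Prop :=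
  ∃ Φ : ℂ × Circle → W.N, IsOrientedEmbNear (plane.prod circle) W.N Φ solidTorus ∧
    Φ '' solidTorus = W.X ∧ ∀ z w : Circle, W.out (z, w) = Φ (z, w)

/-- `Y × S¹`, where the 3-holed sphere `Y` is the unit disk without the open disks of radius `1/4`
around `-1/2` and `1/2`. -/
def pantsTimesCircle : Set (ℂ × Circle) :=
  {p | ‖p.1‖ ≤ 1 ∧ 1 / 4 ≤ ‖p.1 + 1 / 2‖ ∧ 1 / 4 ≤ ‖p.1 - 1 / 2‖}

/-- `W` is `Y × S¹`, viewed as a cobordism from `C₁ × S¹ ⊔ C₂ × S¹` to `C₃ × S¹`, where `C₁` and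
`C₂` are the inner boundary circles of `Y` and `C₃` is the outer one. -/
def Cobordism.IsFusion {A : ClosedManifold 2} (d : DisjUnion torus torus A)
    (W : Cobordism A torus) : Prop :=
  ∃ Φ : ℂ × Circle → W.N, IsOrientedEmbNear (plane.prod circle) W.N Φ pantsTimesCircle ∧
    Φ '' pantsTimesCircle = W.X ∧
    (∀ z w : Circle, W.inc (d.i₁ (z, w)) = Φ (-1 / 2 + z / 4, w)) ∧
    (∀ z w : Circle, W.inc (d.i₂ (z, w)) = Φ (1 / 2 + z / 4, w)) ∧
    ∀ z w : Circle, W.out (z, w) = Φ (z, w)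

/-- Verlinde bases `v₀, …, vₘ` of `Z(S¹ × S¹)`. The product of the fusion algebra `Z(S¹ × S¹)` is
`Z_W` for `W = (Y × S¹; C₁ × S¹ ⊔ C₂ × S¹, C₃ × S¹)`, and its identity element is `Z_{W₀}(1)` for
`W₀ = (D² × S¹; ∅, S¹ × S¹)`. -/
structure TQFT.IsVerlindeBasis (Z : TQFT) {m : ℕ} (v : Basis (Fin (m + 1)) ℂ (Z.V torus))
    (S : Matrix (Fin (m + 1)) (Fin (m + 1)) ℂ) : Prop where
  /-- `S` is the matrix of `Z(S)`. -/
  matrix_eq : ∀ i, Z.map torusS (v i) = ∑ j, S j i • v j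
  /-- `v₀` is the identity element of the fusion algebra. -/
  identity : ∀ W : Cobordism emptySurface torus, W.IsSolidTorus → v 0 = Z.cob W (Z.ofEmpty 1)
  unitary : S ∈ Matrix.unitaryGroup (Fin (m + 1)) ℂ
  symmetric : S.IsSymm
  square_zero : Z.map torusS (Z.map torusS (v 0)) = v 0
  square_mem : ∀ i, ∃ j, Z.map torusS (Z.map torusS (v i)) = v j
  ne_zero : ∀ i, S i 0 ≠ 0
  /-- The structure constants of the fusion algebra. -/
  fusion : ∀ (A : ClosedManifold 2) (d : DisjUnion torus torus A) (W : Cobordism A torus),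
    W.IsFusion d → ∀ i j, Z.cob W (Z.tensor d (v i ⊗ₜ v j)) =
      ∑ k, (∑ l, S i l * S j l * starRingEnd ℂ (S l k) / S 0 l) • v k
  /-- `Z(T)` is diagonal. -/
  diagonal : ∀ i, ∃ t : ℂ, Z.map torusT (v i) = t • v i
  /-- `Z(U) vⱼ` is the dual basis vector `vⱼ*` under the identification of `Z(-(S¹ × S¹))` with the
  dual space of `Z(S¹ × S¹)` by the pairing given by the cylinder. -/
  dual : ∀ (A : ClosedManifold 2) (d : DisjUnion torus torus.neg A) (W : Cobordism A emptySurface),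
    W.IsEvaluation d → ∀ i j, Z.ofEmpty.symm (Z.cob W (Z.tensor d (v i ⊗ₜ Z.map torusU (v j)))) =
      if i = j then 1 else 0

end TQFT3

namespace TQFT3

open OrientedManifold

/-! ### Calculus of oriented embeddings and diffeomorphisms -/

section Embeddings

variable {n : ℕ} {M N P : OrientedManifold n}

/-! The sphere `S³` is a tube about the axis together with the complementary solid torus of points
`meridianPoint a w`, `‖a‖ ≤ 1`, in which the meridian circles of the link are fibres `c × S¹`. Hence
the exterior of the link is `Y × S¹`, with `Y` a disk with `r` holes. In these coordinates the
framings turn the surgery gluing into `T^(p k) S` at the `k`-th hole and into `(z, w) ↦ (z, w̄ z^q)`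
at the outer boundary (`exterior_starLink`, `FramedLink.IsSurgery.exists_isClosedStar`).

Call the union of `Y × S¹` and the `r` solid tori at the holes a star. Cutting off a three-holed
sphere times `S¹` exhibits the vector of a star with `r + 1` solid tori as the fusion product of
`Z(T^p S) v₀ = ∑ t_i^p S_{i0} v_i`, the vector of one reglued solid torus, and the vector of a star
with `r` solid tori (`IsStar.isDecomposition`, `IsStar.isFusion_middle`, `IsDecomposition.cob_eq`).
The vectors `e_l = S_{0l} ∑_k conj(S_{lk}) v_k` diagonalize fusion: the Verlinde formula and
unitarity give `v_i e_l = (S_{il} / S_{0l}) e_l` and `∑ e_l = v₀`. By induction the vector of a star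
is `∑_l ∏_k (∑_i t_i^{p_k} S_{i0} S_{il} / S_{0l}) e_l` (`cob_star`).

The last solid torus is separated from the star by a cylinder, so `Z(M)` is the duality pairing of
this vector with `Z(U S³ T^q S) v₀`. As `S²` is inversion on the torus, it commutes with the other
factors that it has to pass, and it fixes `v₀`; so the second vector is `Z(U) Z(S) ∑ t_i^q S_{i0}
v_i`. Duality and unitarity pair `e_l` with it to `S_{0l} t_l^q S_{l0}` (`evaluation_idem`). Summing
over `l` and multiplying out the product gives the formula; the two extra factors `S_{0l} = S_{l0}`
are the `-2` in the exponent `r - 2`.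

Most of the remaining work shows that the pieces are cobordisms with correctly oriented collars. A
collar is built on the side of a surface where the domain is explicit and then transferred to the
other side (`HasCollar.flip`), and frontiers are never computed but follow from openness away from
the boundary surfaces (`Cobordism.ofIsOpen`). -/

theorem IsOrientedEmbOn.mono {f : M → N} {U V : Set M} (h : IsOrientedEmbOn M N f U)
    (hV : IsOpen V) (hVU : V ⊆ U) : IsOrientedEmbOn M N f V :=
  ⟨hV, h.injOn.mono hVU, h.contMDiffOn.mono hVU, fun x hx => h.carries x (hVU hx)⟩

theorem IsOrientedEmbOn.mdifferentiableAt {f : M → N} {U : Set M} (h : IsOrientedEmbOn M N f U)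
    {x : M} (hx : x ∈ U) : MDifferentiableAt M.I N.I f x :=
  (h.contMDiffOn.contMDiffAt (h.isOpen.mem_nhds hx)).mdifferentiableAt (by simp)

theorem IsOrientedEmbOn.comp {f : M → N} {g : N → P} {U : Set M} {V : Set N}
    (hg : IsOrientedEmbOn N P g V) (hf : IsOrientedEmbOn M N f U) :
    IsOrientedEmbOn M P (g ∘ f) (U ∩ f ⁻¹' V) where
  isOpen := hf.contMDiffOn.continuousOn.isOpen_inter_preimage hf.isOpen hg.isOpen
  injOn := fun x hx y hy h => hf.injOn hx.1 hy.1 (hg.injOn hx.2 hy.2 h)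
  contMDiffOn := hg.contMDiffOn.comp (hf.contMDiffOn.mono Set.inter_subset_left) fun _ hx => hx.2
  carries := fun x hx => by
    rw [derivAt_comp (hg.mdifferentiableAt hx.2) (hf.mdifferentiableAt hx.1)]
    exact (hg.carries _ hx.2).comp (hf.carries x hx.1)

theorem IsOrientedEmbNear.mono {f : M → N} {X Y : Set M} (h : IsOrientedEmbNear M N f X)
    (hY : Y ⊆ X) : IsOrientedEmbNear M N f Y := by
  obtain ⟨U, hU, h⟩ := h
  exact ⟨U, hY.trans hU, h⟩

theorem IsOrientedEmbNear.comp {f : M → N} {g : N → P} {X : Set M} {Y : Set N}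
    (hg : IsOrientedEmbNear N P g Y) (hf : IsOrientedEmbNear M N f X) (h : Set.MapsTo f X Y) :
    IsOrientedEmbNear M P (g ∘ f) X := by
  obtain ⟨U, hU, hf⟩ := hf
  obtain ⟨V, hV, hg⟩ := hg
  exact ⟨U ∩ f ⁻¹' V, fun x hx => ⟨hU hx, hV (h hx)⟩, hg.comp hf⟩

theorem IsOrientedEmbNear.injOn {f : M → N} {X : Set M} (h : IsOrientedEmbNear M N f X) :
    Set.InjOn f X := by
  obtain ⟨U, hU, h⟩ := h
  exact h.injOn.mono hU

theorem IsOrientedEmbNear.isCompact_image {f : M → N} {X : Set M} (h : IsOrientedEmbNear M N f X)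
    (hX : IsCompact X) : IsCompact (f '' X) := by
  obtain ⟨U, hU, h⟩ := h
  exact hX.image_of_continuousOn (h.contMDiffOn.continuousOn.mono hU)

theorem isOrientedEmbOn_id (M : OrientedManifold n) : IsOrientedEmbOn M M id Set.univ where
  isOpen := isOpen_univ
  injOn := Set.injOn_id _
  contMDiffOn := contMDiff_id.contMDiffOn
  carries := fun x _ => by rw [derivAt_id]; exact carries_id _

theorem isOrientedEmbNear_id (M : OrientedManifold n) (X : Set M) : IsOrientedEmbNear M M id X :=
  ⟨Set.univ, Set.subset_univ _, isOrientedEmbOn_id M⟩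

namespace OrientedDiffeo

theorem isOrientedEmbOn (f : OrientedDiffeo M N) : IsOrientedEmbOn M N f Set.univ where
  isOpen := isOpen_univ
  injOn := f.toEquiv.injective.injOn
  contMDiffOn := f.contMDiff_toFun.contMDiffOn
  carries := fun x _ => f.carries x

theorem ext {f g : OrientedDiffeo M N} (h : ∀ x, f x = g x) : f = g := by
  obtain ⟨f, hf⟩ := f
  obtain ⟨g, hg⟩ := g
  have : f = g := Diffeomorph.ext h
  subst this
  rfl

/-- The inverse diffeomorphism. -/
noncomputable def symm (f : OrientedDiffeo M N) : OrientedDiffeo N M where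
  toDiffeomorph := f.toDiffeomorph.symm
  carries := fun y => by
    obtain ⟨x, rfl⟩ := f.toEquiv.surjective y
    change Carries (derivAt N.I M.I f.toDiffeomorph.symm (f x)) (N.orient (f x))
      (M.orient (f.toDiffeomorph.symm (f.toDiffeomorph x)))
    rw [Diffeomorph.symm_apply_apply]
    -- The behaviour of the inverse on orientations is obtained by cancelling that of `f` in `f.symm
    -- ∘ f = id`.
    refine Carries.of_comp (L := derivAt M.I N.I f x) ?_ (f.carries x)
    have h : f.toDiffeomorph.symm ∘ f.toDiffeomorph = id :=
      funext f.toDiffeomorph.symm_apply_apply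
    have h2 := derivAt_comp (I := M.I) (I' := N.I) (I'' := M.I) (x := x)
      (g := f.toDiffeomorph.symm) (f := f.toDiffeomorph)
      (f.toDiffeomorph.symm.contMDiff.mdifferentiableAt (by simp))
      (f.toDiffeomorph.contMDiff.mdifferentiableAt (by simp))
    rw [h, derivAt_id] at h2
    exact h2 ▸ carries_id _

theorem symm_apply_apply (f : OrientedDiffeo M N) (x : M) : f.symm (f x) = x :=
  f.toDiffeomorph.symm_apply_apply x

theorem apply_symm_apply (f : OrientedDiffeo M N) (x : N) : f (f.symm x) = x :=
  f.toDiffeomorph.apply_symm_apply x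

end OrientedDiffeo

end Embeddings

/-! ### Products of embeddings; reversal of both factors -/

section ProductEmbeddings

variable {m n : ℕ} [NeZero m] [NeZero n]

theorem Carries.unique {n : ℕ} {V W : Type} [NormedAddCommGroup V] [NormedSpace ℝ V]
    [NormedAddCommGroup W] [NormedSpace ℝ W] {L : V →L[ℝ] W} {a : Orientation ℝ V (Fin n)}
    {b b' : Orientation ℝ W (Fin n)} (h : Carries L a b) (h' : Carries L a b') : b = b' := by
  obtain ⟨e, he, rfl⟩ := h
  obtain ⟨e', he', rfl⟩ := h'
  rw [LinearEquiv.ext fun v => (he v).trans (he' v).symm]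

/-- Realizes the reversal of an orientation by a linear map, for `prodOrientation_neg_neg`. The
dimension has to be positive. -/
theorem exists_det_eq_neg_one {V : Type} [NormedAddCommGroup V] [NormedSpace ℝ V]
    [FiniteDimensional ℝ V] (hV : finrank ℝ V = n) :
    ∃ A : V →L[ℝ] V, LinearMap.det (A : V →ₗ[ℝ] V) = -1 := by
  let b := finBasisOfFinrankEq ℝ V hV
  refine ⟨LinearMap.toContinuousLinearMap
    (Matrix.toLin b b (Matrix.diagonal (Function.update 1 0 (-1)))), ?_⟩
  rw [LinearMap.coe_toContinuousLinearMap, LinearMap.det_toLin, Matrix.det_diagonal,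
    Finset.prod_update_of_mem (Finset.mem_univ _)]
  simp

/-- The direct sum of two maps of determinant `-1` has determinant `1`, so it carries the product
orientation to itself; factor by factor it carries it to the product of the opposite orientations. A
linear map determines the image orientation. -/
theorem prodOrientation_neg_neg {V W : Type} [NormedAddCommGroup V] [NormedSpace ℝ V]
    [NormedAddCommGroup W] [NormedSpace ℝ W] [FiniteDimensional ℝ V]
    [FiniteDimensional ℝ W] (hV : finrank ℝ V = m) (hW : finrank ℝ W = n)
    (a : Orientation ℝ V (Fin m)) (b : Orientation ℝ W (Fin n)) :
    prodOrientation hV hW (-a) (-b) = prodOrientation hV hW a b := by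
  obtain ⟨A, hA⟩ := exists_det_eq_neg_one hV
  obtain ⟨B, hB⟩ := exists_det_eq_neg_one hW
  refine Carries.unique ((carries_neg_of_det_neg hV A a (by simp [hA])).prodMap hV hW hV hW
    (carries_neg_of_det_neg hW B b (by simp [hB]))) (carries_of_det_pos (by simp [hV, hW]) _ _ ?_)
  have : ((A.prodMap B : V × W →L[ℝ] V × W) : V × W →ₗ[ℝ] V × W) =
      (A : V →ₗ[ℝ] V).prodMap (B : W →ₗ[ℝ] W) := rfl
  rw [this, LinearMap.det_prodMap, hA, hB]
  norm_num

theorem IsOrientedEmbOn.prodMap {M M' : OrientedManifold m} {N N' : OrientedManifold n}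
    {f : M → M'} {g : N → N'} {U : Set M} {V : Set N} (hf : IsOrientedEmbOn M M' f U)
    (hg : IsOrientedEmbOn N N' g V) :
    IsOrientedEmbOn (M.prod N) (M'.prod N') (Prod.map f g) (U ×ˢ V) where
  isOpen := hf.isOpen.prod hg.isOpen
  injOn := fun x hx y hy h => Prod.ext (hf.injOn hx.1 hy.1 (congrArg Prod.fst h))
    (hg.injOn hx.2 hy.2 (congrArg Prod.snd h))
  contMDiffOn := hf.contMDiffOn.prodMap hg.contMDiffOn
  carries := fun x hx => by
    have h : derivAt (M.I.prod N.I) (M'.I.prod N'.I) (Prod.map f g) x =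
        (derivAt M.I M'.I f x.1).prodMap (derivAt N.I N'.I g x.2) :=
      derivAt_prodMap (hf.mdifferentiableAt hx.1) (hg.mdifferentiableAt hx.2)
    change Carries (derivAt (M.I.prod N.I) (M'.I.prod N'.I) (Prod.map f g) x) _ _
    rw [h]
    exact (hf.carries _ hx.1).prodMap M.finrank_eq N.finrank_eq M'.finrank_eq N'.finrank_eq
      (hg.carries _ hx.2)

/-- Serves for collars in which the surface changes orientation and the collar direction is reversed
at the same time. -/
theorem IsOrientedEmbOn.of_neg_prod {M : OrientedManifold m} {N : OrientedManifold n}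
    {P : OrientedManifold (m + n)} {f : M × N → P} {U : Set (M × N)}
    (h : IsOrientedEmbOn (M.neg.prod N.neg) P f U) : IsOrientedEmbOn (M.prod N) P f U where
  isOpen := h.isOpen
  injOn := h.injOn
  contMDiffOn := h.contMDiffOn
  carries := fun x hx => by
    have := h.carries x hx
    have e : (M.neg.prod N.neg).orient x = (M.prod N).orient x :=
      prodOrientation_neg_neg M.finrank_eq N.finrank_eq _ _
    rw [e] at this
    exact this

end ProductEmbeddings

/-! ### Collars of boundary surfaces -/

section Collars

/-- `f : S → N` has a bicollar `S × (-ε, ε) → N` in which the domain `X` consists of the points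
whose collar coordinate satisfies `P`. -/
def HasCollar (P : ℝ → Prop) (S : OrientedManifold 2) (N : OrientedManifold 3) (X : Set N)
    (f : S → N) : Prop :=
  ∃ ε > 0, ∃ c : S × ℝ → N, IsOrientedEmbOn (S.prod line) N c {p : S × ℝ | |p.2| < ε} ∧
    (∀ x, c (x, 0) = f x) ∧ ∀ x t, |t| < ε → (c (x, t) ∈ X ↔ P t)

variable {S : OrientedManifold 2} {N : OrientedManifold 3} {X X' O : Set N} {f : S → N}
  {P Q : ℝ → Prop}

theorem isOpen_abs_snd_lt {Y : Type} [TopologicalSpace Y] (ε : ℝ) :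
    IsOpen {p : Y × ℝ | |p.2| < ε} :=
  isOpen_lt (by fun_prop) continuous_const

/-- A collar shrinks into a given neighbourhood of the surface. -/
theorem IsOrientedEmbOn.exists_shrink [CompactSpace S] {c : S × ℝ → N} {U : Set (S × ℝ)}
    (hc : IsOrientedEmbOn (S.prod line) N c U) (hU : ∀ x, (x, 0) ∈ U) (hO : IsOpen O)
    (hcO : ∀ x, c (x, 0) ∈ O) : ∃ ε > 0,
      IsOrientedEmbOn (S.prod line) N c {p : S × ℝ | |p.2| < ε} ∧
      ∀ x t, |t| < ε → (x, t) ∈ U ∧ c (x, t) ∈ O := by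
  have hV : IsOpen (U ∩ c ⁻¹' O) :=
    hc.contMDiffOn.continuousOn.isOpen_inter_preimage hc.isOpen hO
  -- Compactness of `S` makes the width of the collar uniform.
  obtain ⟨u, v, -, hv, hu, h0, huv⟩ := generalized_tube_lemma (s := (Set.univ : Set S))
    isCompact_univ (t := {(0 : ℝ)}) isCompact_singleton (n := U ∩ c ⁻¹' O) hV (by
      rintro ⟨x, t⟩ ⟨-, rfl⟩
      exact ⟨hU x, hcO x⟩)
  obtain ⟨ε, hε, hεv⟩ := Metric.isOpen_iff.1 hv 0 (h0 rfl)
  have key : ∀ x t, |t| < ε → (x, t) ∈ U ∩ c ⁻¹' O := fun x t ht =>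
    huv ⟨hu trivial, hεv (by simpa using ht)⟩
  exact ⟨ε, hε, hc.mono (isOpen_abs_snd_lt ε) fun p hp => (key p.1 p.2 hp).1, key⟩

theorem HasCollar.exists_shrink [CompactSpace S] (h : HasCollar P S N X f) (hO : IsOpen O)
    (hf : ∀ x, f x ∈ O) : ∃ ε > 0, ∃ c : S × ℝ → N,
      IsOrientedEmbOn (S.prod line) N c {p : S × ℝ | |p.2| < ε} ∧ (∀ x, c (x, 0) = f x) ∧
      (∀ x t, |t| < ε → (c (x, t) ∈ X ↔ P t)) ∧ ∀ x t, |t| < ε → c (x, t) ∈ O := by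
  obtain ⟨ε, hε, c, hc, hc0, hcX⟩ := h
  obtain ⟨δ, hδ, hc', h'⟩ := hc.exists_shrink (fun x => show |(0 : ℝ)| < ε by simpa using hε) hO
    (fun x => by rw [hc0]; exact hf x)
  exact ⟨δ, hδ, c, hc', hc0, fun x t ht => hcX x t (h' x t ht).1, fun x t ht => (h' x t ht).2⟩

/-- A collar can be shrunk, so only the trace of the domain on a neighbourhood of the surface
matters. -/
theorem HasCollar.congr [CompactSpace S] (h : HasCollar P S N X f) (hO : IsOpen O)
    (hf : ∀ x, f x ∈ O) (hX : ∀ y ∈ O, y ∈ X' ↔ y ∈ X) : HasCollar P S N X' f := by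
  obtain ⟨ε, hε, c, hc, hc0, hcX, hcO⟩ := h.exists_shrink hO hf
  exact ⟨ε, hε, c, hc, hc0, fun x t ht => (hX _ (hcO x t ht)).trans (hcX x t ht)⟩

/-- The domain on the other side of the surface has the complementary collar. -/
theorem HasCollar.flip [CompactSpace S] (h : HasCollar P S N X f)
    (hPQ : ∀ t, Q t ↔ ¬ P t ∨ t = 0) (hO : IsOpen O)
    (hf : ∀ x, f x ∈ O) (hXX' : O ⊆ X ∪ X') (hint : O ∩ (X ∩ X') ⊆ Set.range f)
    (hfX' : ∀ x, f x ∈ X') : HasCollar Q S N X' f := by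
  obtain ⟨ε, hε, c, hc, hc0, hcX, hcO⟩ := h.exists_shrink hO hf
  refine ⟨ε, hε, c, hc, hc0, fun x t ht => ?_⟩
  rw [hPQ]
  by_cases h0 : t = 0
  · subst h0
    simp [hc0, hfX']
  · simp only [h0, or_false]
    constructor
    · intro hx hp
      -- A collar point in both domains lies on the surface, so it is also `c (y, 0)`, and
      -- injectivity of the collar forces `t = 0`.
      obtain ⟨y, hy⟩ := hint ⟨hcO x t ht, (hcX x t ht).2 hp, hx⟩
      rw [← hc0] at hy
      have := hc.injOn (show |((y, 0) : S × ℝ).2| < ε by simpa using hε) ht hy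
      exact h0 (congrArg Prod.snd this).symm
    · intro hp
      exact (hXX' (hcO x t ht)).resolve_left fun hx => hp ((hcX x t ht).1 hx)

theorem HasCollar.reparam {S' : OrientedManifold 2} (h : HasCollar P S N X f)
    (φ : OrientedDiffeo S' S) : HasCollar P S' N X (f ∘ φ) := by
  obtain ⟨ε, hε, c, hc, hc0, hcX⟩ := h
  refine ⟨ε, hε, c ∘ Prod.map φ id, ?_, fun x => hc0 _, fun x t ht => hcX _ _ ht⟩
  exact (hc.comp (φ.isOrientedEmbOn.prodMap (isOrientedEmbOn_id line))).mono
    (isOpen_abs_snd_lt ε) fun p hp => ⟨⟨trivial, trivial⟩, hp⟩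

/-- On the collar line through a point of the surface, parameters that violate `P` accumulate at
`0`; so the point is not interior. -/
theorem HasCollar.range_subset_frontier (h : HasCollar P S N X f) (hP0 : P 0)
    (hP : ∃ᶠ t in 𝓝 (0 : ℝ), ¬ P t) : Set.range f ⊆ frontier X := by
  rintro _ ⟨x, rfl⟩
  obtain ⟨ε, hε, c, hc, hc0, hcX⟩ := h
  have hx : f x ∈ X := by rw [← hc0, hcX x 0 (by simpa using hε)]; exact hP0
  refine ⟨subset_closure hx, fun hi => ?_⟩
  have hcont : ContinuousAt (fun t : ℝ => c (x, t)) 0 :=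
    ((hc.contMDiffOn.continuousOn.continuousAt ((isOpen_abs_snd_lt ε).mem_nhds
      (show |((x, 0) : S × ℝ).2| < ε by simpa using hε))).comp
      (f := fun t : ℝ => (x, t)) (by fun_prop : ContinuousAt (fun t : ℝ => (x, t)) 0))
  rw [← hc0] at hi
  have h1 := hcont.eventually (mem_interior_iff_mem_nhds.1 hi)
  have h2 : ∀ᶠ t in 𝓝 (0 : ℝ), |t| < ε := by
    filter_upwards [Metric.ball_mem_nhds (0 : ℝ) hε] with t ht
    simpa using ht
  obtain ⟨t, ht, ht1, ht2⟩ := (hP.and_eventually (h1.and h2)).exists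
  exact ht ((hcX x t ht2).1 ht1)

theorem IsOutgoing.range_subset_frontier (h : IsOutgoing S N X f) : Set.range f ⊆ frontier X := by
  refine HasCollar.range_subset_frontier h le_rfl ?_
  simp only [not_le]
  exact (eventually_mem_nhdsWithin (a := (0 : ℝ)) (s := Set.Ioi 0)).frequently.filter_mono
    nhdsWithin_le_nhds

theorem IsIncoming.range_subset_frontier (h : IsIncoming S N X f) : Set.range f ⊆ frontier X := by
  refine HasCollar.range_subset_frontier h le_rfl ?_
  simp only [not_le]
  exact (eventually_mem_nhdsWithin (a := (0 : ℝ)) (s := Set.Iio 0)).frequently.filter_mono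
    nhdsWithin_le_nhds

theorem IsOutgoing.flip [CompactSpace S] (h : IsOutgoing S N X f) (hO : IsOpen O)
    (hf : ∀ x, f x ∈ O) (hXX' : O ⊆ X ∪ X') (hint : O ∩ (X ∩ X') ⊆ Set.range f)
    (hfX' : ∀ x, f x ∈ X') : IsIncoming S N X' f :=
  HasCollar.flip h (fun t => by rw [not_le, le_iff_lt_or_eq, eq_comm]) hO hf hXX' hint hfX'

theorem IsIncoming.flip [CompactSpace S] (h : IsIncoming S N X f) (hO : IsOpen O)
    (hf : ∀ x, f x ∈ O) (hXX' : O ⊆ X ∪ X') (hint : O ∩ (X ∩ X') ⊆ Set.range f)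
    (hfX' : ∀ x, f x ∈ X') : IsOutgoing S N X' f :=
  HasCollar.flip h (fun t => by rw [not_le, le_iff_lt_or_eq]) hO hf hXX' hint hfX'

theorem hasCollar_empty (P : ℝ → Prop) (X : Set N) (f : emptySurface → N) :
    HasCollar P emptySurface.toOrientedManifold N X f :=
  ⟨1, one_pos, fun p => Empty.elim p.1,
    ⟨isOpen_abs_snd_lt (Y := Empty) 1,
      fun p => Empty.elim p.1, fun p => Empty.elim p.1, fun p => Empty.elim p.1⟩,
    fun x => Empty.elim x, fun x => Empty.elim x⟩

end Collars

/-- A cobordism, from a compact set that is open away from its boundary surfaces. -/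
def Cobordism.ofIsOpen {S₀ S₁ : ClosedManifold 2} (N : OrientedManifold 3) (X : Set N)
    (inc : S₀ → N) (out : S₁ → N) (isCompact : IsCompact X)
    (incoming : IsIncoming S₀ N X inc) (outgoing : IsOutgoing S₁ N X out)
    (disjoint : Disjoint (Set.range inc) (Set.range out))
    (isOpen : IsOpen (X \ (Set.range inc ∪ Set.range out))) : Cobordism S₀ S₁ where
  N := N
  X := X
  inc := inc
  out := out
  isCompact := isCompact
  incoming := incoming
  outgoing := outgoing
  disjoint := disjoint
  frontier_eq := by
    -- The collars place the boundary surfaces in the frontier. Conversely the rest of `X` is open,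
    -- hence interior.
    refine Set.Subset.antisymm (fun x hx => ?_)
      (Set.union_subset incoming.range_subset_frontier outgoing.range_subset_frontier)
    by_contra h
    rw [frontier, isCompact.isClosed.closure_eq] at hx
    exact hx.2 (mem_interior.2 ⟨_, Set.sdiff_subset, isOpen, hx.1, h⟩)

theorem Cobordism.isOpen_diff {S₀ S₁ : ClosedManifold 2} (W : Cobordism S₀ S₁) :
    IsOpen (W.X \ (Set.range W.inc ∪ Set.range W.out)) := by
  rw [← W.frontier_eq, self_sdiff_frontier]
  exact isOpen_interior

theorem isEmpty_emptySurface : IsEmpty emptySurface := inferInstanceAs (IsEmpty Empty)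

theorem range_emptySurface {Y : Type} (f : emptySurface → Y) : Set.range f = ∅ :=
  @Set.range_eq_empty _ _ isEmpty_emptySurface f

/-! ### Disjoint unions of two copies of a surface -/

section Sum

variable {E H M M' : Type} [NormedAddCommGroup E] [NormedSpace ℝ E] [TopologicalSpace H]
  [TopologicalSpace M] [ChartedSpace H M] [TopologicalSpace M'] [ChartedSpace H M']
  {I : ModelWithCorners ℝ E H}

theorem extChartAt_inl_apply (x y : M) :
    extChartAt I (Sum.inl x : M ⊕ M') (Sum.inl y) = extChartAt I x y := by
  simp [extChartAt, ChartedSpace.sum_chartAt_inl, Sum.inl_injective.extend_apply]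

theorem extChartAt_inr_apply (x y : M') :
    extChartAt I (Sum.inr x : M ⊕ M') (Sum.inr y) = extChartAt I x y := by
  simp [extChartAt, ChartedSpace.sum_chartAt_inr, Sum.inr_injective.extend_apply]

/-- The derivative is read in the preferred charts at `x` and `f x`. If these charts correspond
under `f`, the coordinate expression of `f` is the identity. -/
theorem derivAt_eq_id_of_extChartAt {N : Type} [TopologicalSpace N] [ChartedSpace H N] {f : M → N}
    {x : M} (hf : ContinuousAt f x) (h : ∀ y, extChartAt I (f x) (f y) = extChartAt I x y) :
    derivAt I I f x = ContinuousLinearMap.id ℝ E := by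
  refine HasMFDerivAt.mfderiv (I := I) (I' := I) ⟨hf, ?_⟩
  refine (hasFDerivWithinAt_id _ _).congr_of_eventuallyEq ?_ ?_
  · filter_upwards [extChartAt_target_mem_nhdsWithin (I := I) x] with y hy
    simp only [writtenInExtChartAt, Function.comp_apply, h, id]
    exact (extChartAt I x).right_inv hy
  · simp only [writtenInExtChartAt, Function.comp_apply, h, id]
    exact (extChartAt I x).right_inv (mem_extChartAt_target x)

theorem derivAt_inl (x : M) :
    derivAt I I (Sum.inl : M → M ⊕ M') x = ContinuousLinearMap.id ℝ E :=
  derivAt_eq_id_of_extChartAt continuous_inl.continuousAt (extChartAt_inl_apply x)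

theorem derivAt_inr (x : M') :
    derivAt I I (Sum.inr : M' → M ⊕ M') x = ContinuousLinearMap.id ℝ E :=
  derivAt_eq_id_of_extChartAt continuous_inr.continuousAt (extChartAt_inr_apply x)

end Sum

namespace ClosedManifold

variable {n : ℕ}

/-- `o` is a locally constant orientation of the manifold `S`. -/
def IsLocallyConst (S : ClosedManifold n) (o : S → Orientation ℝ S.E (Fin n)) : Prop :=
  ∀ x₀, ∃ a₀ : Orientation ℝ S.E (Fin n), ∀ᶠ x in 𝓝 x₀,
    Carries (derivAt S.I 𝓘(ℝ, S.E) (extChartAt S.I x₀) x) (o x) a₀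

/-- The manifold `S` with another orientation. -/
def reorient (S : ClosedManifold n) (o : S → Orientation ℝ S.E (Fin n))
    (ho : S.IsLocallyConst o) : ClosedManifold n where
  toOrientedManifold := { S.toOrientedManifold with
    orient := o
    orient_locally_const := ho }
  compact := S.compact

/-- The disjoint union of two copies of `S`, the second one with the orientation `o`. -/
noncomputable def double (S : ClosedManifold n) (o : S → Orientation ℝ S.E (Fin n))
    (ho : S.IsLocallyConst o) : ClosedManifold n where
  carrier := S ⊕ S
  E := S.E
  H := S.H
  I := S.I
  finrank_eq := S.finrank_eq
  orient := Sum.elim S.orient o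
  orient_locally_const := by
    rintro (x₀ | x₀)
    · obtain ⟨a₀, h⟩ := S.orient_locally_const x₀
      refine ⟨a₀, ?_⟩
      rw [← Topology.IsOpenEmbedding.inl.map_nhds_eq x₀, Filter.eventually_map]
      filter_upwards [h, extChartAt_source_mem_nhds (I := S.I) x₀] with x hx hxs
      -- The inclusion of the summand has identity derivative and matches the charts, so local
      -- constancy passes from the summand to the union.
      refine Carries.of_comp (L := derivAt S.I S.I (Sum.inl : S → S ⊕ S) x) ?_
        (by rw [derivAt_inl]; exact carries_id _)
      have hs : (Sum.inl x : S ⊕ S) ∈ (extChartAt S.I (Sum.inl x₀ : S ⊕ S)).source := by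
        simpa [extChartAt, ChartedSpace.sum_chartAt_inl] using hxs
      rw [← derivAt_comp (mdifferentiableAt_extChartAt (by simpa using hs))
        ((ContMDiff.inl (n := 1)).mdifferentiableAt (by simp))]
      have : (extChartAt S.I (Sum.inl x₀ : S ⊕ S)) ∘ Sum.inl = extChartAt S.I x₀ :=
        funext fun y => extChartAt_inl_apply x₀ y
      rw [this]
      exact hx
    · obtain ⟨a₀, h⟩ := ho x₀
      refine ⟨a₀, ?_⟩
      rw [← Topology.IsOpenEmbedding.inr.map_nhds_eq x₀, Filter.eventually_map]
      filter_upwards [h, extChartAt_source_mem_nhds (I := S.I) x₀] with x hx hxs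
      refine Carries.of_comp (L := derivAt S.I S.I (Sum.inr : S → S ⊕ S) x) ?_
        (by rw [derivAt_inr]; exact carries_id _)
      have hs : (Sum.inr x : S ⊕ S) ∈ (extChartAt S.I (Sum.inr x₀ : S ⊕ S)).source := by
        simpa [extChartAt, ChartedSpace.sum_chartAt_inr] using hxs
      rw [← derivAt_comp (mdifferentiableAt_extChartAt (by simpa using hs))
        ((ContMDiff.inr (n := 1)).mdifferentiableAt (by simp))]
      have : (extChartAt S.I (Sum.inr x₀ : S ⊕ S)) ∘ Sum.inr = extChartAt S.I x₀ :=
        funext fun y => extChartAt_inr_apply x₀ y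
      rw [this]
      exact hx
  compact := inferInstanceAs (CompactSpace (S ⊕ S))

variable (S : ClosedManifold n) (o : S → Orientation ℝ S.E (Fin n)) (ho : S.IsLocallyConst o)

theorem isOrientedEmbOn_inl : IsOrientedEmbOn S.toOrientedManifold (S.double o ho)
    (Sum.inl : S → S ⊕ S) Set.univ where
  isOpen := isOpen_univ
  injOn := Sum.inl_injective.injOn
  contMDiffOn := ContMDiff.inl.contMDiffOn
  carries := fun x _ => by
    change Carries (derivAt S.I S.I (Sum.inl : S → S ⊕ S) x) (S.orient x) (S.orient x)
    rw [derivAt_inl]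
    exact carries_id _

/-- The orientation of the second copy is a parameter so that one construction gives both `torus ⊔
torus`, needed for fusion, and `torus ⊔ -torus`, needed for evaluation; reorienting `torus` by the
orientation of `torus` or `torus.neg` returns these surfaces definitionally. -/
theorem isOrientedEmbOn_inr : IsOrientedEmbOn (S.reorient o ho).toOrientedManifold (S.double o ho)
    (Sum.inr : S → S ⊕ S) Set.univ where
  isOpen := isOpen_univ
  injOn := Sum.inr_injective.injOn
  contMDiffOn := (ContMDiff.inr (I := S.I) (M := S) (M' := S)).contMDiffOn
  carries := fun (x : S) _ => by
    change Carries (derivAt S.I S.I (Sum.inr : S → S ⊕ S) x) (o x) (o x)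
    rw [derivAt_inr]
    exact carries_id _

/-- `S.double o ho` as a disjoint union. -/
def disjUnionDouble : DisjUnion S (S.reorient o ho) (S.double o ho) where
  i₁ := (Sum.inl : S → S ⊕ S)
  i₂ := (Sum.inr : S → S ⊕ S)
  emb₁ := S.isOrientedEmbOn_inl o ho
  emb₂ := S.isOrientedEmbOn_inr o ho
  isCompl := Set.isCompl_range_inl_range_inr

end ClosedManifold

theorem HasCollar.continuous {S : OrientedManifold 2} {N : OrientedManifold 3} {X : Set N}
    {f : S → N} {P : ℝ → Prop} (h : HasCollar P S N X f) : Continuous f := by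
  obtain ⟨ε, hε, c, hc, hc0, -⟩ := h
  refine continuous_iff_continuousAt.2 fun x => ?_
  have : ContinuousAt c (x, 0) := hc.contMDiffOn.continuousOn.continuousAt
    ((isOpen_abs_snd_lt ε).mem_nhds (show |((x, 0) : S × ℝ).2| < ε by simpa using hε))
  have h2 := this.comp (f := fun y : S => (y, (0 : ℝ)))
    (by fun_prop : ContinuousAt (fun y : S => (y, (0 : ℝ))) x)
  simpa [Function.comp_def, hc0] using h2

section CollarSum

variable (S : ClosedManifold 2) (o : S → Orientation ℝ S.E (Fin 2)) (ho : S.IsLocallyConst o)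
  {N : OrientedManifold 3} {X : Set N} {f₁ f₂ : S → N} {P : ℝ → Prop}

/-- Disjoint compact surfaces have disjoint neighbourhoods. Collars shrunk into them cannot meet, so
together they form one injective collar. -/
theorem HasCollar.sum (h₁ : HasCollar P S.toOrientedManifold N X f₁)
    (h₂ : HasCollar P (S.reorient o ho).toOrientedManifold N X f₂)
    (hd : Disjoint (Set.range f₁) (Set.range f₂)) :
    HasCollar P (S.double o ho).toOrientedManifold N X (Sum.elim f₁ f₂ : S ⊕ S → N) := by
  obtain ⟨O₁, O₂, hO₁, hO₂, hf₁, hf₂, hO⟩ := SeparatedNhds.of_isCompact_isCompact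
    (isCompact_range h₁.continuous) (isCompact_range (X := S) h₂.continuous) hd
  obtain ⟨ε₁, hε₁, c₁, hc₁, hc₁0, hc₁X, hc₁O⟩ := h₁.exists_shrink hO₁ fun x => hf₁ ⟨x, rfl⟩
  obtain ⟨ε₂, hε₂, c₂, hc₂, hc₂0, hc₂X, hc₂O⟩ := HasCollar.exists_shrink
    (S := (S.reorient o ho).toOrientedManifold) h₂ hO₂ fun x => hf₂ ⟨x, rfl⟩
  have m₁ : ∀ (x : S) (t : ℝ), |t| < min ε₁ ε₂ → (x, t) ∈ {p : S × ℝ | |p.2| < ε₁} :=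
    fun x t ht => (lt_min_iff.1 ht).1
  have m₂ : ∀ (x : S) (t : ℝ), |t| < min ε₁ ε₂ → (x, t) ∈ {p : S × ℝ | |p.2| < ε₂} :=
    fun x t ht => (lt_min_iff.1 ht).2
  let c : (S ⊕ S) × ℝ → N := fun p => Sum.elim (fun x => c₁ (x, p.2)) (fun x => c₂ (x, p.2)) p.1
  have hop : IsOpen {p : (S ⊕ S) × ℝ | |p.2| < min ε₁ ε₂} := isOpen_abs_snd_lt _
  -- The folding map of the two copies: near each summand the combined collar is the corresponding
  -- single collar composed with it, which gives smoothness.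
  have hρ : ContMDiff (S.I.prod 𝓘(ℝ, ℝ)) (S.I.prod 𝓘(ℝ, ℝ)) ∞
      (Prod.map (Sum.elim id id : S ⊕ S → S) (id : ℝ → ℝ)) :=
    (contMDiff_id.sumElim contMDiff_id).prodMap contMDiff_id
  have hs : ∀ p : (S ⊕ S) × ℝ, |p.2| < min ε₁ ε₂ →
      ContMDiffAt (S.I.prod 𝓘(ℝ, ℝ)) N.I ∞ c p := by
    rintro ⟨x | x, t⟩ ht
    · have h1 : ContMDiffAt (S.I.prod 𝓘(ℝ, ℝ)) N.I ∞ c₁ (x, t) := hc₁.contMDiffOn.contMDiffAt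
        (hc₁.isOpen.mem_nhds (m₁ x t ht))
      refine (h1.comp ((Sum.inl x, t) : (S ⊕ S) × ℝ) (hρ _)).congr_of_eventuallyEq ?_
      filter_upwards [(isOpen_range_inl.preimage continuous_fst).mem_nhds
        (show ((Sum.inl x, t) : (S ⊕ S) × ℝ).1 ∈ Set.range Sum.inl from ⟨x, rfl⟩)]
      rintro ⟨_, s⟩ ⟨y, rfl⟩
      rfl
    · have h1 : ContMDiffAt (M := S × ℝ) (S.I.prod 𝓘(ℝ, ℝ)) N.I ∞ c₂ (x, t) :=
        hc₂.contMDiffOn.contMDiffAt (hc₂.isOpen.mem_nhds (m₂ x t ht))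
      refine (h1.comp ((Sum.inr x, t) : (S ⊕ S) × ℝ) (hρ _)).congr_of_eventuallyEq ?_
      filter_upwards [(isOpen_range_inr.preimage continuous_fst).mem_nhds
        (show ((Sum.inr x, t) : (S ⊕ S) × ℝ).1 ∈ Set.range Sum.inr from ⟨x, rfl⟩)]
      rintro ⟨_, s⟩ ⟨y, rfl⟩
      rfl
  have hne : ∀ x y s t, |s| < ε₁ → |t| < ε₂ → c₁ (x, s) ≠ c₂ (y, t) := fun x y s t hs ht h =>
    Set.disjoint_left.1 hO (hc₁O x s hs) (h ▸ hc₂O y t ht)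
  refine ⟨min ε₁ ε₂, lt_min hε₁ hε₂, c, ⟨hop, ?_, fun p hp => (hs p hp).contMDiffWithinAt, ?_⟩,
    ?_, ?_⟩
  · rintro ⟨x | x, s⟩ hs ⟨y | y, t⟩ ht hxy
    · have := hc₁.injOn (m₁ x s hs) (m₁ y t ht) hxy
      obtain ⟨rfl, rfl⟩ := Prod.ext_iff.1 this
      rfl
    · exact absurd hxy (hne _ _ _ _ (lt_min_iff.1 hs).1 (lt_min_iff.1 ht).2)
    · exact absurd hxy.symm (hne _ _ _ _ (lt_min_iff.1 ht).1 (lt_min_iff.1 hs).2)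
    · have := hc₂.injOn (m₂ x s hs) (m₂ y t ht) hxy
      obtain ⟨rfl, rfl⟩ := Prod.ext_iff.1 this
      rfl
  · rintro ⟨x | x, t⟩ ht
    · have e := (S.isOrientedEmbOn_inl o ho).prodMap (isOrientedEmbOn_id line)
      refine Carries.of_comp ?_ (e.carries (x, t) ⟨trivial, trivial⟩)
      have hd := derivAt_comp (I := S.I.prod 𝓘(ℝ, ℝ)) (I' := S.I.prod 𝓘(ℝ, ℝ)) (I'' := N.I)
        (x := (x, t)) (g := c) (f := Prod.map (Sum.inl : S → S ⊕ S) (id : ℝ → ℝ))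
        ((hs (Sum.inl x, t) ht).mdifferentiableAt (by simp)) (e.mdifferentiableAt ⟨trivial, trivial⟩)
      have := hc₁.carries (x, t) (m₁ x t ht)
      exact hd ▸ this
    · have e := (S.isOrientedEmbOn_inr o ho).prodMap (isOrientedEmbOn_id line)
      refine Carries.of_comp ?_ (e.carries (x, t) ⟨trivial, trivial⟩)
      have hd := derivAt_comp (I := S.I.prod 𝓘(ℝ, ℝ)) (I' := S.I.prod 𝓘(ℝ, ℝ)) (I'' := N.I)
        (x := (x, t)) (g := c) (f := Prod.map (Sum.inr : S → S ⊕ S) (id : ℝ → ℝ))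
        ((hs (Sum.inr x, t) ht).mdifferentiableAt (by simp)) (e.mdifferentiableAt ⟨trivial, trivial⟩)
      have := hc₂.carries (x, t) (m₂ x t ht)
      exact hd ▸ this
  · rintro (x | x)
    · exact hc₁0 x
    · exact hc₂0 x
  · rintro (x | x) t ht
    · exact hc₁X x t (lt_min_iff.1 ht).1
    · exact hc₂X x t (lt_min_iff.1 ht).2

end CollarSum

/-! ### Explicit oriented embeddings: polar coordinates, similarities, torus diffeomorphisms -/

/-- Polar coordinates near the boundary of the solid torus. -/
noncomputable def polar (p : (Circle × Circle) × ℝ) : ℂ × Circle :=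
  (((1 + p.2 : ℝ) : ℂ) * p.1.1, p.1.2)

theorem norm_polar_fst {p : (Circle × Circle) × ℝ} (hp : |p.2| < 1) : ‖(polar p).1‖ = 1 + p.2 := by
  rw [polar, norm_mul, Circle.norm_coe, mul_one, Complex.norm_real, Real.norm_eq_abs, abs_of_pos]
  linarith [(abs_lt.1 hp).1]

theorem contMDiff_polar : ContMDiff (((𝓡 1).prod (𝓡 1)).prod 𝓘(ℝ, ℝ)) (𝓘(ℝ, ℂ).prod (𝓡 1)) ∞
    polar := by
  have := finrank_real_complex_fact'
  have hcoe : ContMDiff (𝓡 1) 𝓘(ℝ, ℂ) ∞ (fun w : Circle => (w : ℂ)) :=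
    contMDiff_coe_sphere (E := ℂ)
  have h1 : ContDiff ℝ ∞ fun y : ℝ × ℂ => ((1 + y.1 : ℝ) : ℂ) * y.2 := by
    have : ContDiff ℝ ∞ fun y : ℝ × ℂ => Complex.ofRealCLM (1 + y.1) :=
      Complex.ofRealCLM.contDiff.comp (by fun_prop)
    exact this.mul contDiff_snd
  have h2 : ContMDiff (((𝓡 1).prod (𝓡 1)).prod 𝓘(ℝ, ℝ)) 𝓘(ℝ, ℝ × ℂ) ∞
      fun p : (Circle × Circle) × ℝ => (p.2, (p.1.1 : ℂ)) :=
    contMDiff_snd.prodMk_space (hcoe.comp (contMDiff_fst.comp contMDiff_fst))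
  exact (h1.contMDiff.comp h2).prodMk (contMDiff_snd.comp contMDiff_fst)

/-- The standard basis of `(ℝ × ℝ) × ℝ`. -/
noncomputable def basisRRR : Basis (Fin 3) ℝ ((ℝ × ℝ) × ℝ) :=
  ((((Basis.singleton (Fin 1) ℝ).prod (Basis.singleton (Fin 1) ℝ)).reindex
    finSumFinEquiv).prod (Basis.singleton (Fin 1) ℝ)).reindex finSumFinEquiv

/-- Pulls the orientation back along the covering by `ℝ³`, where preserving orientations becomes the
sign of a determinant. -/
theorem carries_expExp (x : (ℝ × ℝ) × ℝ) :
    Carries (derivAt ((𝓘(ℝ, ℝ).prod 𝓘(ℝ, ℝ)).prod 𝓘(ℝ, ℝ)) (((𝓡 1).prod (𝓡 1)).prod 𝓘(ℝ, ℝ))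
      (Prod.map (Prod.map Circle.exp Circle.exp) id) x) basisRRR.orientation
      ((torus.prod line).orient ((Circle.exp x.1.1, Circle.exp x.1.2), x.2)) := by
  rw [derivAt_prodMap ((mdifferentiable_circleExp _).prodMap (mdifferentiable_circleExp _))
    mdifferentiableAt_id, derivAt_id, basisRRR, ← prodOrientation_eq (by simp) (by simp)]
  refine Carries.prodMap (by simp) (by simp) torus.finrank_eq line.finrank_eq ?_ (carries_id _)
  rw [← prodOrientation_eq (by simp) (by simp)]
  exact carries_expMap x.1

theorem basisCR_repr (x : ℂ × ℝ) : basisCR.repr x = ![x.1.re, x.1.im, x.2] := by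
  funext i
  obtain ⟨i, rfl⟩ := (finSumFinEquiv (m := 2) (n := 1)).surjective i
  rw [basisCR, Basis.repr_reindex_apply, Equiv.symm_apply_apply]
  rcases i with i | i
  · fin_cases i <;> simp <;> rfl
  · fin_cases i; simp; rfl

theorem basisRRR_apply : (basisRRR : Fin 3 → (ℝ × ℝ) × ℝ) =
    ![((1, 0), 0), ((0, 1), 0), ((0, 0), 1)] := by
  funext i
  obtain ⟨i, rfl⟩ := (finSumFinEquiv (m := 2) (n := 1)).surjective i
  rw [basisRRR, Basis.reindex_apply, Equiv.symm_apply_apply]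
  rcases i with i | i
  · obtain ⟨i, rfl⟩ := (finSumFinEquiv (m := 1) (n := 1)).surjective i
    rcases i with i | i <;> fin_cases i <;> simp <;> rfl
  · fin_cases i; simp; rfl

/-- For the ordered coordinates (angle of `z`, angle of `w`, `t`) the Jacobian determinant is `1 +
t`, positive for `|t| < 1`. Here the outward direction comes last. -/
theorem exists_carries_polar (x : (ℝ × ℝ) × ℝ) (hx : |x.2| < 1) : ∃ L : (ℝ × ℝ) × ℝ →L[ℝ] ℂ × ℝ,
    HasFDerivAt (fun x : (ℝ × ℝ) × ℝ =>
      (((1 + x.2 : ℝ) : ℂ) * Complex.exp (x.1.1 * Complex.I), x.1.2)) L x ∧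
    Carries L basisRRR.orientation basisCR.orientation := by
  have h1 : HasFDerivAt (fun x : (ℝ × ℝ) × ℝ => Complex.exp (x.1.1 * Complex.I))
      (((1 : ℝ →L[ℝ] ℝ).smulRight (Complex.exp (x.1.1 * Complex.I) * Complex.I)).comp
        ((ContinuousLinearMap.fst ℝ ℝ ℝ).comp (ContinuousLinearMap.fst ℝ (ℝ × ℝ) ℝ))) x := by
    have h3 : HasDerivAt (fun t : ℝ => Complex.exp (t * Complex.I))
        (Complex.exp (x.1.1 * Complex.I) * Complex.I) x.1.1 := by
      have := ((hasDerivAt_id (x.1.1 : ℂ)).mul_const Complex.I).cexp.comp_ofReal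
      simpa using this
    exact HasFDerivAt.comp (𝕜 := ℝ) (f := fun x : (ℝ × ℝ) × ℝ => x.1.1) x h3.hasFDerivAt
      (hasFDerivAt_fst.comp x hasFDerivAt_fst)
  have h2 : HasFDerivAt (fun x : (ℝ × ℝ) × ℝ => ((1 + x.2 : ℝ) : ℂ))
      (Complex.ofRealCLM.comp (ContinuousLinearMap.snd ℝ (ℝ × ℝ) ℝ)) x :=
    Complex.ofRealCLM.hasFDerivAt.comp x (hasFDerivAt_snd.const_add 1)
  have h3 : HasFDerivAt (fun x : (ℝ × ℝ) × ℝ => x.1.2)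
      ((ContinuousLinearMap.snd ℝ ℝ ℝ).comp (ContinuousLinearMap.fst ℝ (ℝ × ℝ) ℝ)) x :=
    hasFDerivAt_snd.comp x hasFDerivAt_fst
  refine ⟨_, (h2.fun_mul h1).prodMk h3, ?_⟩
  refine carries_of_form_pos (by simp) _ _ basisCR.det basisCR.det_ne_zero ?_
  rw [Basis.det_apply, Matrix.det_fin_three]
  simp only [Basis.toMatrix_apply, basisCR_repr, basisRRR_apply]
  simp [Complex.exp_re, Complex.exp_im]
  nlinarith [Real.sin_sq_add_cos_sq x.1.1, (abs_lt.1 hx).1]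

theorem isOrientedEmbOn_polar : IsOrientedEmbOn (torus.prod line) (plane.prod circle) polar
    {p : (Circle × Circle) × ℝ | |p.2| < 1} where
  isOpen := isOpen_abs_snd_lt (Y := Circle × Circle) 1
  injOn := by
    intro (p : (Circle × Circle) × ℝ) (hp : |p.2| < 1) (q : (Circle × Circle) × ℝ) (hq : |q.2| < 1) h
    have h1 := norm_polar_fst hp
    rw [h, norm_polar_fst hq] at h1
    have h2 : q.2 = p.2 := by linarith
    have h3 := congrArg Prod.fst h
    have h4 := congrArg Prod.snd h
    simp only [polar, h2] at h3 h4
    have h5 : ((1 + p.2 : ℝ) : ℂ) ≠ 0 := by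
      have : (0 : ℝ) < 1 + p.2 := by linarith [(abs_lt.1 hp).1]
      exact_mod_cast this.ne'
    exact Prod.ext (Prod.ext (Circle.ext (mul_left_cancel₀ h5 h3)) h4) h2.symm
  contMDiffOn := contMDiff_polar.contMDiffOn
  carries := by
    suffices h : ∀ x : (ℝ × ℝ) × ℝ, |x.2| < 1 → Carries
        (derivAt (((𝓡 1).prod (𝓡 1)).prod 𝓘(ℝ, ℝ)) (𝓘(ℝ, ℂ).prod (𝓡 1)) polar
          ((Circle.exp x.1.1, Circle.exp x.1.2), x.2))
        ((torus.prod line).orient ((Circle.exp x.1.1, Circle.exp x.1.2), x.2))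
        ((plane.prod circle).orient (polar ((Circle.exp x.1.1, Circle.exp x.1.2), x.2))) by
      intro (p : (Circle × Circle) × ℝ) hp
      have := h ((Complex.arg (p.1.1 : ℂ), Complex.arg (p.1.2 : ℂ)), p.2) hp
      simp only [Circle.exp_arg] at this
      exact this
    intro x hx
    refine Carries.of_comp ?_ (carries_expExp x)
    have hp : MDifferentiable (((𝓡 1).prod (𝓡 1)).prod 𝓘(ℝ, ℝ)) (𝓘(ℝ, ℂ).prod (𝓡 1)) polar :=
      contMDiff_polar.mdifferentiable (by simp)
    have he : MDifferentiableAt ((𝓘(ℝ, ℝ).prod 𝓘(ℝ, ℝ)).prod 𝓘(ℝ, ℝ))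
        (((𝓡 1).prod (𝓡 1)).prod 𝓘(ℝ, ℝ)) (Prod.map (Prod.map Circle.exp Circle.exp) id) x :=
      ((mdifferentiable_circleExp _).prodMap (mdifferentiable_circleExp _)).prodMap
        mdifferentiableAt_id
    let K : (ℝ × ℝ) × ℝ → ℂ × ℝ := fun x =>
      (((1 + x.2 : ℝ) : ℂ) * Complex.exp (x.1.1 * Complex.I), x.1.2)
    obtain ⟨L, hL, hLc⟩ := exists_carries_polar x hx
    have hK : HasMFDerivAt ((𝓘(ℝ, ℝ).prod 𝓘(ℝ, ℝ)).prod 𝓘(ℝ, ℝ)) (𝓘(ℝ, ℂ).prod 𝓘(ℝ, ℝ))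
        K x L := by
      rw [← modelWithCornersSelf_prod, ← modelWithCornersSelf_prod, ← modelWithCornersSelf_prod,
        chartedSpaceSelf_prod, chartedSpaceSelf_prod]
      exact hL.hasMFDerivAt
    have hKe : derivAt ((𝓘(ℝ, ℝ).prod 𝓘(ℝ, ℝ)).prod 𝓘(ℝ, ℝ)) (𝓘(ℝ, ℂ).prod 𝓘(ℝ, ℝ)) K x = L :=
      hK.mfderiv
    have e1 := derivAt_comp (hp (Prod.map (Prod.map Circle.exp Circle.exp) id x)) he
    -- `K` lifts `polar` to the coverings of source and target by vector spaces; both covering maps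
    -- preserve orientations, so the sign of the Jacobian of `K` decides.
    have hc : polar ∘ Prod.map (Prod.map Circle.exp Circle.exp) id =
        Prod.map id Circle.exp ∘ K := by
      funext y
      simp [polar, K]
    have hed : MDifferentiableAt (𝓘(ℝ, ℂ).prod 𝓘(ℝ, ℝ)) (𝓘(ℝ, ℂ).prod (𝓡 1))
      (Prod.map id Circle.exp) (K x) := mdifferentiableAt_id.prodMap (mdifferentiable_circleExp _)
    have e2 := derivAt_comp hed hK.mdifferentiableAt
    rw [← hc, e1, hKe] at e2
    have h3 := (carries_planeExp (K x)).comp hLc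
    rw [← e2] at h3
    have h5 : polar ((Circle.exp x.1.1, Circle.exp x.1.2), x.2) = ((K x).1, Circle.exp (K x).2) := by
      simp [polar, K]
    rw [h5]
    exact h3

theorem isOrientedEmbOn_affine (c ρ : ℝ) (hρ : 0 < ρ) :
    IsOrientedEmbOn (plane.prod circle) (plane.prod circle)
      (Prod.map (fun a : ℂ => (c : ℂ) + (ρ : ℂ) * a) (id : Circle → Circle)) Set.univ := by
  have h : IsOrientedEmbOn plane plane (fun a : ℂ => (c : ℂ) + (ρ : ℂ) * a) Set.univ := by
    refine ⟨isOpen_univ, ?_, ?_, ?_⟩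
    · have hi : Function.Injective fun a : ℂ => (c : ℂ) + (ρ : ℂ) * a := fun a b h =>
        mul_left_cancel₀ (by exact_mod_cast hρ.ne') (add_left_cancel h)
      exact hi.injOn
    · have : ContDiff ℝ ∞ (fun a : ℂ => (c : ℂ) + (ρ : ℂ) * a) := by fun_prop
      exact this.contMDiff.contMDiffOn
    · intro (a : ℂ) _
      have hd : HasFDerivAt (fun a : ℂ => (c : ℂ) + (ρ : ℂ) * a)
          ((ρ : ℂ) • ContinuousLinearMap.id ℝ ℂ) a :=
        ((hasFDerivAt_id (𝕜 := ℝ) a).const_mul (ρ : ℂ)).const_add (c : ℂ)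
      have e : derivAt 𝓘(ℝ, ℂ) 𝓘(ℝ, ℂ) (fun a : ℂ => (c : ℂ) + (ρ : ℂ) * a) a =
          (ρ : ℂ) • ContinuousLinearMap.id ℝ ℂ := mfderiv_eq_fderiv.trans hd.fderiv
      change Carries (derivAt 𝓘(ℝ, ℂ) 𝓘(ℝ, ℂ) (fun a : ℂ => (c : ℂ) + (ρ : ℂ) * a) a) _ _
      rw [e]
      refine carries_of_det_pos (V := ℂ) (by simp) _ _ ?_
      rw [← LinearMap.det_toMatrix Complex.basisOneI, Matrix.det_fin_two]
      simp [LinearMap.toMatrix_apply]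
      positivity
  exact (h.prodMap (isOrientedEmbOn_id circle)).mono isOpen_univ
    fun _ _ => ⟨trivial, trivial⟩

theorem isOrientedEmbOn_meridianPoint : IsOrientedEmbOn (plane.prod circle) sphere3
    (fun x : ℂ × Circle => meridianPoint x.1 x.2) Set.univ := by
  have : (fun x : ℂ × Circle => meridianPoint x.1 x.2) = meridianFraming 0 1 0 := by
    funext x
    simp [meridianFraming]
  rw [this]
  exact emb_meridianFraming 0 1 one_pos 0

/-- The diffeomorphism `Tᵖ(z, w) = (zwᵖ, w)` of the torus. -/
noncomputable def torusTPow (p : ℤ) : SurfaceDiffeo torus torus where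
  toFun := fun x : Circle × Circle => ((x.1 * x.2 ^ p, x.2) : Circle × Circle)
  invFun := fun x : Circle × Circle => ((x.1 * x.2 ^ (-p), x.2) : Circle × Circle)
  left_inv := fun x : Circle × Circle => by simp; rfl
  right_inv := fun x : Circle × Circle => by simp; rfl
  contMDiff_toFun := ((contMDiff_fst.mul ((contMDiff_circle_zpow p).comp contMDiff_snd)).prodMk
    contMDiff_snd).of_le (n := ω) le_top
  contMDiff_invFun := ((contMDiff_fst.mul ((contMDiff_circle_zpow (-p)).comp contMDiff_snd)).prodMk
    contMDiff_snd).of_le (n := ω) le_top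
  carries := fun x => carries_torus
    ((((contMDiff_fst.mul ((contMDiff_circle_zpow p).comp contMDiff_snd)).prodMk
    contMDiff_snd).of_le (n := ω) le_top : ContMDiff ((𝓡 1).prod (𝓡 1)) ((𝓡 1).prod (𝓡 1)) ∞
      fun x : Circle × Circle => (x.1 * x.2 ^ p, x.2)).mdifferentiable (by simp))
    ((ContinuousLinearMap.fst ℝ ℝ ℝ + (p : ℝ) • ContinuousLinearMap.snd ℝ ℝ ℝ).prod
      (ContinuousLinearMap.snd ℝ ℝ ℝ))
    (fun x => by simp [Circle.exp_add]) x
    (carries_of_det_pos (by simp) _ _ (by rw [det_R2]; simp))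
    (fun x hx => hx ▸ carries_expMap x)

/-- The diffeomorphism `TᵖS` of the torus. -/
noncomputable def torusTPowS (p : ℤ) : SurfaceDiffeo torus torus := torusS.trans (torusTPow p)

/-- The diffeomorphism `U S³ T^q S (z, w) = (z, w̄ z^q)`. -/
noncomputable def torusTwist (q : ℤ) : SurfaceDiffeo torus torus.neg :=
  -- With a single `S` here the result would be `(z̄, w z^(-q))`; the additional `S²` inverts both
  -- coordinates.
  (torusTPowS q).trans (torusS.trans (torusS.trans (torusS.trans torusU)))

theorem torusTwist_apply (q : ℤ) (z w : Circle) :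
    torusTwist q ((z, w) : Circle × Circle) = ((z, w⁻¹ * z ^ q) : Circle × Circle) := by
  change ((z⁻¹⁻¹, ((w⁻¹ * z ^ q)⁻¹)⁻¹) : Circle × Circle) = _
  simp

/-! ### Domains bounded by a surface and their vectors -/

section

variable {N : OrientedManifold 3} {P : ℝ → Prop}

/-- The collar can be checked in the model `ℂ × S¹`: where `G` is injective, lying in `G '' K` means
lying in `K`. Shrinking keeps the collar in that neighbourhood. -/
theorem hasCollar_image {G : ℂ × Circle → N} {K : Set (ℂ × Circle)}
    (hG : IsOrientedEmbNear (plane.prod circle) N G K) {κ : (Circle × Circle) × ℝ → ℂ × Circle}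
    {ε : ℝ} (hε : 0 < ε)
    (hκ : IsOrientedEmbOn (torus.prod line) (plane.prod circle) κ
      {p : (Circle × Circle) × ℝ | |p.2| < ε})
    (hK : ∀ x t, |t| < ε → (κ (x, t) ∈ K ↔ P t)) (hP : P 0) :
    HasCollar P torus.toOrientedManifold N (G '' K) (fun x : Circle × Circle => G (κ (x, 0))) := by
  obtain ⟨U, hU, hG⟩ := hG
  have h0 : |(0 : ℝ)| < ε := by simpa using hε
  have hK0 : ∀ x, κ (x, 0) ∈ K := fun x => (hK x 0 h0).2 hP
  obtain ⟨δ, hδ, hc, hcU⟩ := (hG.comp hκ).exists_shrink (S := torus.toOrientedManifold)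
    (fun x => ⟨h0, hU (hK0 x)⟩) isOpen_univ (fun _ => trivial)
  refine ⟨δ, hδ, _, hc, fun x => rfl, fun x t ht => ?_⟩
  obtain ⟨⟨h1, h2⟩, -⟩ := hcU x t ht
  rw [← hK x t h1]
  exact ⟨fun ⟨y, hy, hxy⟩ => hG.injOn (hU hy) h2 hxy ▸ hy, fun h => ⟨_, h, rfl⟩⟩

theorem isCompact_solidTorus : IsCompact solidTorus := by
  have : solidTorus = Metric.closedBall 0 1 ×ˢ Set.univ := by
    ext; simp [solidTorus]
  rw [this]
  exact (isCompact_closedBall _ _).prod isCompact_univ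

theorem openSolidTorus_subset : openSolidTorus ⊆ solidTorus :=
  fun x (hx : ‖x.1‖ < 1) => (hx.le : ‖x.1‖ ≤ 1)

/-- The restriction of a map of the solid torus to the boundary. -/
def bdry {Y : Type} (G : ℂ × Circle → Y) (x : Circle × Circle) : Y := G ((x.1 : ℂ), x.2)

/-- The collar is the image of polar coordinates: the radius is `1 + t`, so the solid torus is the
part `t ≤ 0`. -/
theorem isOutgoing_solidTorus {G : ℂ × Circle → N}
    (hG : IsOrientedEmbNear (plane.prod circle) N G solidTorus) :
    IsOutgoing torus N (G '' solidTorus) (bdry G) := by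
  have := hasCollar_image (P := (· ≤ 0)) hG one_pos isOrientedEmbOn_polar (fun x t ht => by
    rw [solidTorus, Set.mem_ofPred_eq, norm_polar_fst ht]
    simp) le_rfl
  have h : bdry G = fun x => G (polar (x, 0)) := funext fun x => by simp [bdry, polar]
  rw [h]
  exact this

end

/-- The compact domain `X` of `N` is bounded by the surface `S`, parametrized by `f`. -/
structure IsCap (S : ClosedManifold 2) (N : OrientedManifold 3) (X : Set N) (f : S → N) :
    Prop where
  isCompact : IsCompact X
  outgoing : IsOutgoing S N X f
  isOpen : IsOpen (X \ Set.range f)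

theorem IsOutgoing.mem {S : OrientedManifold 2} {N : OrientedManifold 3} {X : Set N} {f : S → N}
    (h : IsOutgoing S N X f) (x : S) : f x ∈ X := by
  obtain ⟨ε, hε, c, -, hc0, hc⟩ := h
  rw [← hc0, hc x 0 (by simpa using hε)]

namespace IsCap

variable {S S' : ClosedManifold 2} {N : OrientedManifold 3} {X X' : Set N} {f : S → N}
  {f' : S' → N}

/-- A domain bounded by `S`, as a cobordism from the empty surface to `S`. -/
noncomputable def toCobordism (h : IsCap S N X f) : Cobordism emptySurface S :=
  Cobordism.ofIsOpen N X (fun x => Empty.elim x) f h.isCompact (hasCollar_empty _ _ _) h.outgoing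
    (by rw [range_emptySurface]; exact Set.empty_disjoint _)
    (by rw [range_emptySurface, Set.empty_union]; exact h.isOpen)

theorem of_cobordism (W : Cobordism emptySurface S) : IsCap S W.N W.X W.out where
  isCompact := W.isCompact
  outgoing := W.outgoing
  isOpen := by
    have := W.isOpen_diff
    rwa [range_emptySurface, Set.empty_union] at this

/-- The vector in `Z(S)` of a domain bounded by `S`. -/
noncomputable def vector (h : IsCap S N X f) (Z : TQFT) : Z.V S :=
  Z.cob h.toCobordism (Z.ofEmpty 1)

theorem reparam (h : IsCap S N X f) (φ : SurfaceDiffeo S' S) : IsCap S' N X (f ∘ φ) where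
  isCompact := h.isCompact
  outgoing := HasCollar.reparam h.outgoing φ
  isOpen := by
    have : Set.range (f ∘ φ) = Set.range f := φ.toEquiv.surjective.range_comp f
    rw [this]
    exact h.isOpen

/-- Naturality for the identity of the domain, regarded as a diffeomorphism of cobordisms that
changes only the boundary parametrization. -/
theorem vector_eq_map (Z : TQFT) (h : IsCap S N X f) (h' : IsCap S' N X f')
    (φ : SurfaceDiffeo S S') (hφ : ∀ x, f x = f' (φ x)) : h'.vector Z = Z.map φ (h.vector Z) := by
  have := Z.cob_natural h.toCobordism h'.toCobordism (OrientedDiffeo.refl _) φ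
    ⟨id, isOrientedEmbNear_id _ _, Set.image_id _, fun x => Empty.elim x, hφ⟩ (Z.ofEmpty 1)
  rw [Z.map_refl] at this
  exact this.symm

theorem vector_solidTorus (Z : TQFT) {m : ℕ} {v : Basis (Fin (m + 1)) ℂ (Z.V torus)}
    {A : Matrix (Fin (m + 1)) (Fin (m + 1)) ℂ} (hv : Z.IsVerlindeBasis v A)
    {G : ℂ × Circle → N} (hG : IsOrientedEmbNear (plane.prod circle) N G solidTorus)
    (h : IsCap torus N (G '' solidTorus) (bdry G)) : h.vector Z = v 0 :=
  (hv.identity h.toCobordism ⟨G, hG, rfl, fun _ _ => rfl⟩).symm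

end IsCap

/-! ### Decompositions into two caps and a middle cobordism -/

/-- The empty surface as the disjoint union of two empty surfaces. -/
noncomputable def disjUnionEmpty : DisjUnion emptySurface emptySurface emptySurface where
  i₁ := id
  i₂ := id
  emb₁ := isOrientedEmbOn_id _
  emb₂ := isOrientedEmbOn_id _
  isCompl := by
    rw [range_emptySurface]
    have : (∅ : Set emptySurface) = Set.univ := Set.eq_univ_of_forall fun x => Empty.elim x
    exact ⟨Set.disjoint_empty _, codisjoint_iff.2 (by simpa using this)⟩

/-- A decomposition of a cobordism `W` into a domain `Xa` bounded by `fa : S → W`, a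
domain `Xb` bounded by `fb : S → W`, where `S` is oriented by `o`, and the rest `X₂`. -/
structure IsDecomposition {B : ClosedManifold 2} (W : Cobordism emptySurface B)
    (S : ClosedManifold 2) (o : S → Orientation ℝ S.E (Fin 2)) (ho : S.IsLocallyConst o)
    (Xa Xb X₂ : Set W.N) (fa fb : S → W.N) : Prop where
  isCompact_a : IsCompact Xa
  isCompact_b : IsCompact Xb
  isCompact₂ : IsCompact X₂
  outgoing_a : IsOutgoing S W.N Xa fa
  outgoing_b : IsOutgoing (S.reorient o ho).toOrientedManifold W.N Xb fb
  cover : Xa ∪ Xb ∪ X₂ = W.X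
  disjoint : Disjoint Xa Xb
  inter_a : Xa ∩ X₂ = Set.range fa
  inter_b : Xb ∩ X₂ = Set.range fb
  disjoint_out : Disjoint (Xa ∪ Xb) (Set.range W.out)

namespace IsDecomposition

variable {B : ClosedManifold 2} {W : Cobordism emptySurface B}
    {S : ClosedManifold 2} {o : S → Orientation ℝ S.E (Fin 2)} {ho : S.IsLocallyConst o}
    {Xa Xb X₂ : Set W.N} {fa fb : S → W.N}

theorem isOpen_diff_out (W : Cobordism emptySurface B) : IsOpen (W.X \ Set.range W.out) :=
  (IsCap.of_cobordism W).isOpen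

theorem isCap_a (h : IsDecomposition W S o ho Xa Xb X₂ fa fb) : IsCap S W.N Xa fa where
  isCompact := h.isCompact_a
  outgoing := h.outgoing_a
  isOpen := by
    -- The cap without its boundary is what remains of an open set, `W.X` without its boundary,
    -- after removal of the other two compact pieces.
    have e : Xa \ Set.range fa = (W.X \ Set.range W.out) \ (Xb ∪ X₂) := by
      rw [← h.inter_a, ← h.cover]
      have h1 := h.disjoint_out
      have h2 := h.disjoint
      rw [Set.disjoint_left] at h1 h2
      ext y
      have h1 := @h1 y
      have h2 := @h2 y
      simp only [Set.mem_sdiff, Set.mem_union, Set.mem_inter_iff] at h1 ⊢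
      tauto
    rw [e]
    exact (isOpen_diff_out W).sdiff (h.isCompact_b.union h.isCompact₂).isClosed

theorem isCap_b (h : IsDecomposition W S o ho Xa Xb X₂ fa fb) :
    IsCap (S.reorient o ho) W.N Xb fb where
  isCompact := h.isCompact_b
  outgoing := h.outgoing_b
  isOpen := by
    have e : Xb \ Set.range fb = (W.X \ Set.range W.out) \ (Xa ∪ X₂) := by
      rw [← h.inter_b, ← h.cover]
      have h1 := h.disjoint_out
      have h2 := h.disjoint
      rw [Set.disjoint_left] at h1 h2
      ext y
      have h1 := @h1 y
      have h2 := @h2 y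
      simp only [Set.mem_sdiff, Set.mem_union, Set.mem_inter_iff] at h1 ⊢
      tauto
    have := (isOpen_diff_out W).sdiff (h.isCompact_a.union h.isCompact₂).isClosed
    rw [← e] at this
    exact this

theorem disjoint_range (h : IsDecomposition W S o ho Xa Xb X₂ fa fb) :
    Disjoint (Set.range fa) (Set.range fb) := by
  rw [← h.inter_a, ← h.inter_b]
  exact h.disjoint.mono Set.inter_subset_left Set.inter_subset_left

theorem isCap_union (h : IsDecomposition W S o ho Xa Xb X₂ fa fb) :
    IsCap (S.double o ho) W.N (Xa ∪ Xb) (Sum.elim fa fb : S ⊕ S → W.N) where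
  isCompact := h.isCompact_a.union h.isCompact_b
  outgoing := by
    refine HasCollar.sum S o ho ?_ ?_ h.disjoint_range
    -- The caps are disjoint and compact, so near one of them the union looks like that cap alone.
    · refine HasCollar.congr (O := Xbᶜ) h.outgoing_a h.isCompact_b.isClosed.isOpen_compl
        (fun x => Set.disjoint_left.1 h.disjoint (h.outgoing_a.mem x)) fun y hy => ?_
      exact ⟨fun hy' => hy'.resolve_right hy, Or.inl⟩
    · refine HasCollar.congr (S := (S.reorient o ho).toOrientedManifold) (O := Xaᶜ) h.outgoing_b
        h.isCompact_a.isClosed.isOpen_compl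
        (fun x => Set.disjoint_right.1 h.disjoint (h.outgoing_b.mem x)) fun y hy => ?_
      exact ⟨fun hy' => hy'.resolve_left hy, Or.inr⟩
  isOpen := by
    have e : (Xa ∪ Xb) \ Set.range (Sum.elim fa fb) = (Xa \ Set.range fa) ∪ (Xb \ Set.range fb) := by
      rw [Set.Sum.elim_range, ← h.inter_a, ← h.inter_b]
      have h2 := h.disjoint
      rw [Set.disjoint_left] at h2
      ext y
      have h2 := @h2 y
      simp only [Set.mem_sdiff, Set.mem_union, Set.mem_inter_iff]
      tauto
    exact e ▸ h.isCap_a.isOpen.union h.isCap_b.isOpen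

theorem inter_union (h : IsDecomposition W S o ho Xa Xb X₂ fa fb) :
    (Xa ∪ Xb) ∩ X₂ = Set.range (Sum.elim fa fb) := by
  rw [Set.union_inter_distrib_right, h.inter_a, h.inter_b, Set.Sum.elim_range]

/-- The rest of the decomposition, as a cobordism. -/
noncomputable def middle (h : IsDecomposition W S o ho Xa Xb X₂ fa fb) :
    Cobordism (S.double o ho) B :=
  Cobordism.ofIsOpen W.N X₂ (Sum.elim fa fb : S ⊕ S → W.N) W.out h.isCompact₂
    (by
      have hm : ∀ x, (Sum.elim fa fb : S ⊕ S → W.N) x ∈ (Xa ∪ Xb) ∩ X₂ := fun x => by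
        rw [h.inter_union]; exact ⟨x, rfl⟩
      -- The collar of the two caps, seen from the other side, is an incoming collar of the middle
      -- piece.
      refine IsOutgoing.flip (S := (S.double o ho).toOrientedManifold) h.isCap_union.outgoing
        (isOpen_diff_out W) (fun x => ⟨?_, ?_⟩) ?_ ?_ (fun x => (hm x).2)
      · rw [← h.cover]; exact Or.inl (hm x).1
      · exact Set.disjoint_left.1 h.disjoint_out (hm x).1
      · rw [h.cover]; exact Set.sdiff_subset
      · rw [h.inter_union]; exact Set.inter_subset_right)
    -- The outgoing surface avoids the caps, so near it `X₂` and `W.X` agree and the collar of `W`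
    -- can be kept.
    (HasCollar.congr (O := (Xa ∪ Xb)ᶜ) W.outgoing
      (h.isCompact_a.union h.isCompact_b).isClosed.isOpen_compl
      (fun x hx => Set.disjoint_left.1 h.disjoint_out hx ⟨x, rfl⟩)
      (fun y hy => by
        rw [← h.cover]
        exact ⟨Or.inr, fun hy' => hy'.resolve_left hy⟩))
    (by
      have := h.disjoint_out.mono_left (Set.inter_subset_left (t := X₂))
      rw [h.inter_union] at this
      exact this)
    (by
      have e : X₂ \ (Set.range (Sum.elim fa fb) ∪ Set.range W.out) =
          (W.X \ Set.range W.out) \ (Xa ∪ Xb) := by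
        rw [← h.inter_union, ← h.cover]
        ext y
        simp only [Set.mem_sdiff, Set.mem_union, Set.mem_inter_iff]
        tauto
      have := (isOpen_diff_out W).sdiff (h.isCompact_a.union h.isCompact_b).isClosed
      rw [← e] at this
      exact this)

/-- The gluing axiom separates the caps from the middle piece, and the union axiom splits the caps;
under `∅ ⊔ ∅ = ∅` the vector `1 ⊗ 1` is `1`. All pieces lie in `W.N`, so every comparison map is the
identity. -/
theorem cob_eq (Z : TQFT) (h : IsDecomposition W S o ho Xa Xb X₂ fa fb) :
    Z.cob W (Z.ofEmpty 1) = Z.cob h.middle (Z.tensor (S.disjUnionDouble o ho)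
      (h.isCap_a.vector Z ⊗ₜ h.isCap_b.vector Z)) := by
  have hc : id '' (Xa ∪ Xb) ∪ id '' X₂ = W.X := by simpa only [Set.image_id] using h.cover
  have hi : id '' (Xa ∪ Xb) ∩ id '' X₂ = Set.range (Sum.elim fa fb) := by
    simpa only [Set.image_id] using h.inter_union
  have hu : id '' Xa ∪ id '' Xb = Xa ∪ Xb := by simp only [Set.image_id]
  have hd : Disjoint (id '' Xa) (id '' Xb) := by simpa only [Set.image_id] using h.disjoint
  have h1 := Z.cob_gluing h.isCap_union.toCobordism h.middle W
    ⟨id, id, isOrientedEmbNear_id _ _, isOrientedEmbNear_id _ _, hc, hi, fun _ => rfl,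
      fun x => Empty.elim x, fun _ => rfl⟩ (Z.ofEmpty 1)
  have h2 := Z.cob_union h.isCap_a.toCobordism h.isCap_b.toCobordism h.isCap_union.toCobordism
    disjUnionEmpty (S.disjUnionDouble o ho)
    ⟨id, id, isOrientedEmbNear_id _ _, isOrientedEmbNear_id _ _, hu, hd, fun x => Empty.elim x,
      fun x => Empty.elim x, fun _ => rfl, fun _ => rfl⟩ (Z.ofEmpty 1) (Z.ofEmpty 1)
  have h3 := Z.tensor_unit disjUnionEmpty isEmpty_emptySurface
    (OrientedDiffeo.refl _) (fun x => Empty.elim x) (Z.ofEmpty 1) 1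
  rw [Z.map_refl, one_smul] at h3
  rw [h1]
  refine congrArg _ ?_
  have h4 : Z.tensor disjUnionEmpty (Z.ofEmpty 1 ⊗ₜ Z.ofEmpty 1) = Z.ofEmpty 1 := h3
  rw [h4] at h2
  exact h2

end IsDecomposition

/-! ### The self-similar sequence of holes in the unit disk -/

section PlaneGeometry

/-- The embedding of `ℂ × S¹` onto itself that maps the unit disk to the disk of radius `ρ` around
`c`. -/
noncomputable def rescale (c ρ : ℝ) (x : ℂ × Circle) : ℂ × Circle := ((c : ℂ) + (ρ : ℂ) * x.1, x.2)

theorem isOrientedEmbOn_rescale (c ρ : ℝ) (hρ : 0 < ρ) :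
    IsOrientedEmbOn (plane.prod circle) (plane.prod circle) (rescale c ρ) Set.univ :=
  isOrientedEmbOn_affine c ρ hρ

/-- `Y × S¹`, where `Y` is the unit disk without the first `r` open disks of the sequence. -/
def holed (r : ℕ) : Set (ℂ × Circle) :=
  {x | ‖x.1‖ ≤ 1 ∧ ∀ k < r, radius k ≤ ‖x.1 - centre k‖}

theorem holed_zero : holed 0 = solidTorus := by
  ext; simp [holed, solidTorus]

theorem centre_zero : centre 0 = -1 / 2 := by unfold centre; norm_num

theorem radius_zero : radius 0 = 1 / 4 := by unfold radius; norm_num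

/-- Together with `radius_succ`: the similarity `a ↦ 1/2 + a/4` maps the `k`-th hole to the next
one. This drives the induction on the number of holes. -/
theorem centre_succ (k : ℕ) : centre (k + 1) = 1 / 2 + 1 / 4 * centre k := by
  unfold centre; ring

theorem radius_succ (k : ℕ) : radius (k + 1) = 1 / 4 * radius k := by
  unfold radius; ring

theorem isCompact_holed (r : ℕ) : IsCompact (holed r) := by
  refine isCompact_solidTorus.of_isClosed_subset ?_ fun x hx => hx.1
  have : holed r = {x : ℂ × Circle | ‖x.1‖ ≤ 1} ∩ ⋂ k, ⋂ (_ : k < r),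
      {x : ℂ × Circle | radius k ≤ ‖x.1 - (centre k : ℂ)‖} := by
    ext; simp [holed]
  rw [this]
  exact (isClosed_le (by fun_prop) (by fun_prop)).inter
    (isClosed_iInter fun k => isClosed_iInter fun _ => isClosed_le (by fun_prop) (by fun_prop))

theorem isCompact_pants : IsCompact pantsTimesCircle := by
  refine isCompact_solidTorus.of_isClosed_subset ?_ fun x hx => hx.1
  have h1 : IsClosed {x : ℂ × Circle | ‖x.1‖ ≤ 1} := isClosed_le (by fun_prop) (by fun_prop)
  have h2 : IsClosed {x : ℂ × Circle | 1 / 4 ≤ ‖x.1 + 1 / 2‖} :=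
    isClosed_le (by fun_prop) (by fun_prop)
  have h3 : IsClosed {x : ℂ × Circle | 1 / 4 ≤ ‖x.1 - 1 / 2‖} :=
    isClosed_le (by fun_prop) (by fun_prop)
  exact h1.inter (h2.inter h3)

theorem norm_rescale_sub (c ρ : ℝ) (hρ : 0 < ρ) (x : ℂ × Circle) :
    ‖(rescale c ρ x).1 - c‖ = ρ * ‖x.1‖ := by
  simp [rescale, abs_of_pos hρ]

theorem mem_pants {x : ℂ × Circle} : x ∈ pantsTimesCircle ↔
    ‖x.1‖ ≤ 1 ∧ 1 / 4 ≤ ‖x.1 - ((-1 / 2 : ℝ) : ℂ)‖ ∧ 1 / 4 ≤ ‖x.1 - ((1 / 2 : ℝ) : ℂ)‖ := by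
  have h1 : x.1 + 1 / 2 = x.1 - ((-1 / 2 : ℝ) : ℂ) := by push_cast; ring
  have h2 : x.1 - 1 / 2 = x.1 - ((1 / 2 : ℝ) : ℂ) := by push_cast; ring
  rw [← h1, ← h2]
  rfl

theorem norm_ofReal_sub (a b : ℝ) : ‖(a : ℂ) - b‖ = |a - b| := by
  rw [← Complex.ofReal_sub, Complex.norm_real, Real.norm_eq_abs]

theorem abs_sub_le_norm (x : ℂ) (c d : ℝ) : |c - d| ≤ ‖x - c‖ + ‖x - d‖ := by
  rw [← norm_ofReal_sub, ← norm_sub_rev (c : ℂ) x]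
  exact norm_sub_le_norm_sub_add_norm_sub _ _ _

theorem norm_sub_le_add (x : ℂ) (c d : ℝ) : ‖x - c‖ ≤ ‖x - d‖ + |d - c| := by
  rw [← norm_ofReal_sub]
  exact norm_sub_le_norm_sub_add_norm_sub _ _ _

theorem norm_le_add (x : ℂ) (d : ℝ) : ‖x‖ ≤ ‖x - d‖ + |d| := by
  simpa using norm_sub_le_add x 0 d

theorem norm_rescale_lt (k : ℕ) {x : ℂ × Circle} (hx : ‖x.1‖ ≤ 1) :
    ‖(rescale (centre k) (radius k) x).1‖ < 1 := by
  have h1 := norm_le_add (rescale (centre k) (radius k) x).1 (centre k)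
  rw [norm_rescale_sub _ _ (radius_pos k)] at h1
  have h2 := centre_bounds k
  have h3 := radius_pos k
  nlinarith

/-- A boundary point of a hole meets the condition of that hole with equality, and the conditions of
the others because the closed holes are disjoint (`centre_lt`). -/
theorem rescale_mem_holed {r k : ℕ} {x : ℂ × Circle} (hx : ‖x.1‖ = 1) :
    rescale (centre k) (radius k) x ∈ holed r := by
  refine ⟨(norm_rescale_lt k hx.le).le, fun l _ => ?_⟩
  have h1 := abs_sub_le_norm (rescale (centre k) (radius k) x).1 (centre k) (centre l)
  have h2 := norm_rescale_sub (centre k) (radius k) (radius_pos k) x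
  rw [hx, mul_one] at h2
  rw [h2] at h1
  rcases lt_trichotomy k l with h | h | h
  · have := centre_lt h
    have h3 := neg_abs_le (centre k - centre l)
    linarith
  · subst h; exact h2.ge
  · have := centre_lt h
    have h3 := le_abs_self (centre k - centre l)
    linarith

theorem rescale_rescale (k : ℕ) (x : ℂ × Circle) :
    rescale (1 / 2) (1 / 4) (rescale (centre k) (radius k) x) =
      rescale (centre (k + 1)) (radius (k + 1)) x := by
  rw [centre_succ, radius_succ]
  simp only [rescale]
  push_cast
  congr 1
  ring

theorem norm_eq_one_of_rescale_mem_pants {x : ℂ × Circle} (hx : ‖x.1‖ ≤ 1)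
    (h : rescale (1 / 2) (1 / 4) x ∈ pantsTimesCircle) : ‖x.1‖ = 1 := by
  have h1 := (mem_pants.1 h).2.2
  rw [norm_rescale_sub _ _ (by norm_num)] at h1
  linarith

theorem norm_rescale_half_le {x : ℂ × Circle} {c : ℝ} (hc : |c| = 1 / 2) (hx : ‖x.1‖ ≤ 1) :
    ‖(rescale c (1 / 4) x).1‖ ≤ 3 / 4 := by
  have h1 := norm_le_add (rescale c (1 / 4) x).1 c
  rw [norm_rescale_sub _ _ (by norm_num), hc] at h1
  linarith

/-- The centres `c` and `-c` have distance `1` and the point is within `2/4` of `c`. The bound `2`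
in place of `1` leaves room for a collar beyond the unit circle. -/
theorem le_norm_rescale_half_sub {x : ℂ × Circle} {c : ℝ} (hc : |c| = 1 / 2) (hx : ‖x.1‖ ≤ 2) :
    1 / 2 ≤ ‖(rescale c (1 / 4) x).1 - ((-c : ℝ) : ℂ)‖ := by
  have h1 := abs_sub_le_norm (rescale c (1 / 4) x).1 c (-c)
  rw [norm_rescale_sub _ _ (by norm_num)] at h1
  have : |c - -c| = 1 := by
    rw [sub_neg_eq_add, ← two_mul, abs_mul, hc]; norm_num
  linarith

theorem rescale_half_mem_pants_iff {x : ℂ × Circle} (hx : ‖x.1‖ ≤ 2) :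
    rescale (1 / 2) (1 / 4) x ∈ pantsTimesCircle ↔ 1 ≤ ‖x.1‖ := by
  have h1 := le_norm_rescale_half_sub (c := 1 / 2) (by norm_num) hx
  have h2 := norm_le_add (rescale (1 / 2) (1 / 4) x).1 (1 / 2)
  rw [norm_rescale_sub _ _ (by norm_num)] at h2
  rw [mem_pants, norm_rescale_sub _ _ (by norm_num)]
  norm_num at h1 h2 ⊢
  constructor
  · intro h; linarith [h.2.2]
  · intro h; refine ⟨?_, ?_, ?_⟩ <;> linarith

theorem rescale_neg_half_mem_pants {x : ℂ × Circle} (hx : ‖x.1‖ = 1) :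
    rescale (-1 / 2) (1 / 4) x ∈ pantsTimesCircle := by
  have h1 := le_norm_rescale_half_sub (c := -1 / 2) (x := x) (by norm_num) (by linarith)
  have h2 := norm_le_add (rescale (-1 / 2) (1 / 4) x).1 (-1 / 2)
  rw [norm_rescale_sub _ _ (by norm_num)] at h2
  rw [mem_pants, norm_rescale_sub _ _ (by norm_num), hx]
  rw [hx] at h2
  norm_num at h1 h2 ⊢
  constructor <;> linarith

theorem bdry_mem_pants {x : ℂ × Circle} (hx : ‖x.1‖ = 1) : x ∈ pantsTimesCircle := by
  have h1 := norm_le_add x.1 (-1 / 2)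
  have h2 := norm_le_add x.1 (1 / 2)
  rw [mem_pants, hx]
  rw [hx] at h1 h2
  norm_num at h1 h2 ⊢
  constructor <;> linarith

theorem bdry_mem_holed (r : ℕ) {x : ℂ × Circle} (hx : ‖x.1‖ = 1) : x ∈ holed r := by
  refine ⟨hx.le, fun k _ => ?_⟩
  have h1 := norm_le_add x.1 (centre k)
  have h2 := centre_bounds k
  linarith

/-- Hole `0` is one of the two holes of `pantsTimesCircle`, and all later holes lie inside the other
one. -/
theorem pants_subset_holed (r : ℕ) : pantsTimesCircle ⊆ holed (r + 1) := by
  intro x hx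
  obtain ⟨h1, h2, h3⟩ := mem_pants.1 hx
  refine ⟨h1, fun k hk => ?_⟩
  cases k with
  | zero => rw [centre_zero, radius_zero]; exact h2
  | succ k =>
    have h4 := norm_sub_le_add x.1 (1 / 2) (centre (k + 1))
    rw [centre_succ, radius_succ] at *
    have h5 : |1 / 2 + 1 / 4 * centre k - 1 / 2| = 1 / 4 * |centre k| := by
      rw [add_sub_cancel_left, abs_mul]; norm_num
    rw [h5] at h4
    have h6 := centre_bounds k
    linarith

theorem rescale_mem_holed_succ_iff (r : ℕ) {x : ℂ × Circle} (hx : ‖x.1‖ ≤ 1) :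
    rescale (1 / 2) (1 / 4) x ∈ holed (r + 1) ↔ x ∈ holed r := by
  have hk : ∀ k, (rescale (1 / 2) (1 / 4) x).1 - centre (k + 1) =
      ((1 / 4 : ℝ) : ℂ) * (x.1 - centre k) := by
    intro k
    rw [centre_succ]
    simp only [rescale]
    push_cast
    ring
  have hk' : ∀ k, radius (k + 1) ≤ ‖(rescale (1 / 2) (1 / 4) x).1 - centre (k + 1)‖ ↔
      radius k ≤ ‖x.1 - centre k‖ := by
    intro k
    rw [hk, radius_succ, norm_mul, Complex.norm_real, Real.norm_eq_abs, abs_of_pos (by norm_num)]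
    constructor <;> intro h <;> linarith
  constructor
  · intro h
    exact ⟨hx, fun k hk => (hk' k).1 (h.2 (k + 1) (by omega))⟩
  · intro h
    refine ⟨(norm_rescale_half_le (by norm_num) hx).trans (by norm_num), fun k hk => ?_⟩
    cases k with
    | zero =>
      -- Hole `0` is far from the disk around `1/2`, so it imposes no condition there.
      have h1 := le_norm_rescale_half_sub (c := 1 / 2) (x := x) (by norm_num) (by linarith)
      rw [centre_zero, radius_zero]
      norm_num at h1 ⊢
      linarith
    | succ k => exact (hk' k).2 (h.2 k (by omega))

/-- The cut is along the circle of radius `1/4` around `1/2`, which encloses all holes except hole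
`0`; inside it, rescaling gives the disk with one hole fewer. -/
theorem holed_succ (r : ℕ) :
    holed (r + 1) = pantsTimesCircle ∪ rescale (1 / 2) (1 / 4) '' holed r := by
  ext x
  constructor
  · intro hx
    by_cases h : 1 / 4 ≤ ‖x.1 - ((1 / 2 : ℝ) : ℂ)‖
    · refine Or.inl (mem_pants.2 ⟨hx.1, ?_, h⟩)
      have := hx.2 0 (by omega)
      rwa [centre_zero, radius_zero] at this
    · have e : rescale (1 / 2) (1 / 4) (4 * (x.1 - ((1 / 2 : ℝ) : ℂ)), x.2) = x := by
        refine Prod.ext ?_ rfl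
        simp only [rescale]
        push_cast
        ring
      have hn : ‖(4 * (x.1 - ((1 / 2 : ℝ) : ℂ)), x.2).1‖ ≤ 1 := by
        rw [norm_mul]
        norm_num at h ⊢
        linarith
      exact Or.inr ⟨_, (rescale_mem_holed_succ_iff r hn).1 (by rwa [e]), e⟩
  · rintro (hx | ⟨y, hy, rfl⟩)
    · exact pants_subset_holed r hx
    · exact (rescale_mem_holed_succ_iff r hy.1).2 hy

end PlaneGeometry

/-! ### Stars -/

/-- A `Y × S¹`, embedded by `Ψ`, where `Y` is the disk with `r` holes, and solid tori `g k` that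
are glued to the inner boundary components by `T^(p k) S`. -/
structure IsStar {N : OrientedManifold 3} {r : ℕ} (p : Fin r → ℤ) (Ψ : ℂ × Circle → N)
    (g : Fin r → ℂ × Circle → N) : Prop where
  emb : IsOrientedEmbNear (plane.prod circle) N Ψ (holed r)
  emb_g : ∀ k, IsOrientedEmbNear (plane.prod circle) N (g k) solidTorus
  glue : ∀ k (z w : Circle), g k ((z : ℂ), w) =
    Ψ (rescale (centre k) (radius k) (((w⁻¹ * z ^ p k : Circle) : ℂ), z))
  disjoint : ∀ k, Disjoint (Ψ '' holed r) (g k '' openSolidTorus)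
  disjoint_g : ∀ k l, k ≠ l → Disjoint (g k '' solidTorus) (g l '' solidTorus)

/-- The union of `Y × S¹` and the solid tori. -/
def starSet {N : OrientedManifold 3} {r : ℕ} (Ψ : ℂ × Circle → N) (g : Fin r → ℂ × Circle → N) :
    Set N :=
  Ψ '' holed r ∪ ⋃ k, g k '' solidTorus

theorem exists_circle {x : ℂ × Circle} (h : ‖x.1‖ = 1) : ∃ z : Circle, x = ((z : ℂ), x.2) :=
  ⟨⟨x.1, mem_sphere_zero_iff_norm.2 h⟩, rfl⟩

namespace IsStar

variable {N : OrientedManifold 3} {r : ℕ} {p : Fin r → ℤ} {Ψ : ℂ × Circle → N}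
  {g : Fin r → ℂ × Circle → N}

theorem isCompact (h : IsStar p Ψ g) : IsCompact (starSet Ψ g) :=
  (h.emb.isCompact_image (isCompact_holed r)).union
    (isCompact_iUnion fun k => (h.emb_g k).isCompact_image isCompact_solidTorus)

theorem bdry_g (h : IsStar p Ψ g) (k : Fin r) (x : Circle × Circle) : bdry (g k) x =
    bdry (Ψ ∘ rescale (centre k) (radius k)) (torusTPowS (p k) x : Circle × Circle) :=
  h.glue k x.1 x.2

/-- The open solid torus misses `Y × S¹`, so only its boundary can be shared; the gluing map is a
diffeomorphism, so all of the boundary of the hole is reached. -/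
theorem image_inter (h : IsStar p Ψ g) (k : Fin r) : g k '' solidTorus ∩ Ψ '' holed r =
    Set.range (bdry (Ψ ∘ rescale (centre k) (radius k))) := by
  ext y
  constructor
  · rintro ⟨⟨x, hx, rfl⟩, hy⟩
    have h1 : ‖x.1‖ = 1 := by
      refine le_antisymm hx (not_lt.1 fun hlt => ?_)
      exact Set.disjoint_left.1 (h.disjoint k) hy ⟨x, hlt, rfl⟩
    obtain ⟨z, hz⟩ := exists_circle h1
    rw [hz]
    exact ⟨_, (h.bdry_g k (z, x.2)).symm⟩
  · rintro ⟨x, rfl⟩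
    let u : Circle × Circle := (torusTPowS (p k)).symm x
    refine ⟨⟨((u.1 : ℂ), u.2), (Circle.norm_coe u.1).le, ?_⟩,
      ⟨_, rescale_mem_holed (Circle.norm_coe x.1), rfl⟩⟩
    refine (h.bdry_g k u).trans (congrArg _ ?_)
    exact (torusTPowS (p k)).apply_symm_apply x

end IsStar

/-! ### Splitting one solid torus off a star -/

section Step

variable {N : OrientedManifold 3} {r : ℕ} {p : Fin (r + 1) → ℤ} {Ψ : ℂ × Circle → N}
  {g : Fin (r + 1) → ℂ × Circle → N}

/-- The star without its first solid torus. -/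
theorem IsStar.tail (h : IsStar p Ψ g) : IsStar (fun k => p k.succ)
    (Ψ ∘ rescale (1 / 2) (1 / 4)) (fun k => g k.succ) where
  emb := h.emb.comp ⟨Set.univ, Set.subset_univ _, isOrientedEmbOn_rescale _ _ (by norm_num)⟩
    fun x hx => (rescale_mem_holed_succ_iff r hx.1).2 hx
  emb_g := fun k => h.emb_g k.succ
  glue := fun k z w => by
    rw [h.glue, Function.comp_apply, rescale_rescale]
    rfl
  disjoint := fun k => (h.disjoint k.succ).mono_left (by
    rw [Set.image_comp]
    refine Set.image_mono ?_
    rw [holed_succ]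
    exact Set.subset_union_right)
  disjoint_g := fun k l hkl => h.disjoint_g _ _ fun e => hkl (Fin.succ_injective _ e)

theorem rescale_zero : rescale (centre ((0 : Fin (r + 1)) : ℕ)) (radius ((0 : Fin (r + 1)) : ℕ)) =
    rescale (-1 / 2) (1 / 4) := by
  rw [Fin.val_zero, centre_zero, radius_zero]

theorem IsStar.inter_pants_zero (h : IsStar p Ψ g) : g 0 '' solidTorus ∩ Ψ '' pantsTimesCircle =
    Set.range (bdry (Ψ ∘ rescale (-1 / 2) (1 / 4))) := by
  have e := h.image_inter 0
  rw [rescale_zero] at e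
  refine Set.Subset.antisymm ?_ ?_
  · rw [← e]
    exact Set.inter_subset_inter_right _ (Set.image_mono (pants_subset_holed r))
  · refine Set.subset_inter (e ▸ Set.inter_subset_left) ?_
    rintro _ ⟨x, rfl⟩
    exact ⟨_, rescale_neg_half_mem_pants (Circle.norm_coe x.1), rfl⟩

/-- A common point in `Y × S¹` would lie on the boundary of hole `0`, at distance `1/4` from `-1/2`,
but the disk around `1/2` stays at distance at least `1/2` from there. -/
theorem IsStar.disjoint_tail (h : IsStar p Ψ g) : Disjoint (g 0 '' solidTorus)
    (starSet (Ψ ∘ rescale (1 / 2) (1 / 4)) fun k => g k.succ) := by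
  rw [starSet, Set.disjoint_union_right, Set.disjoint_iUnion_right]
  refine ⟨?_, fun k => h.disjoint_g _ _ (Fin.succ_ne_zero k).symm⟩
  rw [Set.disjoint_left]
  rintro y hy ⟨b, hb, rfl⟩
  have hb' := (rescale_mem_holed_succ_iff r hb.1).2 hb
  have e := h.image_inter 0
  rw [rescale_zero] at e
  obtain ⟨x, hx⟩ : Ψ (rescale (1 / 2) (1 / 4) b) ∈
      Set.range (bdry (Ψ ∘ rescale (-1 / 2) (1 / 4))) := e ▸ ⟨hy, _, hb', rfl⟩
  have := h.emb.injOn (pants_subset_holed r (rescale_neg_half_mem_pants (Circle.norm_coe x.1)))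
    hb' hx
  have h1 := le_norm_rescale_half_sub (c := 1 / 2) (x := b) (by norm_num) (by linarith [hb.1])
  rw [← this] at h1
  have h2 := norm_rescale_sub (-1 / 2) (1 / 4) (by norm_num) ((x.1 : ℂ), x.2)
  rw [Circle.norm_coe] at h2
  have h3 : (-(1 / 2) : ℝ) = -1 / 2 := by norm_num
  rw [h3, h2] at h1
  norm_num at h1

/-- Injectivity of `Ψ` reduces the first part to the plane: the two regions share the circle of
radius `1/4` around `1/2`. The solid tori meet `Y × S¹` only at boundaries of holes strictly inside
this circle, which miss the pants. -/
theorem IsStar.inter_pants_tail (h : IsStar p Ψ g) :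
    (starSet (Ψ ∘ rescale (1 / 2) (1 / 4)) fun k => g k.succ) ∩ Ψ '' pantsTimesCircle =
      Set.range (bdry (Ψ ∘ rescale (1 / 2) (1 / 4))) := by
  refine Set.Subset.antisymm ?_ ?_
  · rintro y ⟨hy | hy, x, hx, rfl⟩
    · obtain ⟨b, hb, hbx⟩ := hy
      have := h.emb.injOn ((rescale_mem_holed_succ_iff r hb.1).2 hb) (pants_subset_holed r hx) hbx
      obtain ⟨z, hz⟩ := exists_circle (norm_eq_one_of_rescale_mem_pants hb.1 (this ▸ hx))
      rw [← hbx, hz]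
      exact ⟨(z, b.2), rfl⟩
    · obtain ⟨k, hk⟩ := Set.mem_iUnion.1 hy
      obtain ⟨u, hu⟩ : Ψ x ∈ Set.range (bdry (Ψ ∘ rescale (centre k.succ) (radius k.succ))) :=
        h.image_inter k.succ ▸ ⟨hk, x, pants_subset_holed r hx, rfl⟩
      have hu' := h.emb.injOn (rescale_mem_holed (Circle.norm_coe u.1)) (pants_subset_holed r hx) hu
      rw [Fin.val_succ, ← rescale_rescale] at hu'
      have h1 := norm_rescale_lt k (x := ((u.1 : ℂ), u.2)) (Circle.norm_coe u.1).le
      exact absurd (norm_eq_one_of_rescale_mem_pants h1.le (hu' ▸ hx)) h1.ne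
  · rintro _ ⟨x, rfl⟩
    have hx : ‖((x.1 : ℂ), x.2).1‖ = 1 := Circle.norm_coe x.1
    exact ⟨Or.inl ⟨_, bdry_mem_holed r hx, rfl⟩, _, (rescale_half_mem_pants_iff (by linarith)).2 hx.ge, rfl⟩

theorem starSet_succ (Ψ : ℂ × Circle → N) (g : Fin (r + 1) → ℂ × Circle → N) :
    g 0 '' solidTorus ∪ (starSet (Ψ ∘ rescale (1 / 2) (1 / 4)) fun k => g k.succ) ∪
      Ψ '' pantsTimesCircle = starSet Ψ g := by
  ext y
  simp only [starSet, holed_succ, Set.image_union, Set.image_comp, Set.mem_union, Set.mem_iUnion,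
    Fin.exists_fin_succ]
  tauto

/-- The caps reach the pants only along the inner circles, where the modulus is at most `3/4`; on
the outer boundary it is `1`. -/
theorem IsStar.disjoint_bdry (h : IsStar p Ψ g) : Disjoint (g 0 '' solidTorus ∪
    (starSet (Ψ ∘ rescale (1 / 2) (1 / 4)) fun k => g k.succ)) (Set.range (bdry Ψ)) := by
  rw [Set.disjoint_left]
  rintro _ hy ⟨x, rfl⟩
  have hx : ‖((x.1 : ℂ), x.2).1‖ = 1 := Circle.norm_coe x.1
  have hxp : bdry Ψ x ∈ Ψ '' pantsTimesCircle := ⟨_, bdry_mem_pants hx, rfl⟩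
  have key : ∀ c : ℝ, |c| = 1 / 2 → (∀ u : ℂ × Circle, ‖u.1‖ = 1 → rescale c (1 / 4) u ∈ holed (r + 1)) →
      bdry Ψ x ∉ Set.range (bdry (Ψ ∘ rescale c (1 / 4))) := by
    rintro c hc hm ⟨u, hu⟩
    have hu1 : ‖((u.1 : ℂ), u.2).1‖ = 1 := Circle.norm_coe u.1
    have := h.emb.injOn (hm _ hu1) (bdry_mem_holed _ hx) hu
    have h1 := norm_rescale_half_le hc hu1.le
    rw [this, hx] at h1
    norm_num at h1
  rcases hy with hy | hy
  · exact key (-1 / 2) (by norm_num)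
      (fun u hu => pants_subset_holed r (rescale_neg_half_mem_pants hu))
      (h.inter_pants_zero ▸ ⟨hy, hxp⟩)
  · exact key (1 / 2) (by norm_num)
      (fun u hu => pants_subset_holed r ((rescale_half_mem_pants_iff (by linarith)).2 hu.ge))
      (h.inter_pants_tail ▸ ⟨hy, hxp⟩)

end Step

/-- A solid torus and a smaller star split off from a star. -/
theorem IsStar.isDecomposition {r : ℕ} {p : Fin (r + 1) → ℤ} (W : Cobordism emptySurface torus)
    {Ψ : ℂ × Circle → W.N} {g : Fin (r + 1) → ℂ × Circle → W.N} (h : IsStar p Ψ g)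
    (hX : W.X = starSet Ψ g) (hout : W.out = bdry Ψ) :
    IsDecomposition W torus torus.orient torus.orient_locally_const (g 0 '' solidTorus)
      (starSet (Ψ ∘ rescale (1 / 2) (1 / 4)) fun k => g k.succ) (Ψ '' pantsTimesCircle)
      (bdry (Ψ ∘ rescale (-1 / 2) (1 / 4))) (bdry (Ψ ∘ rescale (1 / 2) (1 / 4))) where
  isCompact_a := (h.emb_g 0).isCompact_image isCompact_solidTorus
  isCompact_b := h.tail.isCompact
  isCompact₂ := (h.emb.mono (pants_subset_holed r)).isCompact_image isCompact_pants
  outgoing_a := by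
    -- The solid torus is reparametrized by the inverse of its gluing map, so that its boundary
    -- carries the parametrization of the hole.
    have h1 := HasCollar.reparam (isOutgoing_solidTorus (h.emb_g 0)) (torusTPowS (p 0)).symm
    have e : bdry (g 0) ∘ (torusTPowS (p 0)).symm = bdry (Ψ ∘ rescale (-1 / 2) (1 / 4)) := by
      funext x
      rw [← rescale_zero (r := r)]
      refine (h.bdry_g 0 _).trans (congrArg _ ?_)
      exact (torusTPowS (p 0)).apply_symm_apply x
    exact e ▸ h1
  outgoing_b := by
    -- The collar is built from the pants, where membership is a condition on the modulus in `ℂ`,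
    -- and is then flipped to the smaller star.
    have h1 : HasCollar (0 ≤ ·) torus.toOrientedManifold W.N (Ψ '' pantsTimesCircle)
        (fun x : Circle × Circle => Ψ (rescale (1 / 2) (1 / 4) (polar (x, 0)))) := by
      refine hasCollar_image (κ := rescale (1 / 2) (1 / 4) ∘ polar)
        (h.emb.mono (pants_subset_holed r)) one_pos
        (((isOrientedEmbOn_rescale (1 / 2) (1 / 4) (by norm_num)).comp isOrientedEmbOn_polar).mono
          (isOpen_abs_snd_lt _) fun x hx => ⟨hx, trivial⟩) (fun x t ht => ?_) le_rfl
      have hn := norm_polar_fst (p := (x, t)) ht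
      rw [Function.comp_apply, rescale_half_mem_pants_iff, hn]
      · simp
      · rw [hn]
        have := (abs_lt.1 ht).2
        simp only
        linarith
    have e : (fun x : Circle × Circle => Ψ (rescale (1 / 2) (1 / 4) (polar (x, 0)))) =
        bdry (Ψ ∘ rescale (1 / 2) (1 / 4)) := by
      funext x
      simp [bdry, polar]
    rw [e] at h1
    have hm : ∀ x : Circle × Circle, bdry (Ψ ∘ rescale (1 / 2) (1 / 4)) x ∈
        (starSet (Ψ ∘ rescale (1 / 2) (1 / 4)) fun k => g k.succ) ∩ Ψ '' pantsTimesCircle :=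
      fun x => h.inter_pants_tail ▸ ⟨x, rfl⟩
    refine IsIncoming.flip (S := torus.toOrientedManifold) h1
      ((IsDecomposition.isOpen_diff_out W).sdiff
        ((h.emb_g 0).isCompact_image isCompact_solidTorus).isClosed)
      (fun x => ⟨⟨?_, ?_⟩, ?_⟩) ?_ ?_ (fun x => (hm x).1)
    · rw [hX, ← starSet_succ]
      exact Or.inr (hm x).2
    · rw [hout]
      exact Set.disjoint_left.1 h.disjoint_bdry (Or.inr (hm x).1)
    · exact Set.disjoint_right.1 h.disjoint_tail (hm x).1
    · rw [hX, ← starSet_succ]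
      rintro y ⟨⟨(h1 | h1) | h1, -⟩, h2⟩
      · exact absurd h1 h2
      · exact Or.inr h1
      · exact Or.inl h1
    · rintro y ⟨-, h1, h2⟩
      exact h.inter_pants_tail ▸ ⟨h2, h1⟩
  cover := by rw [hX, ← starSet_succ]
  disjoint := h.disjoint_tail
  inter_a := h.inter_pants_zero
  inter_b := h.inter_pants_tail
  disjoint_out := by rw [hout]; exact h.disjoint_bdry

/-- What remains between the caps is the standard three-holed sphere times `S¹`, with inner
boundaries already parametrized by `z ↦ ∓1/2 + z/4`. -/
theorem IsStar.isFusion_middle {r : ℕ} {p : Fin (r + 1) → ℤ} (W : Cobordism emptySurface torus)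
    {Ψ : ℂ × Circle → W.N} {g : Fin (r + 1) → ℂ × Circle → W.N} (h : IsStar p Ψ g)
    (hX : W.X = starSet Ψ g) (hout : W.out = bdry Ψ) :
    (h.isDecomposition W hX hout).middle.IsFusion
      (torus.disjUnionDouble torus.orient torus.orient_locally_const :
        DisjUnion torus torus _) := by
  refine ⟨Ψ, h.emb.mono (pants_subset_holed r), rfl, fun z w => congrArg Ψ ?_,
    fun z w => congrArg Ψ ?_, fun z w => congrFun hout (z, w)⟩
  · simp only [rescale]
    push_cast
    congr 1
    ring
  · simp only [rescale]
    push_cast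
    congr 1
    ring

/-! ### Powers of `T`, diagonalization of fusion, vectors of stars -/

theorem torusTPow_zero : torusTPow 0 = OrientedDiffeo.refl torus.toOrientedManifold := by
  refine OrientedDiffeo.ext fun x => ?_
  change ((_, _) : Circle × Circle) = x
  simp
  rfl

theorem torusTPow_add_one (p : ℤ) : torusTPow (p + 1) = (torusTPow p).trans torusT := by
  refine OrientedDiffeo.ext fun (x : Circle × Circle) => ?_
  change ((x.1 * x.2 ^ (p + 1), x.2) : Circle × Circle) = (x.1 * x.2 ^ p * x.2, x.2)
  rw [zpow_add_one, mul_assoc]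

namespace TQFT.IsVerlindeBasis

variable {Z : TQFT} {m : ℕ} {v : Basis (Fin (m + 1)) ℂ (Z.V torus)}
  {S : Matrix (Fin (m + 1)) (Fin (m + 1)) ℂ} {t : Fin (m + 1) → ℂ}

theorem map_torusTPow (ht : ∀ i, Z.map torusT (v i) = t i • v i) (p : ℤ) (i : Fin (m + 1)) :
    Z.map (torusTPow p) (v i) = t i ^ p • v i := by
  -- Negative powers need nonzero eigenvalues; `Z(T)` is invertible.
  have ht0 : t i ≠ 0 := by
    intro h
    have := ht i
    rw [h, zero_smul, LinearEquiv.map_eq_zero_iff] at this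
    exact v.ne_zero i this
  induction p with
  | zero => rw [torusTPow_zero, Z.map_refl]; simp
  | succ n ih =>
    rw [torusTPow_add_one, Z.map_trans, LinearEquiv.trans_apply, ih, map_smul, ht, smul_smul,
      zpow_add_one₀ ht0]
  | pred n ih =>
    have h := torusTPow_add_one (-(n : ℤ) - 1)
    rw [sub_add_cancel] at h
    apply (Z.map torusT).injective
    rw [h, Z.map_trans, LinearEquiv.trans_apply] at ih
    rw [ih, map_smul, ht, smul_smul, ← zpow_add_one₀ ht0, sub_add_cancel]

/-- This is the vector that a solid torus glued in with framing `p` contributes to a star. -/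
theorem map_torusTPowS (hv : Z.IsVerlindeBasis v S) (ht : ∀ i, Z.map torusT (v i) = t i • v i)
    (p : ℤ) : Z.map (torusTPowS p) (v 0) = ∑ i, (t i ^ p * S i 0) • v i := by
  rw [torusTPowS, Z.map_trans, LinearEquiv.trans_apply, hv.matrix_eq, map_sum]
  refine Finset.sum_congr rfl fun i _ => ?_
  rw [map_smul, map_torusTPow ht, smul_smul, mul_comm]

/-- The idempotents of the fusion algebra. -/
noncomputable def idem (v : Basis (Fin (m + 1)) ℂ (Z.V torus))
    (S : Matrix (Fin (m + 1)) (Fin (m + 1)) ℂ) (l : Fin (m + 1)) : Z.V torus :=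
  ∑ k, (S 0 l * starRingEnd ℂ (S l k)) • v k

/-- Unitarity, with the conjugate transpose replaced by the conjugate through the symmetry of `S`.
-/
theorem sum_conj_mul (hv : Z.IsVerlindeBasis v S) (l l' : Fin (m + 1)) :
    ∑ k, starRingEnd ℂ (S l k) * S k l' = if l = l' then 1 else 0 := by
  have h := congrFun (congrFun (Matrix.mem_unitaryGroup_iff'.1 hv.unitary) l) l'
  rw [Matrix.mul_apply, Matrix.one_apply] at h
  rw [← h]
  refine Finset.sum_congr rfl fun k _ => ?_
  rw [Matrix.star_apply, hv.symmetric.apply, starRingEnd_apply]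

/-- The coefficient of `v k` is the Hermitian product of rows `0` and `k` of `S`, which are
orthonormal. -/
theorem sum_idem (hv : Z.IsVerlindeBasis v S) : ∑ l, idem v S l = v 0 := by
  simp only [idem]
  rw [Finset.sum_comm]
  have h : ∀ k, ∑ l, (S 0 l * starRingEnd ℂ (S l k)) • v k =
      (if k = 0 then (1 : ℂ) else 0) • v k := by
    intro k
    rw [← Finset.sum_smul, ← hv.sum_conj_mul]
    congr 1
    refine Finset.sum_congr rfl fun l _ => ?_
    rw [hv.symmetric.apply l k, hv.symmetric.apply, mul_comm]
  simp [h]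

/-- The product of a basis element and an idempotent. -/
theorem fusion_idem (hv : Z.IsVerlindeBasis v S) {A : ClosedManifold 2}
    {d : DisjUnion torus torus A} {W : Cobordism A torus} (hW : W.IsFusion d) (i l : Fin (m + 1)) :
    Z.cob W (Z.tensor d (v i ⊗ₜ idem v S l)) = (S i l / S 0 l) • idem v S l := by
  simp only [idem, TensorProduct.tmul_sum, TensorProduct.tmul_smul, map_sum, map_smul,
    hv.fusion A d W hW, Finset.smul_sum, smul_smul]
  rw [Finset.sum_comm]
  refine Finset.sum_congr rfl fun k _ => ?_
  rw [← Finset.sum_smul]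
  congr 1
  simp only [Finset.mul_sum]
  rw [Finset.sum_comm]
  -- Summing over `j` first, unitarity leaves only the term `l' = l` of the Verlinde formula.
  have h : ∀ l', ∑ j, S 0 l * starRingEnd ℂ (S l j) * (S i l' * S j l' * starRingEnd ℂ (S l' k) / S 0 l') =
      S 0 l * (S i l' * starRingEnd ℂ (S l' k) / S 0 l') * (if l = l' then 1 else 0) := by
    intro l'
    rw [← hv.sum_conj_mul, Finset.mul_sum]
    refine Finset.sum_congr rfl fun j _ => ?_
    ring
  simp only [h, mul_ite, mul_one, mul_zero, Finset.sum_ite_eq, Finset.mem_univ, if_true]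
  ring

theorem fusion_sum (hv : Z.IsVerlindeBasis v S) {A : ClosedManifold 2}
    {d : DisjUnion torus torus A} {W : Cobordism A torus} (hW : W.IsFusion d)
    (x c : Fin (m + 1) → ℂ) :
    Z.cob W (Z.tensor d ((∑ i, x i • v i) ⊗ₜ ∑ l, c l • idem v S l)) =
      ∑ l, ((∑ i, x i * S i l) / S 0 l * c l) • idem v S l := by
  simp only [TensorProduct.tmul_sum, TensorProduct.sum_tmul, TensorProduct.tmul_smul,
    TensorProduct.smul_tmul, map_sum, map_smul, hv.fusion_idem hW, smul_smul]
  refine Finset.sum_congr rfl fun l _ => ?_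
  rw [← Finset.sum_smul, smul_smul, mul_comm, Finset.sum_div]
  simp only [mul_div_assoc]

/-- The vector of a star. -/
theorem cob_star (hv : Z.IsVerlindeBasis v S) (ht : ∀ i, Z.map torusT (v i) = t i • v i) :
    ∀ (r : ℕ) (p : Fin r → ℤ) (W : Cobordism emptySurface torus) (Ψ : ℂ × Circle → W.N)
      (g : Fin r → ℂ × Circle → W.N), IsStar p Ψ g → W.X = starSet Ψ g → W.out = bdry Ψ →
      Z.cob W (Z.ofEmpty 1) =
        ∑ l, (∏ k, (∑ i, t i ^ p k * S i 0 * S i l) / S 0 l) • idem v S l := by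
  intro r
  induction r with
  | zero =>
    intro p W Ψ g h hX hout
    -- Without holes the star is a solid torus; its vector `v 0` is the sum of all idempotents, in
    -- accordance with the empty products.
    have h1 : W.IsSolidTorus := by
      refine ⟨Ψ, holed_zero ▸ h.emb, ?_, fun z w => congrFun hout (z, w)⟩
      rw [hX, starSet, ← holed_zero]
      simp
    rw [← hv.identity W h1, ← hv.sum_idem]
    simp
  | succ r ih =>
    intro p W Ψ g h hX hout
    have hd := h.isDecomposition W hX hout
    -- With its own parametrization the first solid torus has vector `v 0`; passing to that of the
    -- hole applies `Z(TᵖS)`.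
    have ha : hd.isCap_a.vector Z = ∑ i, (t i ^ p 0 * S i 0) • v i := by
      have e : bdry (Ψ ∘ rescale (-1 / 2) (1 / 4)) ∘ torusTPowS (p 0) = bdry (g 0) := by
        rw [← rescale_zero (r := r)]
        exact funext fun x => (h.bdry_g 0 x).symm
      have hc : IsCap torus W.N (g 0 '' solidTorus) (bdry (g 0)) :=
        e ▸ hd.isCap_a.reparam (torusTPowS (p 0))
      rw [IsCap.vector_eq_map Z hc hd.isCap_a (torusTPowS (p 0))
        (fun x => (congrFun e x).symm), IsCap.vector_solidTorus Z hv (h.emb_g 0) hc,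
        hv.map_torusTPowS ht]
    -- The second cap, as a cobordism of its own, is a star with one solid torus fewer.
    have hb := ih _ (IsCap.toCobordism (S := torus) hd.isCap_b) _ _ h.tail rfl rfl
    rw [hd.cob_eq Z, ha]
    refine (congrArg (fun y : Z.V torus => Z.cob hd.middle (Z.tensor
      (torus.disjUnionDouble torus.orient torus.orient_locally_const : DisjUnion torus torus _)
      ((∑ i, (t i ^ p 0 * S i 0) • v i) ⊗ₜ y))) hb).trans ?_
    refine (hv.fusion_sum (h.isFusion_middle W hX hout) _ _).trans ?_
    simp only [Fin.prod_univ_succ]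

end TQFT.IsVerlindeBasis

/-! ### The closed manifold as star, cylinder and solid torus -/

section Closed

/-- The radial coordinate of the shell: `t ∈ [0, 1]` runs inwards through the radii `1 - t / 2`,
from `1` to `1/2`. -/
theorem isOrientedEmbOn_line_neg : IsOrientedEmbOn line.neg line (fun t : ℝ => -t / 2)
    Set.univ where
  isOpen := isOpen_univ
  injOn := by
    have hi : Function.Injective fun t : ℝ => -t / 2 := fun s t h => by
      simp only at h
      linarith
    exact hi.injOn
  contMDiffOn := by
    have : ContDiff ℝ ∞ (fun t : ℝ => -t / 2) := by fun_prop
    exact this.contMDiff.contMDiffOn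
  carries := by
    intro (x : ℝ) _
    have hd : HasFDerivAt (fun t : ℝ => -t / 2) ((-1 / 2 : ℝ) • ContinuousLinearMap.id ℝ ℝ) x := by
      have h := (((-1 / 2 : ℝ) • ContinuousLinearMap.id ℝ ℝ).hasFDerivAt (x := x))
      refine h.congr_of_eventuallyEq (Filter.Eventually.of_forall fun t => ?_)
      simp
      ring
    have e : derivAt 𝓘(ℝ, ℝ) 𝓘(ℝ, ℝ) (fun t : ℝ => -t / 2) x =
        (-1 / 2 : ℝ) • ContinuousLinearMap.id ℝ ℝ := mfderiv_eq_fderiv.trans hd.fderiv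
    change Carries (derivAt 𝓘(ℝ, ℝ) 𝓘(ℝ, ℝ) (fun t : ℝ => -t / 2) x)
      (-(Basis.singleton (Fin 1) ℝ).orientation) (Basis.singleton (Fin 1) ℝ).orientation
    rw [e]
    have := (carries_neg_of_det_neg (V := ℝ) (n := 1) (by simp)
      ((-1 / 2 : ℝ) • ContinuousLinearMap.id ℝ ℝ) (-(Basis.singleton (Fin 1) ℝ).orientation) (by
        norm_num))
    have e2 : -(-(Basis.singleton (Fin 1) ℝ).orientation) =
      (Basis.singleton (Fin 1) ℝ).orientation :=
      neg_neg (G := Module.Ray ℝ (ℝ [⋀^Fin 1]→ₗ[ℝ] ℝ)) _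
    rw [e2] at this
    exact this

/-- The inverse of `torusTwist q`. -/
noncomputable def twistInv (q : ℤ) : OrientedDiffeo torus.neg.toOrientedManifold torus.toOrientedManifold :=
  (torusTwist q).symm

/-- The part of the solid torus near its boundary as a cylinder, parametrized such that the
boundary `t = 0` is glued by `torusTwist q`. -/
noncomputable def shell (q : ℤ) (x : (Circle × Circle) × ℝ) : ℂ × Circle :=
  polar ((twistInv q x.1 : Circle × Circle), -x.2 / 2)

/-- `twistInv q` starts from `-torus` and the radial direction is reversed; the two signs cancel in
the product. -/
theorem isOrientedEmbOn_shell (q : ℤ) : IsOrientedEmbOn (torus.prod line) (plane.prod circle)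
    (shell q) {p : (Circle × Circle) × ℝ | |p.2| < 2} := by
  refine (isOrientedEmbOn_polar.comp (IsOrientedEmbOn.of_neg_prod (M := torus.toOrientedManifold)
    (N := line) ((twistInv q).isOrientedEmbOn.prodMap isOrientedEmbOn_line_neg))).mono
    (isOpen_abs_snd_lt (Y := Circle × Circle) 2) ?_
  intro (p : (Circle × Circle) × ℝ) (hp : |p.2| < 2)
  refine ⟨⟨trivial, trivial⟩, ?_⟩
  change |-p.2 / 2| < 1
  rw [abs_div, abs_neg, abs_two]
  linarith

theorem norm_shell (q : ℤ) {x : (Circle × Circle) × ℝ} (hx : |x.2| < 2) :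
    ‖(shell q x).1‖ = 1 - x.2 / 2 := by
  rw [shell, norm_polar_fst]
  · ring
  · simp only
    rw [abs_div, abs_neg, abs_two]
    linarith

/-- Away from the core, `t` is recovered from the radius `1 - t / 2` and the point of the torus from
the direction of `a.1`. -/
theorem exists_shell (q : ℤ) {a : ℂ × Circle} (ha : a.1 ≠ 0) :
    ∃ x : Circle × Circle, shell q (x, 2 * (1 - ‖a.1‖)) = a := by
  have hn : (‖a.1‖ : ℂ) ≠ 0 := by simpa using ha
  let z : Circle := ⟨a.1 / ‖a.1‖, mem_sphere_zero_iff_norm.2 (by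
    rw [norm_div, Complex.norm_real, norm_norm, div_self (by simpa using ha)])⟩
  refine ⟨torusTwist q ((z, a.2) : Circle × Circle), ?_⟩
  have e : (twistInv q (torusTwist q ((z, a.2) : Circle × Circle)) : Circle × Circle) = (z, a.2) :=
    (torusTwist q).symm_apply_apply _
  rw [shell]
  simp only
  rw [e]
  refine Prod.ext ?_ rfl
  change ((1 + -(2 * (1 - ‖a.1‖)) / 2 : ℝ) : ℂ) * (a.1 / ‖a.1‖) = a.1
  have : (1 + -(2 * (1 - ‖a.1‖)) / 2 : ℝ) = ‖a.1‖ := by ring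
  rw [this]
  field_simp

/-- The closed manifold `M` consists of a star and of a solid torus `G` that is glued to it by
`torusTwist q`. -/
structure IsClosedStar (M : ClosedManifold 3) {r : ℕ} (p : Fin r → ℤ) (q : ℤ)
    (Ψ : ℂ × Circle → M) (g : Fin r → ℂ × Circle → M) (G : ℂ × Circle → M) : Prop where
  isStar : IsStar p Ψ g
  emb : IsOrientedEmbNear (plane.prod circle) M G solidTorus
  glue : ∀ x : Circle × Circle, bdry G x = bdry Ψ (torusTwist q x : Circle × Circle)
  cover : starSet Ψ g ∪ G '' solidTorus = Set.univ
  disjoint : Disjoint (Ψ '' holed r) (G '' openSolidTorus)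
  disjoint_g : ∀ k, Disjoint (g k '' solidTorus) (G '' solidTorus)

namespace IsClosedStar

variable {M : ClosedManifold 3} {r : ℕ} {p : Fin r → ℤ} {q : ℤ} {Ψ : ℂ × Circle → M}
  {g : Fin r → ℂ × Circle → M} {G : ℂ × Circle → M}

theorem glue_symm (h : IsClosedStar M p q Ψ g G) (x : Circle × Circle) :
    bdry G (twistInv q x : Circle × Circle) = bdry Ψ x :=
  (h.glue _).trans (congrArg (bdry Ψ) ((torusTwist q).apply_symm_apply x))

theorem shell_zero (h : IsClosedStar M p q Ψ g G) (x : Circle × Circle) :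
    G (shell q (x, 0)) = bdry Ψ x := by
  rw [← h.glue_symm]
  simp [shell, polar, bdry]

theorem shell_one (x : Circle × Circle) :
    G (shell q (x, 1)) = bdry (G ∘ rescale 0 (1 / 2)) (twistInv q x : Circle × Circle) := by
  simp only [shell, polar, bdry, rescale, Function.comp_apply]
  congr 2
  push_cast
  ring

theorem inter (h : IsClosedStar M p q Ψ g G) :
    starSet Ψ g ∩ G '' solidTorus = Set.range (bdry Ψ) := by
  refine Set.Subset.antisymm ?_ ?_
  · rintro _ ⟨hy | hy, x, hx, rfl⟩
    · have h1 : ‖x.1‖ = 1 := by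
        refine le_antisymm hx (not_lt.1 fun hlt => ?_)
        exact Set.disjoint_left.1 h.disjoint hy ⟨x, hlt, rfl⟩
      obtain ⟨z, hz⟩ := exists_circle h1
      rw [hz]
      exact ⟨_, (h.glue (z, x.2)).symm⟩
    · obtain ⟨k, hk⟩ := Set.mem_iUnion.1 hy
      exact absurd ⟨x, hx, rfl⟩ (Set.disjoint_left.1 (h.disjoint_g k) hk)
  · rintro _ ⟨x, rfl⟩
    refine ⟨Or.inl ⟨_, bdry_mem_holed r (Circle.norm_coe x.1), rfl⟩, ?_⟩
    rw [← h.glue_symm]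
    exact ⟨_, (Circle.norm_coe _).le, rfl⟩

theorem isCompact_interval : IsCompact {x : (Circle × Circle) × ℝ | x.2 ∈ Set.Icc (0 : ℝ) 1} := by
  have : {x : (Circle × Circle) × ℝ | x.2 ∈ Set.Icc (0 : ℝ) 1} = Set.univ ×ˢ Set.Icc 0 1 := by
    ext; simp
  rw [this]
  exact isCompact_univ.prod isCompact_Icc

theorem emb_shell (h : IsClosedStar M p q Ψ g G) : IsOrientedEmbNear (torus.prod line) M
    (G ∘ shell q) {x : (Circle × Circle) × ℝ | x.2 ∈ Set.Icc (0 : ℝ) 1} := by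
  refine h.emb.comp ⟨_, ?_, isOrientedEmbOn_shell q⟩ ?_
  · intro (x : (Circle × Circle) × ℝ) (hx : x.2 ∈ Set.Icc (0 : ℝ) 1)
    change |x.2| < 2
    exact abs_lt.2 ⟨by linarith [hx.1], by linarith [hx.2]⟩
  · intro (x : (Circle × Circle) × ℝ) (hx : x.2 ∈ Set.Icc (0 : ℝ) 1)
    change ‖(shell q x).1‖ ≤ 1
    rw [norm_shell q (abs_lt.2 ⟨by linarith [hx.1], by linarith [hx.2]⟩)]
    linarith [hx.1]

theorem image_shell (G : ℂ × Circle → M) (q : ℤ) :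
    (G ∘ shell q) '' {x : (Circle × Circle) × ℝ | x.2 ∈ Set.Icc (0 : ℝ) 1} =
      G '' {x | 1 / 2 ≤ ‖x.1‖ ∧ ‖x.1‖ ≤ 1} := by
  rw [Set.image_comp]
  congr 1
  ext a
  constructor
  · rintro ⟨x, hx, rfl⟩
    have h0 : 0 ≤ x.2 := hx.1
    have h1 : x.2 ≤ 1 := hx.2
    have h2 := norm_shell q (x := x) (abs_lt.2 ⟨by linarith, by linarith⟩)
    refine ⟨?_, ?_⟩ <;> rw [h2] <;> linarith
  · rintro ⟨h1, h2⟩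
    obtain ⟨x, hx⟩ := exists_shell q (a := a) (norm_pos_iff.1 (by linarith))
    exact ⟨_, ⟨by simp only; linarith, by simp only; linarith⟩, hx⟩

theorem image_rescale (G : ℂ × Circle → M) :
    (G ∘ rescale 0 (1 / 2)) '' solidTorus = G '' {x | ‖x.1‖ ≤ 1 / 2} := by
  rw [Set.image_comp]
  congr 1
  ext a
  constructor
  · rintro ⟨x, hx, rfl⟩
    have h1 := norm_rescale_sub 0 (1 / 2) (by norm_num) x
    rw [Complex.ofReal_zero, sub_zero] at h1
    have hx' : ‖x.1‖ ≤ 1 := hx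
    change ‖(rescale 0 (1 / 2) x).1‖ ≤ 1 / 2
    rw [h1]
    linarith
  · intro h
    have h : ‖a.1‖ ≤ 1 / 2 := h
    refine ⟨(2 * a.1, a.2), ?_, ?_⟩
    · change ‖2 * a.1‖ ≤ 1
      rw [norm_mul]
      norm_num at h ⊢
      linarith
    · refine Prod.ext ?_ rfl
      simp only [rescale]
      push_cast
      ring

/-- The collar is the explicit shell of `G` beyond the surface, flipped to the star; so nothing is
needed about `Ψ` beyond the outer boundary. -/
theorem isOutgoing_shell (h : IsClosedStar M p q Ψ g G) :
    IsOutgoing torus M (starSet Ψ g) (bdry Ψ) := by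
  have h1 : HasCollar (0 ≤ ·) torus.toOrientedManifold M (G '' solidTorus)
      (fun x : Circle × Circle => G (shell q (x, 0))) :=
    hasCollar_image h.emb two_pos (isOrientedEmbOn_shell q) (fun x t ht => by
      change ‖(shell q (x, t)).1‖ ≤ 1 ↔ 0 ≤ t
      rw [norm_shell q ht]
      constructor <;> intro h <;> simp only at * <;> linarith) le_rfl
  rw [funext h.shell_zero] at h1
  have hm : ∀ x, bdry Ψ x ∈ starSet Ψ g ∩ G '' solidTorus := fun x => h.inter ▸ ⟨x, rfl⟩
  refine IsIncoming.flip (S := torus.toOrientedManifold) h1 isOpen_univ (fun _ => trivial) ?_ ?_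
    (fun x => (hm x).1)
  · rw [Set.union_comm, h.cover]
  · rw [Set.inter_comm (G '' solidTorus), h.inter]
    exact Set.inter_subset_right

theorem emb_rescale (h : IsClosedStar M p q Ψ g G) :
    IsOrientedEmbNear (plane.prod circle) M (G ∘ rescale 0 (1 / 2)) solidTorus := by
  refine h.emb.comp ⟨Set.univ, Set.subset_univ _, isOrientedEmbOn_rescale 0 (1 / 2) (by norm_num)⟩ ?_
  intro (x : ℂ × Circle) (hx : ‖x.1‖ ≤ 1)
  have h1 := norm_rescale_sub 0 (1 / 2) (by norm_num) x
  rw [Complex.ofReal_zero, sub_zero] at h1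
  change ‖(rescale 0 (1 / 2) x).1‖ ≤ 1
  rw [h1]
  linarith

theorem cover_shell (h : IsClosedStar M p q Ψ g G) : starSet Ψ g ∪ (G ∘ rescale 0 (1 / 2)) '' solidTorus ∪
      (G ∘ shell q) '' {x : (Circle × Circle) × ℝ | x.2 ∈ Set.Icc (0 : ℝ) 1} = Set.univ := by
  rw [image_shell, image_rescale]
  refine Set.eq_univ_of_forall fun y => ?_
  rcases (h.cover ▸ Set.mem_univ y : y ∈ starSet Ψ g ∪ G '' solidTorus) with hy | ⟨x, hx, rfl⟩
  · exact Or.inl (Or.inl hy)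
  · rcases le_total ‖x.1‖ (1 / 2) with h1 | h1
    · exact Or.inl (Or.inr ⟨x, h1, rfl⟩)
    · exact Or.inr ⟨x, ⟨h1, hx⟩, rfl⟩

/-- `G` meets the star only at modulus `1`. Shrinking the solid torus to radius `1/2` separates it
from the star and leaves room for the cylinder. -/
theorem disjoint_rescale (h : IsClosedStar M p q Ψ g G) : Disjoint (starSet Ψ g)
    ((G ∘ rescale 0 (1 / 2)) '' solidTorus) := by
  rw [image_rescale, Set.disjoint_left]
  rintro _ hy ⟨x, hx, rfl⟩
  have hx : ‖x.1‖ ≤ 1 / 2 := hx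
  have hx1 : x ∈ solidTorus := hx.trans (by norm_num)
  obtain ⟨u, hu⟩ : G x ∈ Set.range (bdry Ψ) := h.inter ▸ ⟨hy, x, hx1, rfl⟩
  rw [← h.glue_symm] at hu
  have := h.emb.injOn (Circle.norm_coe _).le hx1 hu
  rw [← this, Circle.norm_coe] at hx
  norm_num at hx

theorem inter_shell (h : IsClosedStar M p q Ψ g G) : starSet Ψ g ∩
    (G ∘ shell q) '' {x : (Circle × Circle) × ℝ | x.2 ∈ Set.Icc (0 : ℝ) 1} = Set.range (bdry Ψ) := by
  rw [image_shell]
  refine Set.Subset.antisymm ?_ ?_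
  · rw [← h.inter]
    exact Set.inter_subset_inter_right _ (Set.image_mono fun x hx => hx.2)
  · refine Set.subset_inter (h.inter ▸ Set.inter_subset_left) ?_
    rintro _ ⟨x, rfl⟩
    rw [← h.glue_symm]
    refine ⟨_, ⟨?_, (Circle.norm_coe _).le⟩, rfl⟩
    rw [Circle.norm_coe]
    norm_num

theorem inter_rescale_shell (h : IsClosedStar M p q Ψ g G) : (G ∘ rescale 0 (1 / 2)) '' solidTorus ∩
    (G ∘ shell q) '' {x : (Circle × Circle) × ℝ | x.2 ∈ Set.Icc (0 : ℝ) 1} =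
      Set.range (fun x : Circle × Circle =>
        bdry (G ∘ rescale 0 (1 / 2)) (twistInv q x : Circle × Circle)) := by
  refine Set.Subset.antisymm ?_ ?_
  · rw [image_shell, image_rescale]
    rintro _ ⟨⟨x, hx, rfl⟩, y, hy, hxy⟩
    have hx : ‖x.1‖ ≤ 1 / 2 := hx
    have := h.emb.injOn (show y ∈ solidTorus from hy.2) (show x ∈ solidTorus from hx.trans (by norm_num)) hxy
    subst this
    have hn : ‖y.1‖ = 1 / 2 := le_antisymm hx hy.1
    obtain ⟨u, hu⟩ := exists_shell q (a := y) (norm_pos_iff.1 (by rw [hn]; norm_num))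
    refine ⟨u, ?_⟩
    have e : (2 * (1 - ‖y.1‖)) = 1 := by rw [hn]; norm_num
    rw [e] at hu
    rw [← hu]
    exact (shell_one u).symm
  · rintro _ ⟨x, rfl⟩
    exact ⟨⟨_, (Circle.norm_coe _).le, rfl⟩, (x, 1), ⟨zero_le_one, le_rfl⟩, shell_one x⟩

/-- A closed star is the union of a star, a solid torus and a cylinder between them. -/
theorem isDecomposition (h : IsClosedStar M p q Ψ g G) :
    IsDecomposition M.toCobordism torus torus.neg.orient torus.neg.orient_locally_const
      (starSet Ψ g) ((G ∘ rescale 0 (1 / 2)) '' solidTorus)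
      ((G ∘ shell q) '' {x : (Circle × Circle) × ℝ | x.2 ∈ Set.Icc (0 : ℝ) 1}) (bdry Ψ)
      (bdry (G ∘ rescale 0 (1 / 2)) ∘ twistInv q) where
  isCompact_a := h.isStar.isCompact
  isCompact_b := h.emb_rescale.isCompact_image isCompact_solidTorus
  isCompact₂ := h.emb_shell.isCompact_image isCompact_interval
  outgoing_a := h.isOutgoing_shell
  -- Reparametrization by `twistInv q` makes `-torus` the boundary of this cap, as the evaluation
  -- cobordism requires.
  outgoing_b := HasCollar.reparam (isOutgoing_solidTorus h.emb_rescale) (twistInv q)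
  cover := h.cover_shell
  disjoint := h.disjoint_rescale
  inter_a := h.inter_shell
  inter_b := h.inter_rescale_shell
  disjoint_out := by
    rw [range_emptySurface]
    exact Set.disjoint_empty _

theorem isEvaluation_middle (h : IsClosedStar M p q Ψ g G) :
    h.isDecomposition.middle.IsEvaluation
      (torus.disjUnionDouble torus.neg.orient torus.neg.orient_locally_const :
        DisjUnion torus torus.neg _) :=
  ⟨G ∘ shell q, h.emb_shell, rfl, fun x => (h.shell_zero x).symm, fun x => (shell_one x).symm⟩

end IsClosedStar

end Closed

/-! ### From surgery on the link to a closed star -/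

section Surgery

/-- The diffeomorphism of `S³` carries tubes to tubes, hence exterior to exterior; precomposing the
embedding of the exterior with it transfers the surgery. -/
theorem FramedLink.IsSurgery.of_equivalent {ι : Type} {L L' : FramedLink ι} (h : L.Equivalent L')
    {M : ClosedManifold 3} (hM : L'.IsSurgery M) : L.IsSurgery M := by
  obtain ⟨F, hF⟩ := h
  obtain ⟨Φ, g, hΦ, hg, hglue, hcover, hd, hdg⟩ := hM
  have hbij : Function.Bijective (F : sphere3 → sphere3) := F.toEquiv.bijective
  have himage : F '' L.exterior = L'.exterior := by
    rw [FramedLink.exterior, FramedLink.exterior, Set.image_compl_eq hbij,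
      Set.image_iUnion]
    refine congrArg _ (Set.iUnion_congr fun k => ?_)
    rw [← Set.image_comp]
    exact Set.image_congr fun x hx => (hF k x (openSolidTorus_subset hx)).symm
  refine ⟨Φ ∘ F, g, hΦ.comp ⟨Set.univ, Set.subset_univ _, F.isOrientedEmbOn⟩ ?_, hg, ?_, ?_, ?_, hdg⟩
  · intro x hx
    rw [← himage]
    exact ⟨x, hx, rfl⟩
  · intro k z w
    rw [hglue, hF k _ (Circle.norm_coe _).le]
    rfl
  · rw [Set.image_comp, himage]
    exact hcover
  · intro k
    rw [Set.image_comp, himage]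
    exact hd k

/-- The framing only rotates each disk fibre, by `wᵖ`, so the tube as a set does not depend on it.
-/
theorem image_meridianFraming (c ρ : ℝ) (hρ : 0 < ρ) (p : ℤ) :
    meridianFraming c ρ p '' openSolidTorus =
      (fun x : ℂ × Circle => meridianPoint x.1 x.2) '' {x | ‖x.1 - c‖ < ρ} := by
  ext y
  constructor
  · rintro ⟨x, hx, rfl⟩
    have hx : ‖x.1‖ < 1 := hx
    refine ⟨(c + ρ * x.1 * ((x.2 ^ p : Circle) : ℂ), x.2), ?_, rfl⟩
    change ‖(c : ℂ) + ρ * x.1 * ((x.2 ^ p : Circle) : ℂ) - c‖ < ρ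
    rw [add_sub_cancel_left, norm_mul, norm_mul, Circle.norm_coe, Complex.norm_real,
      Real.norm_eq_abs, abs_of_pos hρ]
    nlinarith
  · rintro ⟨x, hx, rfl⟩
    have hx : ‖x.1 - c‖ < ρ := hx
    have hρ' : (ρ : ℂ) ≠ 0 := by exact_mod_cast hρ.ne'
    refine ⟨((x.1 - c) / ρ * ((x.2 ^ (-p) : Circle) : ℂ), x.2), ?_, ?_⟩
    · change ‖(x.1 - c) / ρ * ((x.2 ^ (-p) : Circle) : ℂ)‖ < 1
      rw [norm_mul, norm_div, Circle.norm_coe, Complex.norm_real, Real.norm_eq_abs, abs_of_pos hρ,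
        mul_one, div_lt_one hρ]
      exact hx
    · have : (c : ℂ) + ρ * ((x.1 - c) / ρ * ((x.2 ^ (-p) : Circle) : ℂ)) *
          ((x.2 ^ p : Circle) : ℂ) = x.1 := by
        have h1 : ((x.2 ^ (-p) : Circle) : ℂ) * ((x.2 ^ p : Circle) : ℂ) = 1 := by
          rw [← Circle.coe_mul, ← zpow_add, neg_add_cancel, zpow_zero, Circle.coe_one]
        rw [mul_assoc, mul_assoc, h1]
        field_simp
        ring
      simp only [meridianFraming, this]

theorem image_axisFraming (q : ℤ) : axisFraming q '' openSolidTorus =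
    (fun x : ℂ × Circle => axisPoint x.1 x.2) '' openSolidTorus := by
  ext y
  constructor
  · rintro ⟨x, hx, rfl⟩
    have hx : ‖x.1‖ < 1 := hx
    refine ⟨(x.1 * ((x.2 ^ q : Circle) : ℂ), x.2), ?_, rfl⟩
    change ‖x.1 * ((x.2 ^ q : Circle) : ℂ)‖ < 1
    rwa [norm_mul, Circle.norm_coe, mul_one]
  · rintro ⟨x, hx, rfl⟩
    have hx : ‖x.1‖ < 1 := hx
    refine ⟨(x.1 * ((x.2 ^ (-q) : Circle) : ℂ), x.2), ?_, ?_⟩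
    · change ‖x.1 * ((x.2 ^ (-q) : Circle) : ℂ)‖ < 1
      rwa [norm_mul, Circle.norm_coe, mul_one]
    · have : x.1 * ((x.2 ^ (-q) : Circle) : ℂ) * ((x.2 ^ q : Circle) : ℂ) = x.1 := by
        rw [mul_assoc, ← Circle.coe_mul, ← zpow_add, neg_add_cancel, zpow_zero, Circle.coe_one,
          mul_one]
      simp only [axisFraming, this]

theorem scale_eq {a b : ℝ} {x : ℂ} (hb : 0 < b) (h : a ^ 2 + b ^ 2 = 1) (hx : ‖x‖ = a / b) :
    scale x = b := by
  have : 1 + ‖x‖ ^ 2 = (b⁻¹) ^ 2 := by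
    rw [hx]
    field_simp
    linarith
  rw [scale, this, Real.sqrt_sq (by positivity), inv_inv]

/-- The 3-sphere is the union of two solid tori. -/
theorem sphere3_cases (y : sphere3) : (∃ b w, ‖b‖ < 1 ∧ axisPoint b w = y) ∨
    ∃ a w, ‖a‖ ≤ 1 ∧ meridianPoint a w = y := by
  obtain ⟨v, hv⟩ := (y : Metric.sphere (0 : EuclideanSpace ℝ (Fin 4)) 1)
  obtain ⟨⟨α, β⟩, rfl⟩ : ∃ x, vec4 x = v := by
    refine ⟨(⟨v 0, v 1⟩, ⟨v 2, v 3⟩), ?_⟩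
    rw [vec4_apply]
    ext i
    fin_cases i <;> simp
  have hn : ‖α‖ ^ 2 + ‖β‖ ^ 2 = 1 := by
    rw [mem_sphere_zero_iff_norm, norm_vec4, Real.sqrt_eq_one] at hv
    exact hv
  have hc : ∀ γ : ℂ, γ ≠ 0 → ∃ w : Circle, (w : ℂ) = γ / ‖γ‖ := fun γ hγ =>
    ⟨⟨γ / ‖γ‖, mem_sphere_zero_iff_norm.2 (by
      rw [norm_div, Complex.norm_real, norm_norm, div_self (by simpa using hγ)])⟩, rfl⟩
  -- The common boundary `‖α‖ = ‖β‖` goes to the meridian side, since only the open tube about the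
  -- axis is removed.
  rcases lt_or_ge ‖β‖ ‖α‖ with h | h
  · left
    have hα : 0 < ‖α‖ := (norm_nonneg _).trans_lt h
    obtain ⟨w, hw⟩ := hc α (norm_pos_iff.1 hα)
    have hb : ‖β / (‖α‖ : ℂ)‖ = ‖β‖ / ‖α‖ := by simp
    refine ⟨β / ‖α‖, w, by rw [hb, div_lt_one hα]; exact h, Subtype.ext ?_⟩
    change scale (β / ‖α‖) • vec4 (w, β / ‖α‖) = vec4 (α, β)
    rw [scale_eq hα (by linarith) hb, ← map_smul, hw]
    have hα' : (‖α‖ : ℂ) ≠ 0 := by exact_mod_cast hα.ne'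
    congr 1
    ext <;> simp [mul_div_cancel₀, hα']
  · right
    have hβ : 0 < ‖β‖ := by
      refine norm_pos_iff.2 fun h0 => ?_
      rw [h0, norm_zero] at h hn
      have := norm_nonneg α
      have h1 : ‖α‖ = 0 := le_antisymm h this
      rw [h1] at hn
      norm_num at hn
    obtain ⟨w, hw⟩ := hc β (norm_pos_iff.1 hβ)
    have hb : ‖α / (‖β‖ : ℂ)‖ = ‖α‖ / ‖β‖ := by simp
    refine ⟨α / ‖β‖, w, by rw [hb, div_le_one hβ]; exact h, Subtype.ext ?_⟩
    change scale (α / ‖β‖) • vec4 (α / ‖β‖, w) = vec4 (α, β)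
    rw [scale_eq hβ hn hb, ← map_smul, hw]
    have hβ' : (‖β‖ : ℂ) ≠ 0 := by exact_mod_cast hβ.ne'
    congr 1
    ext <;> simp [mul_div_cancel₀, hβ']

/-- On the common boundary torus the two coordinate systems exchange the circle factors: a meridian
of the axis is a longitude of the complementary solid torus. -/
theorem axisPoint_circle (z w : Circle) : axisPoint (w : ℂ) z = meridianPoint (z : ℂ) w := by
  refine Subtype.ext ?_
  change scale w • vec4 (z, w) = scale z • vec4 (z, w)
  rw [scale, scale, Circle.norm_coe, Circle.norm_coe]

/-- Removing the open tube of the axis leaves `‖a‖ ≤ 1` in meridian coordinates, as a point in both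
systems satisfies `‖a‖ ‖b‖ = 1`. There the tubes of the meridian circles are the holes times `S¹`.
-/
theorem exterior_starLink {r : ℕ} (q : ℤ) (p : Fin r → ℤ) : (starLink q p).exterior =
    (fun x : ℂ × Circle => meridianPoint x.1 x.2) '' holed r := by
  have hsome : ∀ k : Fin r, (starLink q p).h (some k) '' openSolidTorus =
      (fun x : ℂ × Circle => meridianPoint x.1 x.2) '' {x | ‖x.1 - centre k‖ < radius k} :=
    fun k => image_meridianFraming _ _ (radius_pos k) _
  have hnone : (starLink q p).h none '' openSolidTorus =
      (fun x : ℂ × Circle => axisPoint x.1 x.2) '' openSolidTorus := image_axisFraming q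
  ext y
  rw [FramedLink.exterior, Set.mem_compl_iff, Set.mem_iUnion, Option.exists, hnone]
  simp only [hsome]
  constructor
  · intro h
    rw [not_or, not_exists] at h
    rcases sphere3_cases y with ⟨b, w, hb, rfl⟩ | ⟨a, w, ha, rfl⟩
    · exact absurd ⟨(b, w), hb, rfl⟩ h.1
    · refine ⟨(a, w), ⟨ha, fun k hk => not_lt.1 fun hlt => h.2 ⟨k, hk⟩ ⟨(a, w), hlt, rfl⟩⟩, rfl⟩
  · rintro ⟨x, hx, rfl⟩ (⟨b, hb, hbx⟩ | ⟨k, b, hb, hbx⟩)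
    · have h1 := meridian_axis hbx.symm
      have h2 : ‖b.1‖ < 1 := hb
      have h3 := hx.1
      nlinarith [norm_nonneg x.1, norm_nonneg b.1]
    · have h1 := (meridian_eq hbx).1
      have h2 : ‖b.1 - centre k‖ < radius k := hb
      rw [h1] at h2
      exact absurd (hx.2 k k.2) (not_le.2 h2)

/-- In meridian coordinates the surgery map followed by the framing reads `(z, w) ↦ (w̄ zᵖ, z)` at a
hole. For the axis it gives the point with axis coordinates `(w̄ z^q, z)`, and the exchange of
circle factors makes this `(z, w̄ z^q)`, which is `torusTwist q`. -/
theorem FramedLink.IsSurgery.exists_isClosedStar {r : ℕ} {q : ℤ} {p : Fin r → ℤ}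
    {M : ClosedManifold 3} (h : (starLink q p).IsSurgery M) :
    ∃ Ψ g G, IsClosedStar M p q Ψ g G := by
  obtain ⟨Φ, g, hΦ, hg, hglue, hcover, hd, hdg⟩ := h
  rw [exterior_starLink] at hΦ hcover
  simp only [exterior_starLink, ← Set.image_comp] at hd
  rw [← Set.image_comp] at hcover
  refine ⟨Φ ∘ fun x : ℂ × Circle => meridianPoint x.1 x.2, fun k => g (some k), g none,
    ⟨?_, fun k => hg _, fun k z w => ?_, fun k => hd _, fun k l hkl => hdg _ _ (by simpa using hkl)⟩,
    hg _, fun x => ?_, ?_, hd _, fun k => hdg _ _ (by simp)⟩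
  · exact hΦ.comp ⟨Set.univ, Set.subset_univ _, isOrientedEmbOn_meridianPoint⟩
      fun x hx => ⟨x, hx, rfl⟩
  · rw [hglue]
    change Φ (meridianPoint _ z) = Φ (meridianPoint _ z)
    simp only [rescale, Circle.coe_mul, mul_assoc]
  · refine (hglue none x.1 x.2).trans (congrArg Φ ?_)
    have e : (torusTwist q x : Circle × Circle) = (x.1, x.2⁻¹ * x.1 ^ q) :=
      torusTwist_apply q x.1 x.2
    rw [e]
    change axisPoint (((x.2⁻¹ : Circle) : ℂ) * ((x.1 ^ q : Circle) : ℂ)) x.1 = _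
    rw [← Circle.coe_mul, axisPoint_circle]
  · rw [← hcover, starSet, Set.union_assoc]
    congr 1
    ext y
    simp only [Set.mem_union, Set.mem_iUnion, Option.exists]
    tauto

end Surgery

/-! ### The pairing and the invariant of the closed manifold -/

namespace TQFT.IsVerlindeBasis

variable {Z : TQFT} {m : ℕ} {v : Basis (Fin (m + 1)) ℂ (Z.V torus)}
  {S : Matrix (Fin (m + 1)) (Fin (m + 1)) ℂ} {t : Fin (m + 1) → ℂ}

/-- `S²` inverts both coordinates and commutes with `S` and `T^q`. Two of the three factors `S`
after `T^q` can therefore be applied first, where `Z(S)²` fixes `v 0`. -/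
theorem map_torusTwist (hv : Z.IsVerlindeBasis v S) (q : ℤ) : Z.map (torusTwist q) (v 0) =
    Z.map torusU (Z.map torusS (Z.map (torusTPowS q) (v 0))) := by
  have e : torusTwist q = (torusS.trans torusS).trans ((torusTPowS q).trans (torusS.trans torusU)) := by
    refine OrientedDiffeo.ext fun (x : Circle × Circle) => ?_
    refine (torusTwist_apply q x.1 x.2).trans ?_
    change ((x.1, x.2⁻¹ * x.1 ^ q) : Circle × Circle) =
      ((x.1⁻¹)⁻¹, (((x.2⁻¹)⁻¹ * (x.1⁻¹) ^ q))⁻¹)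
    simp [mul_comm]
  rw [e]
  simp only [Z.map_trans, LinearEquiv.trans_apply, hv.square_zero]

/-- The pairing given by the cylinder, evaluated on an idempotent. -/
theorem evaluation_idem (hv : Z.IsVerlindeBasis v S) {A : ClosedManifold 2}
    {d : DisjUnion torus torus.neg A} {W : Cobordism A emptySurface} (hW : W.IsEvaluation d)
    (l : Fin (m + 1)) (c : Fin (m + 1) → ℂ) :
    Z.ofEmpty.symm (Z.cob W (Z.tensor d
      (idem v S l ⊗ₜ Z.map torusU (Z.map torusS (∑ i, c i • v i))))) = S 0 l * c l := by
  -- Duality reads off the coefficient of `v k` in `Z(S) ∑ c i • v i`.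
  have hk : ∀ k, Z.ofEmpty.symm (Z.cob W (Z.tensor d
      (v k ⊗ₜ Z.map torusU (Z.map torusS (∑ i, c i • v i))))) = ∑ i, c i * S k i := by
    intro k
    simp only [map_sum, map_smul, hv.matrix_eq, TensorProduct.tmul_sum, TensorProduct.tmul_smul,
      hv.dual A d W hW, smul_eq_mul, mul_ite, mul_one, mul_zero, Finset.sum_ite_eq,
      Finset.mem_univ, if_true]
  generalize Z.map torusU (Z.map torusS (∑ i, c i • v i)) = y at hk ⊢
  simp only [idem, TensorProduct.sum_tmul, ← TensorProduct.smul_tmul', map_sum, map_smul, hk,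
    smul_eq_mul, Finset.mul_sum]
  rw [Finset.sum_comm]
  -- The idempotent has the conjugates of row `l` of `S` as coefficients, so unitarity undoes `Z(S)`
  -- and isolates `c l`.
  have h : ∀ i, ∑ k, S 0 l * starRingEnd ℂ (S l k) * (c i * S k i) =
      S 0 l * c i * (if l = i then 1 else 0) := by
    intro i
    rw [← hv.sum_conj_mul, Finset.mul_sum]
    exact Finset.sum_congr rfl fun k _ => by ring
  simp only [h, mul_ite, mul_one, mul_zero, Finset.sum_ite_eq, Finset.mem_univ, if_true]

theorem evaluation_sum (hv : Z.IsVerlindeBasis v S) {A : ClosedManifold 2}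
    {d : DisjUnion torus torus.neg A} {W : Cobordism A emptySurface} (hW : W.IsEvaluation d)
    (a c : Fin (m + 1) → ℂ) :
    Z.ofEmpty.symm (Z.cob W (Z.tensor d ((∑ l, a l • idem v S l) ⊗ₜ
      Z.map torusU (Z.map torusS (∑ i, c i • v i))))) = ∑ l, a l * (S 0 l * c l) := by
  rw [TensorProduct.sum_tmul, map_sum, map_sum, map_sum]
  refine Finset.sum_congr rfl fun l _ => ?_
  rw [← TensorProduct.smul_tmul', map_smul, map_smul, map_smul, hv.evaluation_idem hW, smul_eq_mul]

/-- The invariant is the pairing, through the cylinder, of the vector of the star with that of the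
last solid torus; the latter is `Z(torusTwist q) v₀`, because its boundary is parametrized through
the gluing map. -/
theorem closed_eq (hv : Z.IsVerlindeBasis v S) (ht : ∀ i, Z.map torusT (v i) = t i • v i)
    {M : ClosedManifold 3} {r : ℕ} {p : Fin r → ℤ} {q : ℤ} {Ψ : ℂ × Circle → M}
    {g : Fin r → ℂ × Circle → M} {G : ℂ × Circle → M} (h : IsClosedStar M p q Ψ g G) :
    Z.closed M = ∑ l, (∏ k, (∑ i, t i ^ p k * S i 0 * S i l) / S 0 l) *
      (S 0 l * (t l ^ q * S l 0)) := by
  have hd := h.isDecomposition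
  have ha := hv.cob_star ht r p (IsCap.toCobordism (S := torus) hd.isCap_a) Ψ g h.isStar rfl rfl
  have hb : IsCap.vector (S := torus.neg) hd.isCap_b Z =
      Z.map torusU (Z.map torusS (∑ i, (t i ^ q * S i 0) • v i)) := by
    have e : (bdry (G ∘ rescale 0 (1 / 2)) ∘ twistInv q) ∘ torusTwist q =
        bdry (G ∘ rescale 0 (1 / 2)) :=
      funext fun x => congrArg (bdry (G ∘ rescale 0 (1 / 2))) ((torusTwist q).symm_apply_apply x)
    have hc : IsCap torus M ((G ∘ rescale 0 (1 / 2)) '' solidTorus)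
        (bdry (G ∘ rescale 0 (1 / 2))) :=
      e ▸ IsCap.reparam (S := torus.neg) hd.isCap_b (torusTwist q)
    refine (IsCap.vector_eq_map Z hc hd.isCap_b (torusTwist q)
      (fun x => (congrFun e x).symm)).trans ?_
    refine (congrArg (Z.map (torusTwist q)) (IsCap.vector_solidTorus Z hv h.emb_rescale hc)).trans ?_
    rw [hv.map_torusTwist, hv.map_torusTPowS ht]
  rw [TQFT.closed, hd.cob_eq Z]
  refine (congrArg₂ (fun (x : Z.V torus) (y : Z.V torus.neg) => Z.ofEmpty.symm (Z.cob hd.middle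
    (Z.tensor (torus.disjUnionDouble torus.neg.orient torus.neg.orient_locally_const :
      DisjUnion torus torus.neg _) (x ⊗ₜ y)))) ha hb).trans ?_
  exact hv.evaluation_sum h.isEvaluation_middle _ _

end TQFT.IsVerlindeBasis

end TQFT3

theorem lemma4 (Z : TQFT3.TQFT) {m : ℕ}
    (v : Module.Basis (Fin (m + 1)) ℂ (Z.V TQFT3.torus))
    (S : Matrix (Fin (m + 1)) (Fin (m + 1)) ℂ) (hv : Z.IsVerlindeBasis v S)
    (t : Fin (m + 1) → ℂ) (ht : ∀ i, Z.map TQFT3.torusT (v i) = t i • v i)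
    (r : ℕ) (q : ℤ) (p : Fin r → ℤ) (L : TQFT3.FramedLink (Option (Fin r)))
    (hL : (TQFT3.starLink q p).Equivalent L)
    (M : TQFT3.ClosedManifold 3) (hM : L.IsSurgery M) :
    Z.closed M = ∑ i : Fin r → Fin (m + 1), ∑ j : Fin (m + 1),
      (∏ k, t (i k) ^ p k) * t j ^ q *
        (((∏ k, S (i k) 0) * ∏ k, S (i k) j) / S j 0 ^ ((r : ℤ) - 2)) := by
  obtain ⟨Ψ, g, G, h⟩ := (TQFT3.FramedLink.IsSurgery.of_equivalent hL hM).exists_isClosedStar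
  rw [hv.closed_eq ht h, Finset.sum_comm]
  refine Finset.sum_congr rfl fun j _ => ?_
  have hj := hv.ne_zero j
  have hs : S 0 j = S j 0 := hv.symmetric.apply j 0
  -- The product over `k` of sums over single indices expands to a sum over all index tuples `i`.
  -- Its denominator `S j 0 ^ r` meets the two factors `S j 0` from the pairing.
  rw [Finset.prod_div_distrib, Finset.prod_const, Finset.card_univ, Fintype.card_fin, hs,
    zpow_sub₀ hj, zpow_natCast, Finset.prod_univ_sum, Fintype.piFinset_univ, Finset.sum_div,
    Finset.sum_mul]
  refine Finset.sum_congr rfl fun i _ => ?_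
  rw [Finset.prod_mul_distrib, Finset.prod_mul_distrib]
  have h2 : S j 0 ^ (2 : ℤ) = S j 0 * S j 0 := zpow_two _
  rw [h2]
  field_simp
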